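/- All Hilbert spaces are finite dimensional and $\log$ is to base $2$. A state is a positive semidefinite operator of trace $1$; a missing register in a subscript means partial trace over it. For states $\rho,\rho'$ let $\mathrm F(\rho,\rho')=\|\sqrt{\rho}\sqrt{\rho'}\|_1$ and $\mathrm P(\rho,\rho')=\sqrt{1-\mathrm F(\rho,\rho')^2}$. For a state $\rho$ and a positive semidefinite $\sigma$ let $$\mathrm D_{\max}(\rho\|\sigma)=\inf\{\lambda\in\mathbb R:\rho\le 2^{\lambda}\sigma\},\qquad \mathrm D_{\mathrm H}^{\varepsilon}(\rho\|\sigma)=\sup_{0\le\Pi\le I,\ \mathrm{Tr}(\Pi\rho)\ge 1-\varepsilon^2}\log\frac{1}{\mathrm{Tr}(\Pi\sigma)}\in[-\infty,+\infty],$$ where $\log\frac10=+\infty$ and $\inf\emptyset=+\infty$. For a state $\rho_{AB}$ let $$\bar{\mathrm I}_{\max}^{\varepsilon,\delta}(A:B)_\rho=\min\{\mathrm D_{\max}(\rho'_{AB}\|\rho_A\otimes\rho_B):\ \rho'_{AB}\text{ a state},\ \mathrm P(\rho,\rho')\le\varepsilon,\ \rho'_A\le(1+\delta)\rho_A,\ \rho'_B\le(1+\delta)\rho_B\}.$$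 Let $\mathcal N_{F\to BC}$ be a quantum broadcast channel (a completely positive trace preserving map). An $(R_1,R_2,\eta)$ entanglement-assisted code for $\mathcal N$ consists of pure states $|\theta\rangle_{E_{A_1}E_B}$ (shared by Alice and Bob) and $|\theta\rangle_{E_{A_2}E_C}$ (shared by Alice and Charlie), an encoding quantum operation $\mathcal E:M_1M_2E_{A_1}E_{A_2}\to F$ for Alice, where the message registers $M_1,M_2$ carry message sets of sizes $\lceil 2^{R_1}\rceil,\lceil 2^{R_2}\rceil$, and decoding quantum operations $\mathcal D_B:BE_B\to M_1'$ for Bob and $\mathcal D_C:CE_C\to M_2'$ for Charlie, with $M_i'\equiv M_i$, such that for all $(m_1,m_2)$ $$\Pr\big((M_1',M_2')\ne(m_1,m_2)\mid(M_1,M_2)=(m_1,m_2)\big)\le\eta^2 .$$ The triple $(R_1,R_2,\eta)$ is achievable if such a code exists. **Theorem.** Let $\varepsilon,\delta>0$, let $\mathcal N_{F\to BC}$ be a quantum broadcast channel and let $\psi_{FA_1A_2}$ be a quantum state. Put $$D_1=\mathrm D_{\mathrm H}^{\varepsilon}\big(\mathrm{Tr}_C\mathcal N(\psi_{FA_1})\,\big\|\,\mathrm{Tr}_C\mathcal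 N(\psi_F)\otimes\psi_{A_1}\big),\qquad D_2=\mathrm D_{\mathrm H}^{\varepsilon}\big(\mathrm{Tr}_B\mathcal N(\psi_{FA_2})\,\big\|\,\mathrm{Tr}_B\mathcal N(\psi_F)\otimes\psi_{A_2}\big).$$ Then for all real $R_1,R_2$ with $$R_1\le D_1-5\log\tfrac1\delta-2,\qquad R_2\le D_2-5\log\tfrac1\delta-2,\qquad R_1+R_2\le D_1+D_2-\bar{\mathrm I}_{\max}^{\varepsilon,\delta}(A_1:A_2)_\psi-11\log\tfrac1\delta-5,$$ the triple $(R_1,R_2,4\varepsilon+9\sqrt\delta)$ is achievable. -/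

import Mathlib

open scoped Kronecker ComplexOrder MatrixOrder

universe u

namespace QBroadcast

noncomputable section

/-! Registers are finite types `A`; the Hilbert space of `A` is `ℂ^A` with its standard basis, and
operators on it are matrices indexed by `A`. A composite register is a product type. -/

section Registers

variable {A B R S : Type*}

/-- Density matrices (quantum states). -/
structure IsState [Fintype A] (ρ : Matrix A A ℂ) : Prop where
  posSemidef : ρ.PosSemidef
  trace_eq_one : ρ.trace = 1

/-- The Löwner order `X ≤ Y`: the matrix `Y - X` is positive semidefinite. -/
def Loewner (X Y : Matrix A A ℂ) : Prop := (Y - X).PosSemidef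

/-- Partial trace over the second factor. -/
def ptraceRight [Fintype R] : Matrix (A × R) (A × R) ℂ →ₗ[ℂ] Matrix A A ℂ where
  toFun X := Matrix.of fun a a' => ∑ r, X (a, r) (a', r)
  map_add' X Y := by ext a a'; simp [Finset.sum_add_distrib]
  map_smul' c X := by ext a a'; simp [Finset.mul_sum]

/-- Partial trace over the first factor. -/
def ptraceLeft [Fintype R] : Matrix (R × A) (R × A) ℂ →ₗ[ℂ] Matrix A A ℂ where
  toFun X := Matrix.of fun a a' => ∑ r, X (r, a) (r, a')
  map_add' X Y := by ext a a'; simp [Finset.sum_add_distrib]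
  map_smul' c X := by ext a a'; simp [Finset.mul_sum]

/-- The map `Φ ⊗ id_R`: apply `Φ` to the first factor of a bipartite operator. -/
def onLeft (R : Type*) (Φ : Matrix A A ℂ →ₗ[ℂ] Matrix B B ℂ) :
    Matrix (A × R) (A × R) ℂ →ₗ[ℂ] Matrix (B × R) (B × R) ℂ where
  toFun X := Matrix.of fun x y => Φ (Matrix.of fun a a' => X (a, x.2) (a', y.2)) x.1 y.1
  map_add' X Y := by
    ext x y
    exact congrFun (congrFun (Φ.map_add (Matrix.of fun a a' => X (a, x.2) (a', y.2))
      (Matrix.of fun a a' => Y (a, x.2) (a', y.2))) x.1) y.1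
  map_smul' c X := by
    ext x y
    exact congrFun (congrFun (Φ.map_smul c (Matrix.of fun a a' => X (a, x.2) (a', y.2))) x.1) y.1

/-- The map `id_R ⊗ Φ`: apply `Φ` to the second factor of a bipartite operator. -/
def onRight (R : Type*) (Φ : Matrix A A ℂ →ₗ[ℂ] Matrix B B ℂ) :
    Matrix (R × A) (R × A) ℂ →ₗ[ℂ] Matrix (R × B) (R × B) ℂ where
  toFun X := Matrix.of fun x y => Φ (Matrix.of fun a a' => X (x.1, a) (y.1, a')) x.2 y.2
  map_add' X Y := by
    ext x y
    exact congrFun (congrFun (Φ.map_add (Matrix.of fun a a' => X (x.1, a) (y.1, a'))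
      (Matrix.of fun a a' => Y (x.1, a) (y.1, a'))) x.2) y.2
  map_smul' c X := by
    ext x y
    exact congrFun (congrFun (Φ.map_smul c (Matrix.of fun a a' => X (x.1, a) (y.1, a'))) x.2) y.2

/-- The tensor product `Φ ⊗ Ψ` of two maps. -/
def tensorMap {A' B' : Type*} (Φ : Matrix A A ℂ →ₗ[ℂ] Matrix B B ℂ)
    (Ψ : Matrix A' A' ℂ →ₗ[ℂ] Matrix B' B' ℂ) :
    Matrix (A × A') (A × A') ℂ →ₗ[ℂ] Matrix (B × B') (B × B') ℂ :=
  onRight B Ψ ∘ₗ onLeft A' Φ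

/-- Quantum maps: linear maps that are completely positive and trace preserving. -/
structure IsCPTP [Fintype A] [Fintype B] (Φ : Matrix A A ℂ →ₗ[ℂ] Matrix B B ℂ) : Prop where
  completelyPositive : ∀ (k : ℕ) (X : Matrix (Fin k × A) (Fin k × A) ℂ),
    X.PosSemidef → (onRight (Fin k) Φ X).PosSemidef
  tracePreserving : ∀ X : Matrix A A ℂ, (Φ X).trace = X.trace

/-- The rank-one operator `|v⟩⟨v|`. -/
def ketbra (v : A → ℂ) : Matrix A A ℂ := Matrix.vecMulVec v (star v)

end Registers

section Information

variable {A B : Type*} [Fintype A] [DecidableEq A] [Fintype B] [DecidableEq B]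

/-- The trace norm `Tr √(X† X)`. -/
def traceNorm (X : Matrix A A ℂ) : ℝ := (CFC.sqrt (X.conjTranspose * X)).trace.re

/-- Fidelity `‖√ρ √σ‖₁`. -/
def fidelity (ρ σ : Matrix A A ℂ) : ℝ := traceNorm (CFC.sqrt ρ * CFC.sqrt σ)

/-- Purified distance. -/
def purifiedDist (ρ σ : Matrix A A ℂ) : ℝ := Real.sqrt (1 - fidelity ρ σ ^ 2)

/-- `log₂ (1 / x)` for `x ≥ 0`, with the value `+∞` at `x = 0`. -/
def logInv (x : ℝ) : EReal := if x ≤ 0 then ⊤ else ((Real.logb 2 (1 / x) : ℝ) : EReal)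

/-- Max-relative entropy (it is `+∞` if the support condition fails). -/
def dMax (ρ σ : Matrix A A ℂ) : EReal :=
  ⨅ (l : ℝ) (_ : Loewner ρ (((2 : ℝ) ^ l) • σ)), (l : EReal)

/-- Smooth min-relative entropy (hypothesis testing relative entropy); the tests satisfy
`Tr (Π ρ) ≥ 1 - ε²`. -/
def dH (ε : ℝ) (ρ σ : Matrix A A ℂ) : EReal :=
  ⨆ (T : Matrix A A ℂ) (_ : Loewner 0 T ∧ Loewner T 1 ∧ 1 - ε ^ 2 ≤ (T * ρ).trace.re),
    logInv (T * σ).trace.re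

/-- Restricted smooth max-information of a bipartite state `ρ` on `A B`: the infimum runs over
the states `ρ'` in the `ε`-ball (purified distance) around `ρ` whose marginals are bounded by
`1 + δ` times those of `ρ`. -/
def restrictedIMax (ε δ : ℝ) (ρ : Matrix (A × B) (A × B) ℂ) : EReal :=
  ⨅ (ρ' : Matrix (A × B) (A × B) ℂ)
    (_ : IsState ρ' ∧ purifiedDist ρ ρ' ≤ ε ∧
      Loewner (ptraceRight ρ') ((1 + δ) • ptraceRight ρ) ∧
      Loewner (ptraceLeft ρ') ((1 + δ) • ptraceLeft ρ)),
    dMax ρ' (ptraceRight ρ ⊗ₖ ptraceLeft ρ)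

end Information

section Coding

/-- An entanglement-assisted code for a broadcast channel with input `F` and outputs `B`, `C`,
with `M₁` messages for the first receiver and `M₂` messages for the second one: pure entangled
states `θ₁` (sender and first receiver) and `θ₂` (sender and second receiver), an encoding
operation and two local decoding operations. -/
structure BroadcastCode (F B C : Type u) [Fintype F] [Fintype B] [Fintype C] (M₁ M₂ : ℕ) where
  /-- Sender's part of `θ₁`. -/
  EA₁ : Type u
  /-- First receiver's part of `θ₁`. -/
  EB : Type u
  /-- Sender's part of `θ₂`. -/
  EA₂ : Type u
  /-- Second receiver's part of `θ₂`. -/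
  EC : Type u
  [fintypeEA₁ : Fintype EA₁]
  [fintypeEB : Fintype EB]
  [fintypeEA₂ : Fintype EA₂]
  [fintypeEC : Fintype EC]
  /-- Entanglement between the sender and the first receiver. -/
  θ₁ : EA₁ × EB → ℂ
  /-- Entanglement between the sender and the second receiver. -/
  θ₂ : EA₂ × EC → ℂ
  norm_θ₁ : ∑ x, ‖θ₁ x‖ ^ 2 = 1
  norm_θ₂ : ∑ x, ‖θ₂ x‖ ^ 2 = 1
  /-- The sender's encoding operation. -/
  enc : Matrix ((Fin M₁ × Fin M₂) × (EA₁ × EA₂)) ((Fin M₁ × Fin M₂) × (EA₁ × EA₂)) ℂ →ₗ[ℂ]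
    Matrix F F ℂ
  /-- The first receiver's decoding operation. -/
  decB : Matrix (B × EB) (B × EB) ℂ →ₗ[ℂ] Matrix (Fin M₁) (Fin M₁) ℂ
  /-- The second receiver's decoding operation. -/
  decC : Matrix (C × EC) (C × EC) ℂ →ₗ[ℂ] Matrix (Fin M₂) (Fin M₂) ℂ
  enc_isCPTP : IsCPTP enc
  decB_isCPTP : IsCPTP decB
  decC_isCPTP : IsCPTP decC

namespace BroadcastCode

variable {F B C : Type u} [Fintype F] [Fintype B] [Fintype C] {M₁ M₂ : ℕ}

/-- `|m₁ m₂⟩⟨m₁ m₂| ⊗ θ₁ ⊗ θ₂`, with the sender's registers in the first factor and the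
receivers' registers `EB`, `EC` in the second one. -/
def initialState (c : BroadcastCode F B C M₁ M₂) (m₁ : Fin M₁) (m₂ : Fin M₂) :
    Matrix (((Fin M₁ × Fin M₂) × (c.EA₁ × c.EA₂)) × (c.EB × c.EC))
      (((Fin M₁ × Fin M₂) × (c.EA₁ × c.EA₂)) × (c.EB × c.EC)) ℂ :=
  let shared : Matrix ((c.EA₁ × c.EA₂) × (c.EB × c.EC)) ((c.EA₁ × c.EA₂) × (c.EB × c.EC)) ℂ :=
    (ketbra c.θ₁ ⊗ₖ ketbra c.θ₂).submatrix
      (Equiv.prodProdProdComm c.EA₁ c.EA₂ c.EB c.EC) (Equiv.prodProdProdComm c.EA₁ c.EA₂ c.EB c.EC)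
  (Matrix.single (m₁, m₂) (m₁, m₂) (1 : ℂ) ⊗ₖ shared).submatrix
    (Equiv.prodAssoc _ _ _) (Equiv.prodAssoc _ _ _)

/-- The state held by the two receivers after the use of the channel, grouped as
(first receiver, second receiver). -/
def receivedState (c : BroadcastCode F B C M₁ M₂)
    (N : Matrix F F ℂ →ₗ[ℂ] Matrix (B × C) (B × C) ℂ) (m₁ : Fin M₁) (m₂ : Fin M₂) :
    Matrix ((B × c.EB) × (C × c.EC)) ((B × c.EB) × (C × c.EC)) ℂ :=
  (onLeft (c.EB × c.EC) N (onLeft (c.EB × c.EC) c.enc (c.initialState m₁ m₂))).submatrix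
    (Equiv.prodProdProdComm B c.EB C c.EC) (Equiv.prodProdProdComm B c.EB C c.EC)

/-- The state of the output registers `M₁' M₂'` when the message pair is `(m₁, m₂)`. -/
def outputState (c : BroadcastCode F B C M₁ M₂)
    (N : Matrix F F ℂ →ₗ[ℂ] Matrix (B × C) (B × C) ℂ) (m₁ : Fin M₁) (m₂ : Fin M₂) :
    Matrix (Fin M₁ × Fin M₂) (Fin M₁ × Fin M₂) ℂ :=
  tensorMap c.decB c.decC (c.receivedState N m₁ m₂)

/-- `Pr((M₁', M₂') ≠ (m₁, m₂) | (M₁, M₂) = (m₁, m₂))`, the output registers being read in the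
computational basis. -/
def errorProb (c : BroadcastCode F B C M₁ M₂)
    (N : Matrix F F ℂ →ₗ[ℂ] Matrix (B × C) (B × C) ℂ) (m₁ : Fin M₁) (m₂ : Fin M₂) : ℝ :=
  ∑ m ∈ Finset.univ.erase (m₁, m₂), (c.outputState N m₁ m₂ m m).re

end BroadcastCode

/-- The triple `(R₁, R₂, η)` is achievable: there is an entanglement-assisted code with message
sets of sizes `⌈2 ^ R₁⌉` and `⌈2 ^ R₂⌉` whose error probability is at most `η²` for every message
pair. -/
def IsAchievable {F B C : Type u} [Fintype F] [Fintype B] [Fintype C]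
    (N : Matrix F F ℂ →ₗ[ℂ] Matrix (B × C) (B × C) ℂ) (R₁ R₂ η : ℝ) : Prop :=
  ∃ c : BroadcastCode F B C ⌈(2 : ℝ) ^ R₁⌉₊ ⌈(2 : ℝ) ^ R₂⌉₊,
    ∀ m₁ m₂, c.errorProb N m₁ m₂ ≤ η ^ 2

end Coding

section Marginals

variable {F A₁ A₂ : Type*}

/-- The marginal on `F A₁` of an operator on `F A₁ A₂`. -/
def margFA₁ [Fintype A₂] (ψ : Matrix (F × A₁ × A₂) (F × A₁ × A₂) ℂ) :
    Matrix (F × A₁) (F × A₁) ℂ := onRight F ptraceRight ψ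

/-- The marginal on `F A₂` of an operator on `F A₁ A₂`. -/
def margFA₂ [Fintype A₁] (ψ : Matrix (F × A₁ × A₂) (F × A₁ × A₂) ℂ) :
    Matrix (F × A₂) (F × A₂) ℂ := onRight F ptraceLeft ψ

/-- The marginal on `A₁ A₂` of an operator on `F A₁ A₂`. -/
def margA₁A₂ [Fintype F] (ψ : Matrix (F × A₁ × A₂) (F × A₁ × A₂) ℂ) :
    Matrix (A₁ × A₂) (A₁ × A₂) ℂ := ptraceLeft ψ

end Marginals

/-- `D_H^ε(E(ω_{FA}) ‖ E(ω_F) ⊗ ω_A)` for a state `ω` on `F A` and a map `E` on `F`. -/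
def channelDH {F G A : Type*} [Fintype F] [Fintype G] [DecidableEq G] [Fintype A] [DecidableEq A]
    (ε : ℝ) (E : Matrix F F ℂ →ₗ[ℂ] Matrix G G ℂ) (ω : Matrix (F × A) (F × A) ℂ) : EReal :=
  dH ε (onLeft A E ω) (E (ptraceRight ω) ⊗ₖ ptraceLeft ω)

end

end QBroadcast

/-!
The code is built from independent copies of the marginals `ρ₁ = ψ_{A₁}` and `ρ₂ = ψ_{A₂}`: the
sender and the first receiver share a purification of `ρ₁^{⊗ J}`, where `J` consists of one block
of `K₁` positions for each message `m₁`, and likewise for `ρ₂^{⊗ L}` and the second receiver. To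
send `(m₁, m₂)` the sender acts on the purifying registers in such a way that, for a random
position `j` in the block of `m₁` and a random position `k` in the block of `m₂`, the channel input
together with the copies `j` and `k` of the receivers is in the state `ψ`, all other copies being
untouched.

*Encoding* (`exists_encoder`). Steering the canonical purification of `Θ²`, with
`Θ = √ρ₁^{⊗ J} ⊗ √ρ₂^{⊗ L}`, by the channel with Choi operator `Γ` produces `(1 ⊗ Θ) Γ (1 ⊗ Θ)`. So
one only needs a positive semidefinite `Γ` with marginal `1` for which this operator is dominated by
a constant multiple of the desired mixture plus a remainder of small trace; no purified distance
between global states is estimated. The state `ψ_{A₁A₂}` is first replaced by the nearby state `ω`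
that realises the restricted max-information, and `ψ` by an extension of `ω`
(`exists_extension`, a one-sided Uhlmann theorem). The candidate operator `Y` obtained from it has
a marginal `Z` that averages `(ρ₁ ⊗ ρ₂)^{-1/2} ω (ρ₁ ⊗ ρ₂)^{-1/2}` over the pairs `(j, k)`. Its mean
in the state `Θ²` is `1` and its second moment is at most `1 + 2^I / (K₁ K₂) + δ / K₁ + δ / K₂`
(`trace_avgIns_sq_le`, a bipartite convex split lemma): pairs of positions that share no index are
uncorrelated, pairs that share one index are controlled by the domination of the marginals of `ω`,
and equal pairs by `D_max`. Then `X Y X` with `X = 2 (1 + Z)⁻¹` is almost a Choi operator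
(`exists_choi_of_second_moment`).

*Decoding* (`exists_positionDecoder`). Each receiver applies the pretty good measurement built from
a near-optimal test at every position, and outputs the block of the position found. The
Hayashi–Nagaoka inequality bounds its error by the two error probabilities of the test, the one of
the second kind being multiplied by the number of positions.

*Parameters* (`exists_real_rates`, `exists_block_sizes`). The blocks are taken as large as decoding
permits; the sum rate constraint says that `2^I / (K₁ K₂)` is then at most `δ`. A receiver with a
single message need not decode, so that its number of positions is free. The total error
probability is at most `15 ε² + 37 δ` (`exists_code`). For `δ > 1/2` the required error bound exceeds
`1` and every code will do.
-/

namespace QBroadcast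

open Matrix

noncomputable section

/-! ### Partial traces and product maps -/

section LinearMaps

variable {A B R S W : Type*}

theorem ptraceRight_kronecker [Fintype R] (X : Matrix A A ℂ) (Y : Matrix R R ℂ) :
    ptraceRight (X ⊗ₖ Y) = Y.trace • X := by
  ext a a'
  simp [ptraceRight, Matrix.trace, Finset.mul_sum, mul_comm]

theorem ptraceLeft_kronecker [Fintype R] (X : Matrix R R ℂ) (Y : Matrix A A ℂ) :
    ptraceLeft (X ⊗ₖ Y) = X.trace • Y := by
  ext a a'
  simp [ptraceLeft, Matrix.trace, Finset.sum_mul]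

theorem onLeft_kronecker (Φ : Matrix A A ℂ →ₗ[ℂ] Matrix B B ℂ) (X : Matrix A A ℂ)
    (Y : Matrix R R ℂ) : onLeft R Φ (X ⊗ₖ Y) = Φ X ⊗ₖ Y := by
  ext x y
  have h : (Matrix.of fun a a' => (X ⊗ₖ Y) (a, x.2) (a', y.2)) = Y x.2 y.2 • X := by
    ext a a'
    simp [mul_comm]
  simp only [onLeft, LinearMap.coe_mk, AddHom.coe_mk, Matrix.of_apply]
  rw [h, map_smul]
  simp [mul_comm]

theorem onRight_kronecker (Φ : Matrix A A ℂ →ₗ[ℂ] Matrix B B ℂ) (X : Matrix R R ℂ)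
    (Y : Matrix A A ℂ) : onRight R Φ (X ⊗ₖ Y) = X ⊗ₖ Φ Y := by
  ext x y
  have h : (Matrix.of fun a a' => (X ⊗ₖ Y) (x.1, a) (y.1, a')) = X x.1 y.1 • Y := by
    ext a a'
    simp
  simp only [onRight, LinearMap.coe_mk, AddHom.coe_mk, Matrix.of_apply]
  rw [h, map_smul]
  simp

theorem tensorMap_kronecker {A' B' : Type*} (Φ : Matrix A A ℂ →ₗ[ℂ] Matrix B B ℂ)
    (Ψ : Matrix A' A' ℂ →ₗ[ℂ] Matrix B' B' ℂ) (X : Matrix A A ℂ) (Y : Matrix A' A' ℂ) :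
    tensorMap Φ Ψ (X ⊗ₖ Y) = Φ X ⊗ₖ Ψ Y := by
  simp [tensorMap, onLeft_kronecker, onRight_kronecker]

/-- Linear maps on bipartite operators are determined by their values on tensor products. -/
theorem linearMap_ext_kronecker [Finite A] [Finite B] {E : Type*} [AddCommMonoid E] [Module ℂ E]
    {f g : Matrix (A × B) (A × B) ℂ →ₗ[ℂ] E}
    (h : ∀ (X : Matrix A A ℂ) (Y : Matrix B B ℂ), f (X ⊗ₖ Y) = g (X ⊗ₖ Y)) : f = g := by
  classical
  cases nonempty_fintype A
  cases nonempty_fintype B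
  refine Matrix.ext_linearMap _ fun p q => ?_
  ext
  have := h (Matrix.single p.1 q.1 1) (Matrix.single p.2 q.2 1)
  rw [Matrix.single_kronecker_single] at this
  simpa using this

theorem trace_ptraceRight [Fintype A] [Fintype R] (X : Matrix (A × R) (A × R) ℂ) :
    (ptraceRight X).trace = X.trace := by
  simp [ptraceRight, Matrix.trace, Fintype.sum_prod_type]

theorem trace_ptraceLeft [Fintype A] [Fintype R] (X : Matrix (R × A) (R × A) ℂ) :
    (ptraceLeft X).trace = X.trace := by
  simp only [ptraceLeft, Matrix.trace, Fintype.sum_prod_type, LinearMap.coe_mk, AddHom.coe_mk,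
    Matrix.of_apply, Matrix.diag]
  exact Finset.sum_comm

theorem ptraceLeft_onRight [Fintype R] (Φ : Matrix A A ℂ →ₗ[ℂ] Matrix B B ℂ)
    (X : Matrix (R × A) (R × A) ℂ) : ptraceLeft (onRight R Φ X) = Φ (ptraceLeft X) := by
  have h : ptraceLeft X = ∑ r, (Matrix.of fun a a' => X (r, a) (r, a')) := by
    ext a a'
    simp [ptraceLeft, Matrix.sum_apply]
  rw [h, map_sum]
  ext b b'
  simp [ptraceLeft, onRight, Matrix.sum_apply]

theorem ptraceRight_onLeft [Fintype R] (Φ : Matrix A A ℂ →ₗ[ℂ] Matrix B B ℂ)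
    (X : Matrix (A × R) (A × R) ℂ) : ptraceRight (onLeft R Φ X) = Φ (ptraceRight X) := by
  have h : ptraceRight X = ∑ r, (Matrix.of fun a a' => X (a, r) (a', r)) := by
    ext a a'
    simp [ptraceRight, Matrix.sum_apply]
  rw [h, map_sum]
  ext b b'
  simp [ptraceRight, onLeft, Matrix.sum_apply]

theorem trace_mul_kronecker_one [Fintype A] [Fintype R] [DecidableEq R] (T : Matrix A A ℂ)
    (X : Matrix (A × R) (A × R) ℂ) :
    ((T ⊗ₖ (1 : Matrix R R ℂ)) * X).trace = (T * ptraceRight X).trace := by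
  have : (Matrix.traceLinearMap (A × R) ℂ ℂ ∘ₗ LinearMap.mulLeft ℂ (T ⊗ₖ (1 : Matrix R R ℂ))) =
      Matrix.traceLinearMap A ℂ ℂ ∘ₗ LinearMap.mulLeft ℂ T ∘ₗ ptraceRight := by
    refine linearMap_ext_kronecker fun X Y => ?_
    simp [← Matrix.mul_kronecker_mul, Matrix.trace_kronecker, ptraceRight_kronecker, mul_comm]
  exact LinearMap.congr_fun this X

theorem trace_mul_one_kronecker [Fintype A] [Fintype R] [DecidableEq R] (T : Matrix A A ℂ)
    (X : Matrix (R × A) (R × A) ℂ) :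
    (((1 : Matrix R R ℂ) ⊗ₖ T) * X).trace = (T * ptraceLeft X).trace := by
  have : (Matrix.traceLinearMap (R × A) ℂ ℂ ∘ₗ LinearMap.mulLeft ℂ ((1 : Matrix R R ℂ) ⊗ₖ T)) =
      Matrix.traceLinearMap A ℂ ℂ ∘ₗ LinearMap.mulLeft ℂ T ∘ₗ ptraceLeft := by
    refine linearMap_ext_kronecker fun X Y => ?_
    simp [← Matrix.mul_kronecker_mul, Matrix.trace_kronecker, ptraceLeft_kronecker]
  exact LinearMap.congr_fun this X

theorem ptraceLeft_conj [Fintype A] [Fintype R] [DecidableEq R] (S T : Matrix A A ℂ)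
    (X : Matrix (R × A) (R × A) ℂ) :
    ptraceLeft (((1 : Matrix R R ℂ) ⊗ₖ S) * X * ((1 : Matrix R R ℂ) ⊗ₖ T)) =
      S * ptraceLeft X * T := by
  have : (ptraceLeft ∘ₗ LinearMap.mulRight ℂ ((1 : Matrix R R ℂ) ⊗ₖ T) ∘ₗ
      LinearMap.mulLeft ℂ ((1 : Matrix R R ℂ) ⊗ₖ S)) =
      LinearMap.mulRight ℂ T ∘ₗ LinearMap.mulLeft ℂ S ∘ₗ ptraceLeft := by
    refine linearMap_ext_kronecker fun X Y => ?_
    simp [← Matrix.mul_kronecker_mul, ptraceLeft_kronecker]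
  exact LinearMap.congr_fun this X

theorem ptraceRight_conj [Fintype A] [Fintype R] [DecidableEq R] (S T : Matrix A A ℂ)
    (X : Matrix (A × R) (A × R) ℂ) :
    ptraceRight ((S ⊗ₖ (1 : Matrix R R ℂ)) * X * (T ⊗ₖ (1 : Matrix R R ℂ))) =
      S * ptraceRight X * T := by
  have : (ptraceRight ∘ₗ LinearMap.mulRight ℂ (T ⊗ₖ (1 : Matrix R R ℂ)) ∘ₗ
      LinearMap.mulLeft ℂ (S ⊗ₖ (1 : Matrix R R ℂ))) =
      LinearMap.mulRight ℂ T ∘ₗ LinearMap.mulLeft ℂ S ∘ₗ ptraceRight := by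
    refine linearMap_ext_kronecker fun X Y => ?_
    simp [← Matrix.mul_kronecker_mul, ptraceRight_kronecker]
  exact LinearMap.congr_fun this X

end LinearMaps

/-! ### Completely positive maps -/

section CompletePositivity

variable {A B C D R W : Type*}

/-- Complete positivity, with ancillas `ℂ^k` as in `IsCPTP`. -/
def IsCP (Φ : Matrix A A ℂ →ₗ[ℂ] Matrix B B ℂ) : Prop :=
  ∀ (k : ℕ) (X : Matrix (Fin k × A) (Fin k × A) ℂ), X.PosSemidef →
    (onRight (Fin k) Φ X).PosSemidef

theorem IsCP.onRight [Finite W] {Φ : Matrix A A ℂ →ₗ[ℂ] Matrix B B ℂ} (h : IsCP Φ)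
    {X : Matrix (W × A) (W × A) ℂ} (hX : X.PosSemidef) : (onRight W Φ X).PosSemidef := by
  cases nonempty_fintype W
  let e := Fintype.equivFin W
  have h1 := (h _ _ (hX.submatrix (Prod.map e.symm id : Fin _ × A → W × A))).submatrix
    (Prod.map e id : W × B → Fin _ × B)
  convert h1 using 1
  ext x y
  simp [QBroadcast.onRight]

theorem IsCP.onLeft [Finite W] {Φ : Matrix A A ℂ →ₗ[ℂ] Matrix B B ℂ} (h : IsCP Φ)
    {X : Matrix (A × W) (A × W) ℂ} (hX : X.PosSemidef) : (onLeft W Φ X).PosSemidef :=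
  (h.onRight (hX.submatrix (Prod.swap : W × A → A × W))).submatrix (Prod.swap : B × W → W × B)

theorem IsCP.tensorMap [Finite B] [Finite C] {Φ : Matrix A A ℂ →ₗ[ℂ] Matrix B B ℂ}
    {Ψ : Matrix C C ℂ →ₗ[ℂ] Matrix D D ℂ}
    (hΦ : IsCP Φ) (hΨ : IsCP Ψ) : IsCP (tensorMap Φ Ψ) := by
  intro k X hX
  have h1 := hΦ.onRight (W := Fin k × C) (hX.submatrix
    (fun x : (Fin k × C) × A => (x.1.1, x.2, x.1.2)))
  have h2 := hΨ.onRight (W := Fin k × B) (h1.submatrix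
    (fun x : (Fin k × B) × C => ((x.1.1, x.2), x.1.2)))
  exact h2.submatrix (fun x : Fin k × B × D => ((x.1, x.2.1), x.2.2))

theorem IsCP.comp {Φ : Matrix A A ℂ →ₗ[ℂ] Matrix B B ℂ} {Ψ : Matrix B B ℂ →ₗ[ℂ] Matrix C C ℂ}
    (hΨ : IsCP Ψ) (hΦ : IsCP Φ) : IsCP (Ψ ∘ₗ Φ) :=
  fun k _ hX => hΨ k _ (hΦ k _ hX)

theorem IsCPTP.isCP [Fintype A] [Fintype B] {Φ : Matrix A A ℂ →ₗ[ℂ] Matrix B B ℂ}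
    (h : IsCPTP Φ) : IsCP Φ :=
  h.completelyPositive

theorem ptraceRight_posSemidef [Fintype B] {X : Matrix (A × B) (A × B) ℂ} (hX : X.PosSemidef) :
    (ptraceRight X).PosSemidef := by
  have : ptraceRight X = ∑ r, X.submatrix (fun a => (a, r)) (fun a => (a, r)) := by
    ext; simp [ptraceRight, Matrix.sum_apply]
  rw [this]
  exact Matrix.posSemidef_sum _ fun r _ => hX.submatrix _

theorem ptraceLeft_posSemidef [Fintype A] {X : Matrix (A × B) (A × B) ℂ} (hX : X.PosSemidef) :
    (ptraceLeft X).PosSemidef := by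
  have : ptraceLeft X = ∑ r, X.submatrix (fun a => (r, a)) (fun a => (r, a)) := by
    ext; simp [ptraceLeft, Matrix.sum_apply]
  rw [this]
  exact Matrix.posSemidef_sum _ fun r _ => hX.submatrix _

/-- The completely positive map with Choi operator `Γ`, whose first factor is the output. -/
def choiMap [Fintype A] (Γ : Matrix (B × A) (B × A) ℂ) : Matrix A A ℂ →ₗ[ℂ] Matrix B B ℂ where
  toFun X := Matrix.of fun b b' => ∑ a, ∑ a', Γ (b, a) (b', a') * X a a'
  map_add' X Y := by ext; simp [mul_add, Finset.sum_add_distrib]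
  map_smul' c X := by ext; simp [Finset.mul_sum, mul_left_comm]

theorem choiMap_isCPTP [Fintype A] [Fintype B] [DecidableEq A] {Γ : Matrix (B × A) (B × A) ℂ}
    (hΓ : Γ.PosSemidef) (h1 : ptraceLeft Γ = 1) : IsCPTP (choiMap Γ) where
  completelyPositive k X hX := by
    classical
    -- `choiMap Γ X` is the compression of `Γ ⊗ X` by the unnormalised maximally entangled vector
    let K : Matrix ((B × A) × (Fin k × A)) (Fin k × B) ℂ := Matrix.of fun x y =>
      if x.1.1 = y.2 ∧ x.2.1 = y.1 ∧ x.1.2 = x.2.2 then (1 : ℂ) else 0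
    suffices h : onRight (Fin k) (choiMap Γ) X = Kᴴ * (Γ ⊗ₖ X) * K by
      rw [h]
      exact (hΓ.kronecker hX).conjTranspose_mul_mul_same K
    ext x y
    simp only [Matrix.mul_apply, Fintype.sum_prod_type, onRight, choiMap, K, LinearMap.coe_mk,
      AddHom.coe_mk, Matrix.of_apply, Matrix.conjTranspose_apply, Matrix.kronecker_apply,
      apply_ite star, star_one, star_zero, ite_and, ite_mul, mul_ite, one_mul, mul_one, zero_mul,
      mul_zero, Finset.sum_ite_eq, Finset.sum_ite_eq', Finset.mem_univ, if_true,
      Finset.sum_ite_irrel, Finset.sum_const_zero]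
    exact Finset.sum_comm
  tracePreserving X := by
    have h2 : ∀ a a', ∑ b, Γ (b, a) (b, a') = (1 : Matrix A A ℂ) a a' := fun a a' => by
      rw [← h1]; rfl
    simp only [choiMap, Matrix.trace, Matrix.diag, LinearMap.coe_mk, AddHom.coe_mk,
      Matrix.of_apply]
    rw [Finset.sum_comm]
    refine Finset.sum_congr rfl fun a _ => ?_
    rw [Finset.sum_comm]
    simp only [← Finset.sum_mul, h2, Matrix.one_apply, ite_mul, one_mul, zero_mul,
      Finset.sum_ite_eq, Finset.mem_univ, if_true]

end CompletePositivity

/-! ### Operators on many copies of a register -/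

section TensorPower

variable {J A W : Type*} [Fintype J]

/-- The tensor product `⨂ i, X i` of operators `X i` on the copies of `A` labelled by `J`. -/
def tensorPower (X : J → Matrix A A ℂ) : Matrix (J → A) (J → A) ℂ :=
  Matrix.of fun x y => ∏ i, X i (x i) (y i)

theorem conjTranspose_tensorPower (X : J → Matrix A A ℂ) :
    (tensorPower X)ᴴ = tensorPower fun i => (X i)ᴴ := by
  ext x y
  simp [tensorPower, Matrix.conjTranspose_apply]

theorem tensorPower_one [DecidableEq A] :
    tensorPower (fun _ : J => (1 : Matrix A A ℂ)) = 1 := by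
  ext x y
  simp only [tensorPower, Matrix.of_apply, Matrix.one_apply, Fintype.prod_ite_zero,
    Finset.prod_const_one, funext_iff]

variable [DecidableEq J] [Fintype A]

theorem tensorPower_mul (X Y : J → Matrix A A ℂ) :
    tensorPower X * tensorPower Y = tensorPower fun i => X i * Y i := by
  ext x y
  simp only [tensorPower, Matrix.mul_apply, Matrix.of_apply, Finset.prod_univ_sum,
    Fintype.piFinset_univ, Finset.prod_mul_distrib]

theorem trace_tensorPower (X : J → Matrix A A ℂ) :
    (tensorPower X).trace = ∏ i, (X i).trace := by
  simp only [tensorPower, Matrix.trace, Matrix.diag, Matrix.of_apply, Finset.prod_univ_sum,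
    Fintype.piFinset_univ]

theorem tensorPower_posSemidef {X : J → Matrix A A ℂ} (h : ∀ i, (X i).PosSemidef) :
    (tensorPower X).PosSemidef := by
  classical
  choose c hc using fun i => CStarAlgebra.nonneg_iff_eq_star_mul_self.mp (h i).nonneg
  have : tensorPower X = (tensorPower c)ᴴ * tensorPower c := by
    rw [conjTranspose_tensorPower, tensorPower_mul]
    exact congrArg _ (funext hc)
  rw [this]
  exact Matrix.posSemidef_conjTranspose_mul_self _

/-- The map inserting an operator at the copy `j` while all other copies carry `ρ`. -/
def ins (j : J) (ρ : Matrix A A ℂ) : Matrix A A ℂ →ₗ[ℂ] Matrix (J → A) (J → A) ℂ where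
  toFun X := Matrix.of fun x y => X (x j) (y j) * ∏ i : {i // i ≠ j}, ρ (x i) (y i)
  map_add' X Y := by ext; simp [add_mul]
  map_smul' c X := by ext; simp [mul_assoc]

theorem ins_eq (j : J) (ρ X : Matrix A A ℂ) :
    ins j ρ X = tensorPower (Function.update (fun _ => ρ) j X) := by
  ext x y
  simp only [ins, tensorPower, LinearMap.coe_mk, AddHom.coe_mk, Matrix.of_apply]
  rw [Fintype.prod_eq_mul_prod_subtype_ne _ j]
  simp only [Function.update_self]
  congr 1
  refine Finset.prod_congr rfl fun i _ => ?_
  rw [Function.update_of_ne i.2]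

theorem ins_one_one [DecidableEq A] (j : J) : ins j (1 : Matrix A A ℂ) 1 = 1 := by
  rw [ins_eq, Function.update_eq_self, tensorPower_one]

theorem ins_conj (j : J) (c ρ X : Matrix A A ℂ) :
    tensorPower (fun _ => c) * ins j ρ X * tensorPower (fun _ => c) =
      ins j (c * ρ * c) (c * X * c) := by
  simp only [ins_eq, tensorPower_mul]
  congr 1
  ext1 i
  by_cases h : i = j
  · subst h; simp
  · simp [h]

theorem ins_one_mul [DecidableEq A] (j : J) (X Y : Matrix A A ℂ) :
    ins j 1 X * ins j 1 Y = ins j 1 (X * Y) := by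
  simp only [ins_eq, tensorPower_mul]
  congr 1
  ext1 i
  by_cases h : i = j
  · subst h; simp
  · simp [h]

theorem trace_ins (j : J) {ρ : Matrix A A ℂ} (hρ : ρ.trace = 1) (X : Matrix A A ℂ) :
    (ins j ρ X).trace = X.trace := by
  rw [ins_eq, trace_tensorPower, Fintype.prod_eq_single j]
  · simp
  · intro i hi
    simp [hi, hρ]

theorem trace_ins_mul_ins_same [DecidableEq A] (j : J) {ρ : Matrix A A ℂ} (hρ : ρ.trace = 1)
    (T X : Matrix A A ℂ) : (ins j 1 T * ins j ρ X).trace = (T * X).trace := by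
  rw [ins_eq, ins_eq, tensorPower_mul, trace_tensorPower, Fintype.prod_eq_single j]
  · simp
  · intro i hi
    simp [hi, hρ]

theorem trace_ins_mul_ins_of_ne [DecidableEq A] {j j' : J} (hj : j' ≠ j) {ρ : Matrix A A ℂ}
    (hρ : ρ.trace = 1) (T X : Matrix A A ℂ) :
    (ins j' 1 T * ins j ρ X).trace = (T * ρ).trace * X.trace := by
  rw [ins_eq, ins_eq, tensorPower_mul, trace_tensorPower, Fintype.prod_eq_mul j' j hj]
  · simp [hj, hj.symm]
  · rintro i ⟨hi, hi'⟩
    simp [hi, hi', hρ]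

theorem trace_tensorPower_mul_ins [DecidableEq A] (j : J) {ρ : Matrix A A ℂ} (hρ : ρ.trace = 1)
    (X : Matrix A A ℂ) : (tensorPower (fun _ => ρ) * ins j 1 X).trace = (ρ * X).trace := by
  rw [ins_eq, tensorPower_mul, trace_tensorPower, Fintype.prod_eq_single j]
  · simp
  · intro i hi
    simp [hi, hρ]

theorem trace_tensorPower_mul_ins_mul_ins_of_ne [DecidableEq A] {j j' : J} (hj : j ≠ j')
    {ρ : Matrix A A ℂ} (hρ : ρ.trace = 1) (X Y : Matrix A A ℂ) :
    (tensorPower (fun _ => ρ) * (ins j 1 X * ins j' 1 Y)).trace =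
      (ρ * X).trace * (ρ * Y).trace := by
  rw [ins_eq, ins_eq, tensorPower_mul, tensorPower_mul, trace_tensorPower,
    Fintype.prod_eq_mul j j' hj]
  · simp [hj, hj.symm]
  · rintro i ⟨hi, hi'⟩
    simp [hi, hi', hρ]

theorem ins_isCP (j : J) {ρ : Matrix A A ℂ} (hρ : ρ.PosSemidef) : IsCP (ins j ρ) := by
  intro k X hX
  exact (hX.kronecker (tensorPower_posSemidef (J := {i // i ≠ j}) fun _ => hρ)).submatrix
    (fun x : Fin k × (J → A) => ((x.1, x.2 j), fun i : {i // i ≠ j} => x.2 i))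

end TensorPower

/-! ### Inequalities between Hermitian matrices -/

section Inequalities

variable {n m : Type*} [Fintype n] [Fintype m]

theorem le_of_sub_eq {X Y D : Matrix n n ℂ} (h : D.PosSemidef) (e : Y - X = D) : X ≤ Y :=
  Matrix.le_iff.mpr (e ▸ h)

theorem conj_le_conj {X Y : Matrix n n ℂ} (h : X ≤ Y) (C : Matrix m n ℂ) :
    C * X * Cᴴ ≤ C * Y * Cᴴ := by
  rw [Matrix.le_iff] at h ⊢
  have := h.mul_mul_conjTranspose_same C
  rwa [Matrix.mul_sub, Matrix.sub_mul] at this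

theorem hermitian_conj_le {X Y C : Matrix n n ℂ} (h : X ≤ Y) (hC : C.IsHermitian) :
    C * X * C ≤ C * Y * C := by
  have := conj_le_conj h C
  rwa [hC.eq] at this

theorem posSemidef_hermitian_conj {X C : Matrix n n ℂ} (h : X.PosSemidef) (hC : C.IsHermitian) :
    (C * X * C).PosSemidef := by
  have := h.mul_mul_conjTranspose_same C
  rwa [hC.eq] at this

theorem re_trace_nonneg {X : Matrix n n ℂ} (h : X.PosSemidef) : 0 ≤ X.trace.re :=
  (Complex.le_def.mp h.trace_nonneg).1

theorem re_trace_mono {X Y : Matrix n n ℂ} (h : X ≤ Y) : X.trace.re ≤ Y.trace.re := by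
  have := re_trace_nonneg (Matrix.le_iff.mp h)
  rw [Matrix.trace_sub, Complex.sub_re] at this
  linarith

theorem exists_eq_conjTranspose_mul {X : Matrix n n ℂ} (h : X.PosSemidef) :
    ∃ c : Matrix n n ℂ, X = cᴴ * c := by
  classical
  exact CStarAlgebra.nonneg_iff_eq_star_mul_self.mp h.nonneg

theorem re_trace_mul_nonneg {X Y : Matrix n n ℂ} (hX : X.PosSemidef) (hY : Y.PosSemidef) :
    0 ≤ (X * Y).trace.re := by
  obtain ⟨c, rfl⟩ := exists_eq_conjTranspose_mul hX
  rw [Matrix.mul_assoc, Matrix.trace_mul_comm]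
  exact re_trace_nonneg (hY.mul_mul_conjTranspose_same c)

theorem re_trace_mul_mono {T X Y : Matrix n n ℂ} (hT : T.PosSemidef) (h : X ≤ Y) :
    (T * X).trace.re ≤ (T * Y).trace.re := by
  have := re_trace_mul_nonneg hT (Matrix.le_iff.mp h)
  rw [Matrix.mul_sub, Matrix.trace_sub, Complex.sub_re] at this
  linarith

theorem re_trace_mul_mono_left {T X Y : Matrix n n ℂ} (hT : T.PosSemidef) (h : X ≤ Y) :
    (X * T).trace.re ≤ (Y * T).trace.re := by
  rw [Matrix.trace_mul_comm X, Matrix.trace_mul_comm Y]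
  exact re_trace_mul_mono hT h

theorem re_trace_real_smul (t : ℝ) (X : Matrix n n ℂ) :
    (t • X).trace.re = t * X.trace.re := by
  simp [Matrix.trace_smul]

/-- A positive semidefinite operator with vanishing compression to the range of `Q` kills that
range. -/
theorem mul_eq_zero_of_trace_conj {X : Matrix n n ℂ} (h : X.PosSemidef) {Q : Matrix n m ℂ}
    (hQ : (Qᴴ * X * Q).trace.re ≤ 0) : X * Q = 0 := by
  have hp := h.conjTranspose_mul_mul_same Q
  have h0 : (Qᴴ * X * Q).trace = 0 := by
    have h1 := Complex.le_def.mp hp.trace_nonneg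
    exact Complex.ext (le_antisymm hQ h1.1) h1.2.symm
  obtain ⟨c, rfl⟩ := exists_eq_conjTranspose_mul h
  have h2 : ((c * Q)ᴴ * (c * Q)).trace = 0 := by
    rw [Matrix.conjTranspose_mul, ← h0]
    simp only [Matrix.mul_assoc]
  rw [Matrix.trace_conjTranspose_mul_self_eq_zero_iff] at h2
  rw [Matrix.mul_assoc, h2, Matrix.mul_zero]

/-- The operator form of `(a + b)² ≤ (1 + t) a² + (1 + 1/t) b²`. -/
theorem conj_add_le {Y : Matrix n n ℂ} (hY : Y.PosSemidef) (A B : Matrix m n ℂ) {t : ℝ}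
    (ht : 0 < t) :
    (A + B) * Y * (A + B)ᴴ ≤ (1 + t) • (A * Y * Aᴴ) + (1 + t⁻¹) • (B * Y * Bᴴ) := by
  refine le_of_sub_eq
    ((hY.mul_mul_conjTranspose_same (t • A - B)).smul (inv_nonneg.mpr ht.le)) ?_
  simp only [Matrix.conjTranspose_add, Matrix.conjTranspose_sub, Matrix.conjTranspose_smul,
    star_trivial, Matrix.add_mul, Matrix.mul_add, Matrix.sub_mul, Matrix.mul_sub, Matrix.smul_mul,
    Matrix.mul_smul]
  match_scalars <;> field_simp <;> ring

end Inequalities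

section SquareRoot

variable {n : Type*} [Fintype n] [DecidableEq n]

theorem isHermitian_sqrt (X : Matrix n n ℂ) : (CFC.sqrt X).IsHermitian :=
  (CFC.sqrt_nonneg X).posSemidef.isHermitian

theorem sqrt_mul_sqrt {X : Matrix n n ℂ} (h : X.PosSemidef) : CFC.sqrt X * CFC.sqrt X = X :=
  CFC.sqrt_mul_sqrt_self X h.nonneg

theorem sqrt_mul_self_mul_sqrt {X : Matrix n n ℂ} (h : X.PosSemidef) :
    CFC.sqrt X * X * CFC.sqrt X = X * X := by
  have : CFC.sqrt X * X * CFC.sqrt X = (CFC.sqrt X * CFC.sqrt X) * (CFC.sqrt X * CFC.sqrt X) := by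
    nth_rw 2 [← sqrt_mul_sqrt h]
    simp only [Matrix.mul_assoc]
  rw [this, sqrt_mul_sqrt h]

open scoped Matrix.Norms.L2Operator in
theorem le_sqrt_of_le {S W : Matrix n n ℂ} (hS : S.PosSemidef) (hS1 : S ≤ 1) (hW : S ≤ W) :
    S ≤ CFC.sqrt W := by
  have h1 : S * S ≤ S := by
    refine le_of_sub_eq (posSemidef_hermitian_conj (Matrix.le_iff.mp hS1) (isHermitian_sqrt S)) ?_
    rw [Matrix.mul_sub, Matrix.sub_mul, Matrix.mul_one, sqrt_mul_self_mul_sqrt hS,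
      sqrt_mul_sqrt hS]
  have h2 := CFC.monotone_sqrt (h1.trans hW)
  rwa [CFC.sqrt_mul_self S hS.nonneg] at h2

/-- The Hayashi–Nagaoka inequality for the pretty good measurement operator
`(S + T)^{-1/2} S (S + T)^{-1/2}`. -/
theorem hayashi_nagaoka {S T : Matrix n n ℂ} (hS : S.PosSemidef) (hS1 : S ≤ 1) (hT : T.PosSemidef)
    (hW : IsUnit (S + T)) :
    1 - (CFC.sqrt (S + T))⁻¹ * S * (CFC.sqrt (S + T))⁻¹ ≤ (2 : ℝ) • (1 - S) + (4 : ℝ) • T := by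
  have hWp : (S + T).PosSemidef := hS.add hT
  set p := CFC.sqrt (S + T) with hp
  have hpp : p * p = S + T := sqrt_mul_sqrt hWp
  have hpu : IsUnit p := by
    rw [← hpp, Matrix.isUnit_iff_isUnit_det, Matrix.det_mul] at hW
    exact (Matrix.isUnit_iff_isUnit_det p).mpr (isUnit_of_mul_isUnit_left hW)
  have hdet := (Matrix.isUnit_iff_isUnit_det p).mp hpu
  set q := p⁻¹ with hq
  have hqp : q * p = 1 := Matrix.nonsing_inv_mul p hdet
  have hpq : p * q = 1 := Matrix.mul_nonsing_inv p hdet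
  have hqH : q.IsHermitian := (isHermitian_sqrt (S + T)).inv
  have hq1H : (q - 1).IsHermitian := hqH.sub Matrix.isHermitian_one
  have e1 : 1 - q * S * q = q * T * q := by
    have : q * (p * p) * q = 1 := by
      rw [← Matrix.mul_assoc, hqp, Matrix.one_mul, hpq]
    rw [hpp, Matrix.mul_add, Matrix.add_mul] at this
    rw [← this, add_sub_cancel_left]
  have e2 := conj_add_le hT (q - 1) 1 one_pos
  rw [sub_add_cancel, hqH.eq, hq1H.eq, Matrix.conjTranspose_one, Matrix.one_mul,
    Matrix.mul_one] at e2
  have e3 : (q - 1) * T * (q - 1) ≤ (q - 1) * (S + T) * (q - 1) :=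
    hermitian_conj_le (le_add_of_nonneg_left hS.nonneg) hq1H
  have e4 : (q - 1) * (S + T) * (q - 1) = 1 - (2 : ℝ) • p + (S + T) := by
    rw [← hpp]
    have : (q - 1) * (p * p) * (q - 1) = (q * p) * (p * q) - (q * p) * p - p * (p * q) + p * p := by
      noncomm_ring
    rw [this, hqp, hpq, Matrix.one_mul, Matrix.one_mul, Matrix.mul_one]
    module
  have e5 : S ≤ p := le_sqrt_of_le hS hS1 (le_add_of_nonneg_right hT.nonneg)
  have e6 : 1 - (2 : ℝ) • p + (S + T) ≤ 1 - S + T := by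
    have : (2 : ℝ) • S ≤ (2 : ℝ) • p := smul_le_smul_of_nonneg_left e5 (by norm_num)
    calc 1 - (2 : ℝ) • p + (S + T) ≤ 1 - (2 : ℝ) • S + (S + T) := by gcongr
      _ = 1 - S + T := by module
  rw [e1]
  calc q * T * q ≤ (1 + 1 : ℝ) • ((q - 1) * T * (q - 1)) + (1 + 1⁻¹ : ℝ) • T := e2
    _ ≤ (1 + 1 : ℝ) • (1 - S + T) + (1 + 1⁻¹ : ℝ) • T := by
        gcongr
        exact e3.trans (e4.le.trans e6)
    _ = (2 : ℝ) • (1 - S) + (4 : ℝ) • T := by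
        rw [inv_one]; module

/-- The pseudo-inverse of the square root. -/
def sqrtPinv (ρ : Matrix n n ℂ) : Matrix n n ℂ := cfc (fun x : ℝ => (Real.sqrt x)⁻¹) ρ

/-- The projection onto the support. -/
def supp (ρ : Matrix n n ℂ) : Matrix n n ℂ := sqrtPinv ρ * CFC.sqrt ρ

theorem sqrt_eq_cfc_real {ρ : Matrix n n ℂ} (h : ρ.PosSemidef) :
    CFC.sqrt ρ = cfc (fun x : ℝ => Real.sqrt x) ρ := by
  rw [CFC.sqrt_eq_real_sqrt ρ h.nonneg, cfcₙ_eq_cfc]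

theorem cfc_mul_cfc (f g : ℝ → ℝ) (ρ : Matrix n n ℂ) :
    cfc f ρ * cfc g ρ = cfc (fun x => f x * g x) ρ :=
  (cfc_mul f g ρ (Matrix.finite_real_spectrum.continuousOn f)
    (Matrix.finite_real_spectrum.continuousOn g)).symm

theorem isHermitian_sqrtPinv (ρ : Matrix n n ℂ) : (sqrtPinv ρ).IsHermitian :=
  (cfc_predicate (fun x : ℝ => (Real.sqrt x)⁻¹) ρ)

variable {ρ : Matrix n n ℂ}

theorem sqrt_mul_sqrtPinv (h : ρ.PosSemidef) : CFC.sqrt ρ * sqrtPinv ρ = supp ρ := by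
  rw [supp, sqrtPinv, sqrt_eq_cfc_real h, cfc_mul_cfc, cfc_mul_cfc]
  simp only [mul_comm]

theorem isHermitian_supp (h : ρ.PosSemidef) : (supp ρ).IsHermitian := by
  rw [Matrix.IsHermitian, supp, Matrix.conjTranspose_mul, (isHermitian_sqrt ρ).eq,
    (isHermitian_sqrtPinv ρ).eq, sqrt_mul_sqrtPinv h, supp]

theorem supp_mul_sqrt (h : ρ.PosSemidef) : supp ρ * CFC.sqrt ρ = CFC.sqrt ρ := by
  rw [supp, sqrtPinv, sqrt_eq_cfc_real h, cfc_mul_cfc, cfc_mul_cfc]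
  congr 1
  ext x
  rcases eq_or_ne (Real.sqrt x) 0 with h0 | h0
  · simp [h0]
  · field_simp

theorem sqrt_mul_supp (h : ρ.PosSemidef) : CFC.sqrt ρ * supp ρ = CFC.sqrt ρ := by
  have := congrArg Matrix.conjTranspose (supp_mul_sqrt h)
  rwa [Matrix.conjTranspose_mul, (isHermitian_sqrt ρ).eq, (isHermitian_supp h).eq] at this

theorem supp_mul_supp (h : ρ.PosSemidef) : supp ρ * supp ρ = supp ρ := by
  nth_rw 2 [supp]
  nth_rw 1 [← sqrt_mul_sqrtPinv h]
  rw [Matrix.mul_assoc, ← Matrix.mul_assoc _ _ (CFC.sqrt ρ)]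
  have : sqrtPinv ρ * sqrtPinv ρ * CFC.sqrt ρ = sqrtPinv ρ * supp ρ := by
    rw [Matrix.mul_assoc, supp]
  rw [this, ← Matrix.mul_assoc, sqrt_mul_sqrtPinv h]
  nth_rw 1 [supp]
  rw [Matrix.mul_assoc, sqrt_mul_supp h, supp]

theorem sqrtPinv_conj (h : ρ.PosSemidef) : sqrtPinv ρ * ρ * sqrtPinv ρ = supp ρ := by
  nth_rw 2 [← sqrt_mul_sqrt h]
  rw [← Matrix.mul_assoc, Matrix.mul_assoc _ _ (sqrtPinv ρ), sqrt_mul_sqrtPinv h]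
  exact supp_mul_supp h

theorem mul_supp (h : ρ.PosSemidef) : ρ * supp ρ = ρ := by
  nth_rw 1 [← sqrt_mul_sqrt h]
  rw [Matrix.mul_assoc, sqrt_mul_supp h, sqrt_mul_sqrt h]

theorem one_sub_supp_posSemidef (h : ρ.PosSemidef) : (1 - supp ρ).PosSemidef := by
  have h1 := Matrix.posSemidef_conjTranspose_mul_self (1 - supp ρ)
  have h2 : (1 - supp ρ)ᴴ * (1 - supp ρ) = 1 - supp ρ := by
    rw [(Matrix.isHermitian_one.sub (isHermitian_supp h)).eq, Matrix.sub_mul, Matrix.one_mul,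
      Matrix.mul_sub, Matrix.mul_one, supp_mul_supp h, sub_self, sub_zero]
  rwa [h2] at h1

theorem supp_le_one (h : ρ.PosSemidef) : supp ρ ≤ 1 :=
  Matrix.le_iff.mpr (one_sub_supp_posSemidef h)

theorem supp_posSemidef (h : ρ.PosSemidef) : (supp ρ).PosSemidef := by
  have h1 := Matrix.posSemidef_conjTranspose_mul_self (supp ρ)
  rwa [(isHermitian_supp h).eq, supp_mul_supp h] at h1

end SquareRoot

/-! ### Extensions of nearby states -/

theorem single_posSemidef {F : Type*} [DecidableEq F] (f₀ : F) : (Matrix.single f₀ f₀ (1 : ℂ)).PosSemidef := by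
  rw [← Matrix.diagonal_single]
  refine Matrix.PosSemidef.diagonal fun i => ?_
  by_cases h : i = f₀
  · subst h; simp
  · simp [h]

section Extension

variable {F D : Type*} [Fintype F] [DecidableEq F] [Fintype D] [DecidableEq D]

theorem conjTranspose_one_kronecker (S : Matrix D D ℂ) :
    ((1 : Matrix F F ℂ) ⊗ₖ S)ᴴ = (1 : Matrix F F ℂ) ⊗ₖ Sᴴ := by
  rw [Matrix.conjTranspose_kronecker, Matrix.conjTranspose_one]

theorem one_kronecker_mul (S T : Matrix D D ℂ) :
    ((1 : Matrix F F ℂ) ⊗ₖ S) * ((1 : Matrix F F ℂ) ⊗ₖ T) = (1 : Matrix F F ℂ) ⊗ₖ (S * T) := by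
  rw [← Matrix.mul_kronecker_mul, Matrix.one_mul]

theorem isHermitian_one_kronecker {S : Matrix D D ℂ} (hS : S.IsHermitian) :
    ((1 : Matrix F F ℂ) ⊗ₖ S).IsHermitian := by
  rw [Matrix.IsHermitian, conjTranspose_one_kronecker, hS.eq]

theorem trace_one_kronecker_conj (S T : Matrix D D ℂ) (X : Matrix (F × D) (F × D) ℂ) :
    (((1 : Matrix F F ℂ) ⊗ₖ S) * X * ((1 : Matrix F F ℂ) ⊗ₖ T)).trace =
      (S * ptraceLeft X * T).trace := by
  rw [← trace_ptraceLeft, ptraceLeft_conj]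

/-- If a projection acts trivially on a marginal, it acts trivially on the global operator. -/
theorem one_kronecker_conj_eq_self {P : Matrix D D ℂ} (hP : P.IsHermitian)
    {X : Matrix (F × D) (F × D) ℂ} (hX : X.PosSemidef) (h : ptraceLeft X * P = ptraceLeft X) :
    ((1 : Matrix F F ℂ) ⊗ₖ P) * X * ((1 : Matrix F F ℂ) ⊗ₖ P) = X := by
  have h0 : X * ((1 : Matrix F F ℂ) ⊗ₖ (1 - P)) = 0 := by
    refine mul_eq_zero_of_trace_conj hX ?_
    rw [conjTranspose_one_kronecker, trace_one_kronecker_conj, Matrix.mul_assoc, Matrix.mul_sub,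
      Matrix.mul_one, h, sub_self, Matrix.mul_zero]
    simp
  have h1 : X * ((1 : Matrix F F ℂ) ⊗ₖ P) = X := by
    have e : ((1 : Matrix F F ℂ) ⊗ₖ (1 - P)) = 1 - (1 : Matrix F F ℂ) ⊗ₖ P := by
      rw [eq_sub_iff_add_eq, ← Matrix.kronecker_add, sub_add_cancel, Matrix.one_kronecker_one]
    rw [e, Matrix.mul_sub, Matrix.mul_one, sub_eq_zero] at h0
    exact h0.symm
  have h2 : ((1 : Matrix F F ℂ) ⊗ₖ P) * X = X := by
    have := congrArg Matrix.conjTranspose h1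
    rwa [Matrix.conjTranspose_mul, conjTranspose_one_kronecker, hP.eq, hX.isHermitian.eq] at this
  rw [h2, h1]

/-- The contraction of the polar decomposition: it turns `X` into `|X|`. -/
theorem exists_polar_contraction (X : Matrix D D ℂ) :
    ∃ K : Matrix D D ℂ, K * X = CFC.sqrt (Xᴴ * X) ∧ K * Kᴴ ≤ 1 := by
  have hG : (Xᴴ * X).PosSemidef := Matrix.posSemidef_conjTranspose_mul_self X
  refine ⟨sqrtPinv (Xᴴ * X) * Xᴴ, ?_, ?_⟩
  · rw [Matrix.mul_assoc]
    nth_rw 2 [← sqrt_mul_sqrt hG]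
    rw [← Matrix.mul_assoc]
    exact supp_mul_sqrt hG
  · have : sqrtPinv (Xᴴ * X) * Xᴴ * (sqrtPinv (Xᴴ * X) * Xᴴ)ᴴ = supp (Xᴴ * X) := by
      rw [Matrix.conjTranspose_mul, Matrix.conjTranspose_conjTranspose,
        (isHermitian_sqrtPinv _).eq, ← sqrtPinv_conj hG]
      simp only [Matrix.mul_assoc]
    rw [this]
    exact supp_le_one hG

/-- A form of Uhlmann's theorem: an extension of `ρ` can be modified into an extension of a nearby
state `ρ'`, at the price of a factor `3/2` and of a remainder whose trace is controlled by the
fidelity. -/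
theorem exists_extension {ψ : Matrix (F × D) (F × D) ℂ} (hψ : IsState ψ) {ρ' : Matrix D D ℂ}
    (hρ' : IsState ρ') (f₀ : F) :
    ∃ ψ' Δ : Matrix (F × D) (F × D) ℂ, ψ'.PosSemidef ∧ Δ.PosSemidef ∧ ptraceLeft ψ' = ρ' ∧
      ψ' ≤ (3 / 2 : ℝ) • ψ + Δ ∧ Δ.trace.re ≤ 6 * (1 - fidelity (ptraceLeft ψ) ρ') := by
  set ρ := ptraceLeft ψ with hρdef
  have hρ : ρ.PosSemidef := ptraceLeft_posSemidef hψ.posSemidef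
  have hρ1 : ρ.trace = 1 := by rw [hρdef, trace_ptraceLeft, hψ.trace_eq_one]
  set a := CFC.sqrt ρ with ha
  set a' := CFC.sqrt ρ' with ha'
  have haH : aᴴ = a := isHermitian_sqrt ρ
  have ha'H : a'ᴴ = a' := isHermitian_sqrt ρ'
  set P := supp ρ with hP
  have hPH : Pᴴ = P := isHermitian_supp hρ
  have hPP : P * P = P := supp_mul_supp hρ
  have hPa : P * a = a := supp_mul_sqrt hρ
  obtain ⟨K, hKX, hKK⟩ := exists_polar_contraction (a * a')
  have hKPK : K * P * Kᴴ ≤ 1 := by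
    refine le_trans ?_ hKK
    simpa using conj_le_conj (supp_le_one hρ) K
  obtain ⟨L, hL⟩ : ∃ L, L = a' * K := ⟨_, rfl⟩
  set f := fidelity ρ ρ' with hf
  have hftr : (L * P * a).trace.re = f := by
    rw [hL, Matrix.mul_assoc, hPa, Matrix.mul_assoc, Matrix.trace_mul_comm, Matrix.mul_assoc,
      hKX]
    rfl
  set r := sqrtPinv ρ with hr
  have hrH : rᴴ = r := isHermitian_sqrtPinv ρ
  set φ := ((1 : Matrix F F ℂ) ⊗ₖ r) * ψ * ((1 : Matrix F F ℂ) ⊗ₖ r) with hφ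
  have hφp : φ.PosSemidef := posSemidef_hermitian_conj hψ.posSemidef
    (isHermitian_one_kronecker (isHermitian_sqrtPinv ρ))
  have hφtr : ptraceLeft φ = P := by
    rw [hφ, ptraceLeft_conj, ← hρdef]
    exact sqrtPinv_conj hρ
  have hφψ : ((1 : Matrix F F ℂ) ⊗ₖ a) * φ * ((1 : Matrix F F ℂ) ⊗ₖ a)ᴴ = ψ := by
    have h1 := one_kronecker_conj_eq_self (isHermitian_supp hρ) hψ.posSemidef (mul_supp hρ)
    rw [conjTranspose_one_kronecker, haH]
    calc _ = (((1 : Matrix F F ℂ) ⊗ₖ a) * ((1 : Matrix F F ℂ) ⊗ₖ r)) * ψ *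
          (((1 : Matrix F F ℂ) ⊗ₖ r) * ((1 : Matrix F F ℂ) ⊗ₖ a)) := by
          rw [hφ]; simp only [Matrix.mul_assoc]
      _ = ψ := by
          rw [one_kronecker_mul, one_kronecker_mul, sqrt_mul_sqrtPinv hρ]
          exact h1
  -- `L φ L†` is the image of `ψ` under Uhlmann's contraction; it falls short of an extension of `ρ'`
  -- by a product operator `J`
  set d := L - a with hd
  set J := Matrix.single f₀ f₀ (1 : ℂ) ⊗ₖ (a' * (1 - K * P * Kᴴ) * a') with hJ
  have hJin : (a' * (1 - K * P * Kᴴ) * a').PosSemidef :=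
    posSemidef_hermitian_conj (Matrix.le_iff.mp hKPK) (isHermitian_sqrt ρ')
  have hJp : J.PosSemidef := (single_posSemidef f₀).kronecker hJin
  have hLP : L * P * Lᴴ = a' * (K * P * Kᴴ) * a' := by
    rw [hL, Matrix.conjTranspose_mul, ha'H]
    simp only [Matrix.mul_assoc]
  have hrest : a' * (1 - K * P * Kᴴ) * a' = ρ' - L * P * Lᴴ := by
    rw [hLP, Matrix.mul_sub, Matrix.sub_mul, Matrix.mul_one, sqrt_mul_sqrt hρ'.posSemidef]
  have hd1 : (d * P * dᴴ).trace.re = (L * P * Lᴴ).trace.re + 1 - 2 * f := by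
    have e1 : (a * P * Lᴴ).trace.re = f := by
      have : a * P * Lᴴ = (L * P * a)ᴴ := by
        rw [Matrix.conjTranspose_mul, Matrix.conjTranspose_mul, haH, hPH]
        simp only [Matrix.mul_assoc]
      rw [this, Matrix.trace_conjTranspose, ← hftr]
      simp
    have e2 : (a * P * a).trace.re = 1 := by
      rw [Matrix.mul_assoc, hPa, sqrt_mul_sqrt hρ, hρ1]
      simp
    rw [hd, Matrix.conjTranspose_sub, haH]
    simp only [Matrix.sub_mul, Matrix.mul_sub, Matrix.trace_sub, Complex.sub_re, e1, e2, hftr]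
    ring
  refine ⟨((1 : Matrix F F ℂ) ⊗ₖ L) * φ * ((1 : Matrix F F ℂ) ⊗ₖ L)ᴴ + J,
    (3 : ℝ) • (((1 : Matrix F F ℂ) ⊗ₖ d) * φ * ((1 : Matrix F F ℂ) ⊗ₖ d)ᴴ) + J,
    (hφp.mul_mul_conjTranspose_same _).add hJp,
    ((hφp.mul_mul_conjTranspose_same _).smul (by norm_num)).add hJp, ?_, ?_, ?_⟩
  · rw [map_add, conjTranspose_one_kronecker, ptraceLeft_conj, hφtr, hJ, ptraceLeft_kronecker,
      hrest]
    simp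
  -- splitting `L = a + d` at `t = 1/2` gives the factors `3/2` and `3`
  · have h := conj_add_le hφp ((1 : Matrix F F ℂ) ⊗ₖ a) ((1 : Matrix F F ℂ) ⊗ₖ d)
      (t := 1 / 2) (by norm_num)
    rw [← Matrix.kronecker_add, hφψ, hd, add_sub_cancel, ← hd] at h
    norm_num at h
    rw [← add_assoc]
    gcongr
  · rw [Matrix.trace_add, Complex.add_re, re_trace_real_smul, conjTranspose_one_kronecker,
      trace_one_kronecker_conj, hφtr, hd1, hJ, Matrix.trace_kronecker, hrest]
    have e3 : (L * P * Lᴴ).trace.re ≤ 1 := by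
      have := re_trace_nonneg hJin
      rw [hrest, Matrix.trace_sub, hρ'.trace_eq_one, Complex.sub_re, Complex.one_re] at this
      linarith
    rw [Matrix.trace_sub, hρ'.trace_eq_one]
    simp only [Matrix.trace_single_eq_same, one_mul, Complex.sub_re, Complex.one_re]
    linarith

end Extension

/-! ### Second moments for the bipartite convex split -/

section Cyclic

variable {A B : Type*} [Fintype A] [DecidableEq A] [Fintype B] [DecidableEq B]

theorem ptraceRight_one_kronecker_conj (S T : Matrix B B ℂ) (X : Matrix (A × B) (A × B) ℂ) :
    ptraceRight (((1 : Matrix A A ℂ) ⊗ₖ S) * X * ((1 : Matrix A A ℂ) ⊗ₖ T)) =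
      ptraceRight (((1 : Matrix A A ℂ) ⊗ₖ (T * S)) * X) := by
  have : (ptraceRight ∘ₗ LinearMap.mulRight ℂ ((1 : Matrix A A ℂ) ⊗ₖ T) ∘ₗ
      LinearMap.mulLeft ℂ ((1 : Matrix A A ℂ) ⊗ₖ S)) =
      ptraceRight ∘ₗ LinearMap.mulLeft ℂ ((1 : Matrix A A ℂ) ⊗ₖ (T * S)) := by
    refine linearMap_ext_kronecker fun X Y => ?_
    simp only [LinearMap.comp_apply, LinearMap.mulRight_apply, LinearMap.mulLeft_apply,
      ← Matrix.mul_kronecker_mul, ptraceRight_kronecker, Matrix.one_mul, Matrix.mul_one]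
    rw [Matrix.trace_mul_comm, Matrix.mul_assoc]
  exact LinearMap.congr_fun this X

theorem ptraceLeft_kronecker_one_conj (S T : Matrix A A ℂ) (X : Matrix (A × B) (A × B) ℂ) :
    ptraceLeft ((S ⊗ₖ (1 : Matrix B B ℂ)) * X * (T ⊗ₖ (1 : Matrix B B ℂ))) =
      ptraceLeft (((T * S) ⊗ₖ (1 : Matrix B B ℂ)) * X) := by
  have : (ptraceLeft ∘ₗ LinearMap.mulRight ℂ (T ⊗ₖ (1 : Matrix B B ℂ)) ∘ₗ
      LinearMap.mulLeft ℂ (S ⊗ₖ (1 : Matrix B B ℂ))) =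
      ptraceLeft ∘ₗ LinearMap.mulLeft ℂ ((T * S) ⊗ₖ (1 : Matrix B B ℂ)) := by
    refine linearMap_ext_kronecker fun X Y => ?_
    simp only [LinearMap.comp_apply, LinearMap.mulRight_apply, LinearMap.mulLeft_apply,
      ← Matrix.mul_kronecker_mul, ptraceLeft_kronecker, Matrix.one_mul, Matrix.mul_one]
    rw [Matrix.trace_mul_comm, Matrix.mul_assoc]
  exact LinearMap.congr_fun this X

/-- Bilinear maps of bipartite operators are determined by their values on tensor products. -/
theorem bilinearMap_ext_kronecker {E : Type*} [AddCommMonoid E] [Module ℂ E]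
    {f g : Matrix (A × B) (A × B) ℂ →ₗ[ℂ] Matrix (A × B) (A × B) ℂ →ₗ[ℂ] E}
    (h : ∀ (X X' : Matrix A A ℂ) (Y Y' : Matrix B B ℂ),
      f (X ⊗ₖ Y) (X' ⊗ₖ Y') = g (X ⊗ₖ Y) (X' ⊗ₖ Y')) : f = g :=
  linearMap_ext_kronecker fun X Y => linearMap_ext_kronecker fun X' Y' => h X X' Y Y'

theorem re_trace_mul_sq_le {ρ z : Matrix A A ℂ} (hρ : ρ.PosSemidef) (hz : z.PosSemidef) {c : ℝ}
    (h : z ≤ c • (1 : Matrix A A ℂ)) : (ρ * (z * z)).trace.re ≤ c * (ρ * z).trace.re := by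
  have h1 : z * z ≤ c • z := by
    have h2 := hermitian_conj_le h (isHermitian_sqrt z)
    rw [Matrix.mul_smul, Matrix.smul_mul, Matrix.mul_one, sqrt_mul_sqrt hz] at h2
    rwa [sqrt_mul_self_mul_sqrt hz] at h2
  have := re_trace_mul_mono hρ h1
  rwa [Matrix.mul_smul, re_trace_real_smul] at this

theorem kronecker_le_one {P : Matrix A A ℂ} {Q : Matrix B B ℂ} (hP : P.PosSemidef) (hP1 : P ≤ 1)
    (hQ1 : Q ≤ 1) : P ⊗ₖ Q ≤ 1 := by
  have e : 1 - P ⊗ₖ Q = (1 - P) ⊗ₖ (1 : Matrix B B ℂ) + P ⊗ₖ (1 - Q) := by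
    rw [← Matrix.one_kronecker_one]
    ext
    simp only [Matrix.sub_apply, Matrix.add_apply, Matrix.kroneckerMap_apply]
    ring
  exact le_of_sub_eq (((Matrix.le_iff.mp hP1).kronecker (Matrix.PosSemidef.one (n := B))).add
    (hP.kronecker (Matrix.le_iff.mp hQ1))) e

end Cyclic

section InsPair

variable {J L A₁ A₂ : Type*} [Fintype J] [DecidableEq J] [Fintype L] [DecidableEq L]
  [Fintype A₁] [DecidableEq A₁] [Fintype A₂] [DecidableEq A₂]

/-- The operator on `A₁^J ⊗ A₂^L` acting on the copies `j` and `k` only. -/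
def insPair (j : J) (k : L) : Matrix (A₁ × A₂) (A₁ × A₂) ℂ →ₗ[ℂ]
    Matrix ((J → A₁) × (L → A₂)) ((J → A₁) × (L → A₂)) ℂ :=
  tensorMap (ins j 1) (ins k 1)

theorem insPair_mul (j : J) (k : L) (Z Z' : Matrix (A₁ × A₂) (A₁ × A₂) ℂ) :
    insPair j k Z * insPair j k Z' = insPair j k (Z * Z') := by
  have : (LinearMap.mul ℂ _).compl₁₂ (insPair (A₁ := A₁) (A₂ := A₂) j k) (insPair j k) =
      (LinearMap.mul ℂ _).compr₂ (insPair j k) := by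
    refine bilinearMap_ext_kronecker fun X X' Y Y' => ?_
    simp [insPair, tensorMap_kronecker, ← Matrix.mul_kronecker_mul, ins_one_mul]
  exact LinearMap.congr_fun₂ this Z Z'

variable {ρ₁ : Matrix A₁ A₁ ℂ} {ρ₂ : Matrix A₂ A₂ ℂ}

/-- The state `ρ₁^{⊗ J} ⊗ ρ₂^{⊗ L}`. -/
def powerPair (J L : Type*) [Fintype J] [Fintype L] (ρ₁ : Matrix A₁ A₁ ℂ) (ρ₂ : Matrix A₂ A₂ ℂ) :
    Matrix ((J → A₁) × (L → A₂)) ((J → A₁) × (L → A₂)) ℂ :=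
  tensorPower (fun _ : J => ρ₁) ⊗ₖ tensorPower (fun _ : L => ρ₂)

theorem trace_powerPair_mul_insPair (h₁ : ρ₁.trace = 1) (h₂ : ρ₂.trace = 1) (j : J) (k : L)
    (Z : Matrix (A₁ × A₂) (A₁ × A₂) ℂ) :
    (powerPair J L ρ₁ ρ₂ * insPair j k Z).trace = ((ρ₁ ⊗ₖ ρ₂) * Z).trace := by
  have : Matrix.traceLinearMap _ ℂ ℂ ∘ₗ LinearMap.mulLeft ℂ (powerPair J L ρ₁ ρ₂) ∘ₗ insPair j k =
      Matrix.traceLinearMap _ ℂ ℂ ∘ₗ LinearMap.mulLeft ℂ (ρ₁ ⊗ₖ ρ₂) := by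
    refine linearMap_ext_kronecker fun X Y => ?_
    simp [insPair, powerPair, tensorMap_kronecker, ← Matrix.mul_kronecker_mul,
      Matrix.trace_kronecker, trace_tensorPower_mul_ins, h₁, h₂]
  exact LinearMap.congr_fun this Z

theorem trace_powerPair_mul_insPair_ne_right (h₁ : ρ₁.trace = 1) (h₂ : ρ₂.trace = 1) (j : J)
    {k k' : L} (hk : k ≠ k') (Z Z' : Matrix (A₁ × A₂) (A₁ × A₂) ℂ) :
    (powerPair J L ρ₁ ρ₂ * (insPair j k Z * insPair j k' Z')).trace =
      (ρ₁ * (ptraceRight (((1 : Matrix A₁ A₁ ℂ) ⊗ₖ ρ₂) * Z) *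
        ptraceRight (((1 : Matrix A₁ A₁ ℂ) ⊗ₖ ρ₂) * Z'))).trace := by
  have : ((LinearMap.mul ℂ _).compl₁₂ (insPair j k) (insPair j k')).compr₂
      (Matrix.traceLinearMap _ ℂ ℂ ∘ₗ LinearMap.mulLeft ℂ (powerPair J L ρ₁ ρ₂)) =
      ((LinearMap.mul ℂ _).compl₁₂
        (ptraceRight ∘ₗ LinearMap.mulLeft ℂ ((1 : Matrix A₁ A₁ ℂ) ⊗ₖ ρ₂))
        (ptraceRight ∘ₗ LinearMap.mulLeft ℂ ((1 : Matrix A₁ A₁ ℂ) ⊗ₖ ρ₂))).compr₂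
      (Matrix.traceLinearMap _ ℂ ℂ ∘ₗ LinearMap.mulLeft ℂ ρ₁) := by
    refine bilinearMap_ext_kronecker fun X X' Y Y' => ?_
    simp [insPair, powerPair, tensorMap_kronecker, ← Matrix.mul_kronecker_mul,
      Matrix.trace_kronecker, trace_tensorPower_mul_ins, h₁, h₂, ins_one_mul,
      trace_tensorPower_mul_ins_mul_ins_of_ne hk, ptraceRight_kronecker]
    ring
  exact LinearMap.congr_fun₂ this Z Z'

theorem trace_powerPair_mul_insPair_ne_left (h₁ : ρ₁.trace = 1) (h₂ : ρ₂.trace = 1) {j j' : J}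
    (hj : j ≠ j') (k : L) (Z Z' : Matrix (A₁ × A₂) (A₁ × A₂) ℂ) :
    (powerPair J L ρ₁ ρ₂ * (insPair j k Z * insPair j' k Z')).trace =
      (ρ₂ * (ptraceLeft ((ρ₁ ⊗ₖ (1 : Matrix A₂ A₂ ℂ)) * Z) *
        ptraceLeft ((ρ₁ ⊗ₖ (1 : Matrix A₂ A₂ ℂ)) * Z'))).trace := by
  have : ((LinearMap.mul ℂ _).compl₁₂ (insPair j k) (insPair j' k)).compr₂
      (Matrix.traceLinearMap _ ℂ ℂ ∘ₗ LinearMap.mulLeft ℂ (powerPair J L ρ₁ ρ₂)) =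
      ((LinearMap.mul ℂ _).compl₁₂
        (ptraceLeft ∘ₗ LinearMap.mulLeft ℂ (ρ₁ ⊗ₖ (1 : Matrix A₂ A₂ ℂ)))
        (ptraceLeft ∘ₗ LinearMap.mulLeft ℂ (ρ₁ ⊗ₖ (1 : Matrix A₂ A₂ ℂ)))).compr₂
      (Matrix.traceLinearMap _ ℂ ℂ ∘ₗ LinearMap.mulLeft ℂ ρ₂) := by
    refine bilinearMap_ext_kronecker fun X X' Y Y' => ?_
    simp [insPair, powerPair, tensorMap_kronecker, ← Matrix.mul_kronecker_mul,
      Matrix.trace_kronecker, trace_tensorPower_mul_ins, h₁, h₂, ins_one_mul,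
      trace_tensorPower_mul_ins_mul_ins_of_ne hj, ptraceLeft_kronecker]
    ring
  exact LinearMap.congr_fun₂ this Z Z'

theorem trace_powerPair_mul_insPair_ne_ne (h₁ : ρ₁.trace = 1) (h₂ : ρ₂.trace = 1) {j j' : J}
    (hj : j ≠ j') {k k' : L} (hk : k ≠ k') (Z Z' : Matrix (A₁ × A₂) (A₁ × A₂) ℂ) :
    (powerPair J L ρ₁ ρ₂ * (insPair j k Z * insPair j' k' Z')).trace =
      ((ρ₁ ⊗ₖ ρ₂) * Z).trace * ((ρ₁ ⊗ₖ ρ₂) * Z').trace := by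
  have : ((LinearMap.mul ℂ _).compl₁₂ (insPair j k) (insPair j' k')).compr₂
      (Matrix.traceLinearMap _ ℂ ℂ ∘ₗ LinearMap.mulLeft ℂ (powerPair J L ρ₁ ρ₂)) =
      (LinearMap.mul ℂ ℂ).compl₁₂
        (Matrix.traceLinearMap _ ℂ ℂ ∘ₗ LinearMap.mulLeft ℂ (ρ₁ ⊗ₖ ρ₂))
        (Matrix.traceLinearMap _ ℂ ℂ ∘ₗ LinearMap.mulLeft ℂ (ρ₁ ⊗ₖ ρ₂)) := by
    refine bilinearMap_ext_kronecker fun X X' Y Y' => ?_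
    simp [insPair, powerPair, tensorMap_kronecker, ← Matrix.mul_kronecker_mul,
      Matrix.trace_kronecker, h₁, h₂,
      trace_tensorPower_mul_ins_mul_ins_of_ne hj, trace_tensorPower_mul_ins_mul_ins_of_ne hk]
    ring
  exact LinearMap.congr_fun₂ this Z Z'

end InsPair

section SecondMoment

variable {J L A₁ A₂ : Type*} [Fintype J] [DecidableEq J] [Fintype L] [DecidableEq L]
  [Fintype A₁] [DecidableEq A₁] [Fintype A₂] [DecidableEq A₂]

/-- Insert a bipartite operator at a uniformly random pair of copies `(j, k) ∈ s × t`, all other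
copies carrying `ρ₁` and `ρ₂`. -/
def avgIns (s : Finset J) (t : Finset L) (ρ₁ : Matrix A₁ A₁ ℂ) (ρ₂ : Matrix A₂ A₂ ℂ) :
    Matrix (A₁ × A₂) (A₁ × A₂) ℂ →ₗ[ℂ]
      Matrix ((J → A₁) × (L → A₂)) ((J → A₁) × (L → A₂)) ℂ :=
  ((s.card * t.card : ℝ) : ℂ)⁻¹ • ∑ p ∈ s ×ˢ t, tensorMap (ins p.1 ρ₁) (ins p.2 ρ₂)

theorem sum_prod_if_eq (s : Finset J) (t : Finset L) (c δ : ℝ) :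
    ∑ p ∈ s ×ˢ t, ∑ q ∈ s ×ˢ t, (1 + (if p = q then c else 0) + (if p.1 = q.1 then δ else 0) +
      (if p.2 = q.2 then δ else 0)) =
      (s.card * t.card) * (s.card * t.card) + (s.card * t.card) * c +
        s.card * t.card * t.card * δ + s.card * t.card * s.card * δ := by
  have hp : ∀ p ∈ s ×ˢ t, ∑ q ∈ s ×ˢ t, (1 + (if p = q then c else 0) +
      (if p.1 = q.1 then δ else 0) + (if p.2 = q.2 then δ else 0)) =
      (s.card * t.card) + c + t.card * δ + s.card * δ := by
    rintro ⟨j, k⟩ hjk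
    have hj := (Finset.mem_product.mp hjk).1
    have hk := (Finset.mem_product.mp hjk).2
    have e1 : ∑ q ∈ s ×ˢ t, (if j = q.1 then δ else 0) = t.card * δ := by
      refine (Finset.sum_product' s t fun j' _ => if j = j' then δ else 0).trans ?_
      simp [hj]
    have e2 : ∑ q ∈ s ×ˢ t, (if k = q.2 then δ else 0) = s.card * δ := by
      refine (Finset.sum_product_right' s t fun _ k' => if k = k' then δ else 0).trans ?_
      simp [hk]
    rw [Finset.sum_add_distrib, Finset.sum_add_distrib, Finset.sum_add_distrib,
      Finset.sum_ite_eq, if_pos hjk, e1, e2]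
    simp
  rw [Finset.sum_congr rfl hp, Finset.sum_const, Finset.card_product, nsmul_eq_mul]
  push_cast
  ring

variable {ρ₁ : Matrix A₁ A₁ ℂ} {ρ₂ : Matrix A₂ A₂ ℂ} {Z : Matrix (A₁ × A₂) (A₁ × A₂) ℂ} {c δ : ℝ}

/-- The bipartite convex split: the average of `Z` over the pairs of copies in `s × t` has variance
at most `c / (#s #t) + δ / #s + δ / #t` in the state `ρ₁^{⊗ J} ⊗ ρ₂^{⊗ L}`. -/
theorem trace_avgIns_sq_le (h₁ : ρ₁.trace = 1) (h₂ : ρ₂.trace = 1)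
    (hZ : ((ρ₁ ⊗ₖ ρ₂) * Z).trace = 1) (hc : ((ρ₁ ⊗ₖ ρ₂) * (Z * Z)).trace.re ≤ c)
    (hδ : 0 ≤ δ) (hr : (ρ₁ * (ptraceRight (((1 : Matrix A₁ A₁ ℂ) ⊗ₖ ρ₂) * Z) *
        ptraceRight (((1 : Matrix A₁ A₁ ℂ) ⊗ₖ ρ₂) * Z))).trace.re ≤ 1 + δ)
    (hl : (ρ₂ * (ptraceLeft ((ρ₁ ⊗ₖ (1 : Matrix A₂ A₂ ℂ)) * Z) *
        ptraceLeft ((ρ₁ ⊗ₖ (1 : Matrix A₂ A₂ ℂ)) * Z))).trace.re ≤ 1 + δ)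
    {s : Finset J} {t : Finset L} (hs : s.Nonempty) (ht : t.Nonempty) :
    (powerPair J L ρ₁ ρ₂ * (avgIns s t 1 1 Z * avgIns s t 1 1 Z)).trace.re ≤
      1 + c / (s.card * t.card) + δ / s.card + δ / t.card := by
  have hs0 : (0 : ℝ) < s.card := by exact_mod_cast hs.card_pos
  have ht0 : (0 : ℝ) < t.card := by exact_mod_cast ht.card_pos
  have key : ∀ p q : J × L,
      (powerPair J L ρ₁ ρ₂ * (insPair p.1 p.2 Z * insPair q.1 q.2 Z)).trace.re ≤
        1 + (if p = q then c else 0) + (if p.1 = q.1 then δ else 0) +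
          (if p.2 = q.2 then δ else 0) := by
    rintro ⟨j, k⟩ ⟨j', k'⟩
    by_cases hj : j = j' <;> by_cases hk : k = k'
    · subst hj hk
      simp only [if_true]
      rw [insPair_mul, trace_powerPair_mul_insPair h₁ h₂]
      linarith
    · subst hj
      simp only [Prod.mk.injEq, true_and, hk, if_true, if_false]
      rw [trace_powerPair_mul_insPair_ne_right h₁ h₂ j hk]
      linarith
    · subst hk
      simp only [Prod.mk.injEq, and_true, hj, if_true, if_false]
      rw [trace_powerPair_mul_insPair_ne_left h₁ h₂ hj]
      linarith
    · simp only [Prod.mk.injEq, hj, hk, if_false, false_and]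
      rw [trace_powerPair_mul_insPair_ne_ne h₁ h₂ hj hk, hZ]
      simp
  have e : (powerPair J L ρ₁ ρ₂ * (avgIns s t 1 1 Z * avgIns s t 1 1 Z)).trace.re =
      ((s.card * t.card : ℝ)⁻¹ * (s.card * t.card : ℝ)⁻¹) *
        ∑ p ∈ s ×ˢ t, ∑ q ∈ s ×ˢ t,
          (powerPair J L ρ₁ ρ₂ * (insPair p.1 p.2 Z * insPair q.1 q.2 Z)).trace.re := by
    simp only [avgIns, LinearMap.smul_apply, LinearMap.sum_apply, Matrix.smul_mul,
      Matrix.mul_smul, smul_smul, Finset.sum_mul_sum]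
    simp only [Matrix.mul_sum, Matrix.trace_smul, Matrix.trace_sum, smul_eq_mul,
      ← Complex.ofReal_inv, ← Complex.ofReal_mul, Complex.re_ofReal_mul, Complex.re_sum]
    rfl
  rw [e]
  have hsum := Finset.sum_le_sum fun p (_ : p ∈ s ×ˢ t) =>
    Finset.sum_le_sum fun q (_ : q ∈ s ×ˢ t) => key p q
  rw [sum_prod_if_eq] at hsum
  refine (mul_le_mul_of_nonneg_left hsum (by positivity)).trans_eq ?_
  field_simp

theorem trace_mul_avgIns (h₁ : ρ₁.trace = 1) (h₂ : ρ₂.trace = 1)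
    {s : Finset J} {t : Finset L} (hs : s.Nonempty) (ht : t.Nonempty) :
    (powerPair J L ρ₁ ρ₂ * avgIns s t 1 1 Z).trace = ((ρ₁ ⊗ₖ ρ₂) * Z).trace := by
  have hs0 : (s.card : ℂ) ≠ 0 := by exact_mod_cast hs.card_pos.ne'
  have ht0 : (t.card : ℂ) ≠ 0 := by exact_mod_cast ht.card_pos.ne'
  have h : ∀ p : J × L, (powerPair J L ρ₁ ρ₂ * tensorMap (ins p.1 1) (ins p.2 1) Z).trace =
    ((ρ₁ ⊗ₖ ρ₂) * Z).trace := fun p => trace_powerPair_mul_insPair h₁ h₂ p.1 p.2 Z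
  simp only [avgIns, LinearMap.smul_apply, LinearMap.sum_apply, Matrix.mul_smul,
    Matrix.mul_sum, Matrix.trace_smul, Matrix.trace_sum, smul_eq_mul, h, Finset.sum_const,
    Finset.card_product, nsmul_eq_mul]
  push_cast
  field_simp

end SecondMoment

section Support

variable {A₁ A₂ : Type*} [Fintype A₁] [DecidableEq A₁] [Fintype A₂] [DecidableEq A₂]
  {ρ₁ : Matrix A₁ A₁ ℂ} {ρ₂ : Matrix A₂ A₂ ℂ} {ω : Matrix (A₁ × A₂) (A₁ × A₂) ℂ} {c δ : ℝ}

theorem mul_supp_kronecker_supp (h₁ : ρ₁.PosSemidef) (h₂ : ρ₂.PosSemidef) (hω : ω.PosSemidef)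
    (h : ω ≤ c • (ρ₁ ⊗ₖ ρ₂)) : ω * (supp ρ₁ ⊗ₖ supp ρ₂) = ω := by
  set Q := 1 - supp ρ₁ ⊗ₖ supp ρ₂ with hQ
  have hPH : (supp ρ₁ ⊗ₖ supp ρ₂).IsHermitian := by
    rw [Matrix.IsHermitian, Matrix.conjTranspose_kronecker, (isHermitian_supp h₁).eq,
      (isHermitian_supp h₂).eq]
  have hQH : Q.IsHermitian := Matrix.isHermitian_one.sub hPH
  have h0 : (ρ₁ ⊗ₖ ρ₂) * Q = 0 := by
    rw [hQ, Matrix.mul_sub, Matrix.mul_one, ← Matrix.mul_kronecker_mul, mul_supp h₁, mul_supp h₂,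
      sub_self]
  have h1 : ω * Q = 0 := by
    refine mul_eq_zero_of_trace_conj hω ?_
    rw [hQH.eq]
    refine (re_trace_mono (hermitian_conj_le h hQH)).trans ?_
    rw [Matrix.mul_assoc, Matrix.smul_mul, h0]
    simp
  rw [hQ, Matrix.mul_sub, Matrix.mul_one, sub_eq_zero] at h1
  exact h1.symm

theorem kronecker_sqrtPinv_conj (h₁ : ρ₁.PosSemidef) (h₂ : ρ₂.PosSemidef) :
    (sqrtPinv ρ₁ ⊗ₖ sqrtPinv ρ₂) * (ρ₁ ⊗ₖ ρ₂) * (sqrtPinv ρ₁ ⊗ₖ sqrtPinv ρ₂) =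
      supp ρ₁ ⊗ₖ supp ρ₂ := by
  rw [← Matrix.mul_kronecker_mul, ← Matrix.mul_kronecker_mul, sqrtPinv_conj h₁, sqrtPinv_conj h₂]

theorem isHermitian_kronecker_sqrtPinv (ρ₁ : Matrix A₁ A₁ ℂ) (ρ₂ : Matrix A₂ A₂ ℂ) :
    (sqrtPinv ρ₁ ⊗ₖ sqrtPinv ρ₂).IsHermitian := by
  rw [Matrix.IsHermitian, Matrix.conjTranspose_kronecker, (isHermitian_sqrtPinv ρ₁).eq,
    (isHermitian_sqrtPinv ρ₂).eq]

/-- The second moments of `Z = (ρ₁ ⊗ ρ₂)^{-1/2} ω (ρ₁ ⊗ ρ₂)^{-1/2}` are controlled by the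
max-relative entropy of `ω` and by the domination of its marginals. -/
theorem moments_sqrtPinv_conj (h₁ : ρ₁.PosSemidef) (h₂ : ρ₂.PosSemidef) (hω : IsState ω)
    (hc : 0 ≤ c) (hδ : 0 ≤ δ) (h : ω ≤ c • (ρ₁ ⊗ₖ ρ₂)) (hr : ptraceRight ω ≤ (1 + δ) • ρ₁)
    (hl : ptraceLeft ω ≤ (1 + δ) • ρ₂) {Z : Matrix (A₁ × A₂) (A₁ × A₂) ℂ}
    (hZ : Z = (sqrtPinv ρ₁ ⊗ₖ sqrtPinv ρ₂) * ω * (sqrtPinv ρ₁ ⊗ₖ sqrtPinv ρ₂)) :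
    ((ρ₁ ⊗ₖ ρ₂) * Z).trace = 1 ∧ ((ρ₁ ⊗ₖ ρ₂) * (Z * Z)).trace.re ≤ c ∧
      (ρ₁ * (ptraceRight (((1 : Matrix A₁ A₁ ℂ) ⊗ₖ ρ₂) * Z) *
        ptraceRight (((1 : Matrix A₁ A₁ ℂ) ⊗ₖ ρ₂) * Z))).trace.re ≤ 1 + δ ∧
      (ρ₂ * (ptraceLeft ((ρ₁ ⊗ₖ (1 : Matrix A₂ A₂ ℂ)) * Z) *
        ptraceLeft ((ρ₁ ⊗ₖ (1 : Matrix A₂ A₂ ℂ)) * Z))).trace.re ≤ 1 + δ := by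
  have hωP := mul_supp_kronecker_supp h₁ h₂ hω.posSemidef h
  have hPω : (supp ρ₁ ⊗ₖ supp ρ₂) * ω = ω := by
    have := congrArg Matrix.conjTranspose hωP
    rwa [Matrix.conjTranspose_mul, Matrix.conjTranspose_kronecker, (isHermitian_supp h₁).eq,
      (isHermitian_supp h₂).eq, hω.posSemidef.isHermitian.eq] at this
  have hsH := isHermitian_kronecker_sqrtPinv ρ₁ ρ₂
  have hZp : Z.PosSemidef := by
    rw [hZ]; exact posSemidef_hermitian_conj hω.posSemidef hsH
  have hρp : (ρ₁ ⊗ₖ ρ₂).PosSemidef := h₁.kronecker h₂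
  have hPQ1 : supp ρ₁ ⊗ₖ supp ρ₂ ≤ 1 :=
    kronecker_le_one (supp_posSemidef h₁) (supp_le_one h₁) (supp_le_one h₂)
  have hZc : Z ≤ c • (1 : Matrix (A₁ × A₂) (A₁ × A₂) ℂ) := by
    have := hermitian_conj_le h hsH
    rw [← hZ, Matrix.mul_smul, Matrix.smul_mul, kronecker_sqrtPinv_conj h₁ h₂] at this
    exact this.trans (smul_le_smul_of_nonneg_left hPQ1 hc)
  have htr : ((ρ₁ ⊗ₖ ρ₂) * Z).trace = 1 := by
    rw [hZ, ← Matrix.mul_assoc, Matrix.trace_mul_comm, ← Matrix.mul_assoc, ← Matrix.mul_assoc,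
      kronecker_sqrtPinv_conj h₁ h₂, hPω, hω.trace_eq_one]
  refine ⟨htr, ?_, ?_, ?_⟩
  · have := re_trace_mul_sq_le hρp hZp hZc
    rwa [htr, Complex.one_re, mul_one] at this
  · have e1 : ptraceRight (((1 : Matrix A₁ A₁ ℂ) ⊗ₖ ρ₂) * Z) =
        sqrtPinv ρ₁ * ptraceRight ω * sqrtPinv ρ₁ := by
      have a1 : (sqrtPinv ρ₁ ⊗ₖ sqrtPinv ρ₂) =
          ((1 : Matrix A₁ A₁ ℂ) ⊗ₖ sqrtPinv ρ₂) * (sqrtPinv ρ₁ ⊗ₖ (1 : Matrix A₂ A₂ ℂ)) := by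
        rw [← Matrix.mul_kronecker_mul, Matrix.one_mul, Matrix.mul_one]
      have a2 : (sqrtPinv ρ₁ ⊗ₖ sqrtPinv ρ₂) =
          (sqrtPinv ρ₁ ⊗ₖ (1 : Matrix A₂ A₂ ℂ)) * ((1 : Matrix A₁ A₁ ℂ) ⊗ₖ sqrtPinv ρ₂) := by
        rw [← Matrix.mul_kronecker_mul, Matrix.one_mul, Matrix.mul_one]
      have a3 : ((1 : Matrix A₁ A₁ ℂ) ⊗ₖ ρ₂) * Z = ((1 : Matrix A₁ A₁ ℂ) ⊗ₖ (ρ₂ * sqrtPinv ρ₂)) *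
          ((sqrtPinv ρ₁ ⊗ₖ (1 : Matrix A₂ A₂ ℂ)) * ω * (sqrtPinv ρ₁ ⊗ₖ (1 : Matrix A₂ A₂ ℂ))) *
          ((1 : Matrix A₁ A₁ ℂ) ⊗ₖ sqrtPinv ρ₂) := by
        rw [hZ]
        nth_rw 1 [a1]
        rw [a2, ← one_kronecker_mul]
        simp only [Matrix.mul_assoc]
      have a4 : ((1 : Matrix A₁ A₁ ℂ) ⊗ₖ (sqrtPinv ρ₂ * (ρ₂ * sqrtPinv ρ₂))) *
          ((sqrtPinv ρ₁ ⊗ₖ (1 : Matrix A₂ A₂ ℂ)) * ω * (sqrtPinv ρ₁ ⊗ₖ (1 : Matrix A₂ A₂ ℂ))) =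
          (sqrtPinv ρ₁ ⊗ₖ (1 : Matrix A₂ A₂ ℂ)) * (((1 : Matrix A₁ A₁ ℂ) ⊗ₖ supp ρ₂) * ω) *
            (sqrtPinv ρ₁ ⊗ₖ (1 : Matrix A₂ A₂ ℂ)) := by
        rw [← Matrix.mul_assoc (sqrtPinv ρ₂), sqrtPinv_conj h₂]
        simp only [← Matrix.mul_assoc, ← Matrix.mul_kronecker_mul, Matrix.one_mul, Matrix.mul_one]
      have a5 : ((1 : Matrix A₁ A₁ ℂ) ⊗ₖ supp ρ₂) * ω = ω := by
        nth_rw 1 [← hPω]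
        rw [← Matrix.mul_assoc, ← Matrix.mul_kronecker_mul, Matrix.one_mul, supp_mul_supp h₂, hPω]
      rw [a3, ptraceRight_one_kronecker_conj, a4, a5, ptraceRight_conj]
    rw [e1]
    have hp : (sqrtPinv ρ₁ * ptraceRight ω * sqrtPinv ρ₁).PosSemidef :=
      posSemidef_hermitian_conj (ptraceRight_posSemidef hω.posSemidef) (isHermitian_sqrtPinv ρ₁)
    have hle : sqrtPinv ρ₁ * ptraceRight ω * sqrtPinv ρ₁ ≤ (1 + δ) • (1 : Matrix A₁ A₁ ℂ) := by
      have := hermitian_conj_le hr (isHermitian_sqrtPinv ρ₁)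
      rw [Matrix.mul_smul, Matrix.smul_mul, sqrtPinv_conj h₁] at this
      exact this.trans (smul_le_smul_of_nonneg_left (supp_le_one h₁) (by linarith))
    refine (re_trace_mul_sq_le h₁ hp hle).trans ?_
    have : (ρ₁ * (sqrtPinv ρ₁ * ptraceRight ω * sqrtPinv ρ₁)).trace.re ≤ 1 := by
      rw [← Matrix.mul_assoc, Matrix.trace_mul_comm, ← Matrix.mul_assoc, ← Matrix.mul_assoc,
        sqrtPinv_conj h₁]
      refine (re_trace_mul_mono_left (ptraceRight_posSemidef hω.posSemidef)
        (supp_le_one h₁)).trans ?_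
      rw [Matrix.one_mul, trace_ptraceRight, hω.trace_eq_one, Complex.one_re]
    nlinarith
  · have e1 : ptraceLeft ((ρ₁ ⊗ₖ (1 : Matrix A₂ A₂ ℂ)) * Z) =
        sqrtPinv ρ₂ * ptraceLeft ω * sqrtPinv ρ₂ := by
      have a1 : (sqrtPinv ρ₁ ⊗ₖ sqrtPinv ρ₂) =
          ((1 : Matrix A₁ A₁ ℂ) ⊗ₖ sqrtPinv ρ₂) * (sqrtPinv ρ₁ ⊗ₖ (1 : Matrix A₂ A₂ ℂ)) := by
        rw [← Matrix.mul_kronecker_mul, Matrix.one_mul, Matrix.mul_one]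
      have a2 : (sqrtPinv ρ₁ ⊗ₖ sqrtPinv ρ₂) =
          (sqrtPinv ρ₁ ⊗ₖ (1 : Matrix A₂ A₂ ℂ)) * ((1 : Matrix A₁ A₁ ℂ) ⊗ₖ sqrtPinv ρ₂) := by
        rw [← Matrix.mul_kronecker_mul, Matrix.one_mul, Matrix.mul_one]
      have a3 : (ρ₁ ⊗ₖ (1 : Matrix A₂ A₂ ℂ)) * Z = ((ρ₁ * sqrtPinv ρ₁) ⊗ₖ (1 : Matrix A₂ A₂ ℂ)) *
          (((1 : Matrix A₁ A₁ ℂ) ⊗ₖ sqrtPinv ρ₂) * ω * ((1 : Matrix A₁ A₁ ℂ) ⊗ₖ sqrtPinv ρ₂)) *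
          (sqrtPinv ρ₁ ⊗ₖ (1 : Matrix A₂ A₂ ℂ)) := by
        have a0 : (ρ₁ * sqrtPinv ρ₁) ⊗ₖ (1 : Matrix A₂ A₂ ℂ) =
            (ρ₁ ⊗ₖ (1 : Matrix A₂ A₂ ℂ)) * (sqrtPinv ρ₁ ⊗ₖ (1 : Matrix A₂ A₂ ℂ)) := by
          rw [← Matrix.mul_kronecker_mul, Matrix.one_mul]
        rw [hZ]
        nth_rw 1 [a2]
        rw [a1, a0]
        simp only [Matrix.mul_assoc]
      have a4 : ((sqrtPinv ρ₁ * (ρ₁ * sqrtPinv ρ₁)) ⊗ₖ (1 : Matrix A₂ A₂ ℂ)) *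
          (((1 : Matrix A₁ A₁ ℂ) ⊗ₖ sqrtPinv ρ₂) * ω * ((1 : Matrix A₁ A₁ ℂ) ⊗ₖ sqrtPinv ρ₂)) =
          ((1 : Matrix A₁ A₁ ℂ) ⊗ₖ sqrtPinv ρ₂) * ((supp ρ₁ ⊗ₖ (1 : Matrix A₂ A₂ ℂ)) * ω) *
            ((1 : Matrix A₁ A₁ ℂ) ⊗ₖ sqrtPinv ρ₂) := by
        rw [← Matrix.mul_assoc (sqrtPinv ρ₁), sqrtPinv_conj h₁]
        simp only [← Matrix.mul_assoc, ← Matrix.mul_kronecker_mul, Matrix.one_mul, Matrix.mul_one]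
      have a5 : (supp ρ₁ ⊗ₖ (1 : Matrix A₂ A₂ ℂ)) * ω = ω := by
        nth_rw 1 [← hPω]
        rw [← Matrix.mul_assoc, ← Matrix.mul_kronecker_mul, Matrix.one_mul, supp_mul_supp h₁, hPω]
      rw [a3, ptraceLeft_kronecker_one_conj, a4, a5, ptraceLeft_conj]
    rw [e1]
    have hp : (sqrtPinv ρ₂ * ptraceLeft ω * sqrtPinv ρ₂).PosSemidef :=
      posSemidef_hermitian_conj (ptraceLeft_posSemidef hω.posSemidef) (isHermitian_sqrtPinv ρ₂)
    have hle : sqrtPinv ρ₂ * ptraceLeft ω * sqrtPinv ρ₂ ≤ (1 + δ) • (1 : Matrix A₂ A₂ ℂ) := by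
      have := hermitian_conj_le hl (isHermitian_sqrtPinv ρ₂)
      rw [Matrix.mul_smul, Matrix.smul_mul, sqrtPinv_conj h₂] at this
      exact this.trans (smul_le_smul_of_nonneg_left (supp_le_one h₂) (by linarith))
    refine (re_trace_mul_sq_le h₂ hp hle).trans ?_
    have : (ρ₂ * (sqrtPinv ρ₂ * ptraceLeft ω * sqrtPinv ρ₂)).trace.re ≤ 1 := by
      rw [← Matrix.mul_assoc, Matrix.trace_mul_comm, ← Matrix.mul_assoc, ← Matrix.mul_assoc,
        sqrtPinv_conj h₂]
      refine (re_trace_mul_mono_left (ptraceLeft_posSemidef hω.posSemidef)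
        (supp_le_one h₂)).trans ?_
      rw [Matrix.one_mul, trace_ptraceLeft, hω.trace_eq_one, Complex.one_re]
    nlinarith

end Support

/-! ### Choi operators of encoders -/

section Normalize

variable {F R : Type*} [Fintype F] [DecidableEq F] [Fintype R] [DecidableEq R]

/-- An operator `Y` whose marginal `Z` is close to the identity can be normalised to a Choi
operator. The closeness is measured by the second moment of `Z` in the state `Θ²`, and the
normalisation is `Y ↦ X Y X` with `X = 2 (1 + Z)⁻¹`, for which `X Z X = 1 - (X - 1)²`. -/
theorem exists_choi_of_second_moment {Y : Matrix (F × R) (F × R) ℂ} (hY : Y.PosSemidef)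
    {Θ Z : Matrix R R ℂ} (hΘ : Θ.IsHermitian) (hΘ1 : (Θ * Θ).trace = 1) (hZ : ptraceLeft Y = Z)
    (hZ1 : (Θ * Θ * Z).trace = 1) (f₀ : F) :
    ∃ Γ Δ : Matrix (F × R) (F × R) ℂ, Γ.PosSemidef ∧ ptraceLeft Γ = 1 ∧ Δ.PosSemidef ∧
      ((1 : Matrix F F ℂ) ⊗ₖ Θ) * Γ * ((1 : Matrix F F ℂ) ⊗ₖ Θ) ≤
        (5 / 4 : ℝ) • (((1 : Matrix F F ℂ) ⊗ₖ Θ) * Y * ((1 : Matrix F F ℂ) ⊗ₖ Θ)) + Δ ∧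
      Δ.trace.re ≤ 9 / 4 * ((Θ * Θ * (Z * Z)).trace.re - 1) := by
  have hZp : Z.PosSemidef := hZ ▸ ptraceLeft_posSemidef hY
  have hTd : (1 + Z).PosDef := Matrix.PosDef.one.add_posSemidef hZp
  have hdet := (Matrix.isUnit_iff_isUnit_det _).mp hTd.isUnit
  obtain ⟨X, hX⟩ : ∃ X : Matrix R R ℂ, X = (2 : ℝ) • (1 + Z)⁻¹ := ⟨_, rfl⟩
  have hXT : X * (1 + Z) = (2 : ℝ) • (1 : Matrix R R ℂ) := by
    rw [hX, Matrix.smul_mul, Matrix.nonsing_inv_mul _ hdet]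
  have hTX : (1 + Z) * X = (2 : ℝ) • (1 : Matrix R R ℂ) := by
    rw [hX, Matrix.mul_smul, Matrix.mul_nonsing_inv _ hdet]
  have hXH : Xᴴ = X := by
    rw [hX, Matrix.conjTranspose_smul, hTd.isHermitian.inv.eq, star_trivial]
  obtain ⟨V, hV⟩ : ∃ V : Matrix R R ℂ, V = X - 1 := ⟨_, rfl⟩
  have hVH : Vᴴ = V := by
    rw [hV, Matrix.conjTranspose_sub, hXH, Matrix.conjTranspose_one]
  have hXZ : X * Z = (2 : ℝ) • (1 : Matrix R R ℂ) - X := by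
    rw [← hXT, Matrix.mul_add, Matrix.mul_one, add_sub_cancel_left]
  have hZX : Z * X = (2 : ℝ) • (1 : Matrix R R ℂ) - X := by
    rw [← hTX, Matrix.add_mul, Matrix.one_mul, add_sub_cancel_left]
  have hXZX : X * Z * X = 1 - V * V := by
    rw [hXZ, hV, Matrix.sub_mul, Matrix.smul_mul, Matrix.one_mul, Matrix.sub_mul, Matrix.mul_sub,
      Matrix.mul_one, Matrix.one_mul]
    module
  have h1ZH : (1 - Z).IsHermitian := Matrix.isHermitian_one.sub hZp.isHermitian
  have h2V : (2 : ℝ) • V = X * (1 - Z) := by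
    rw [Matrix.mul_sub, Matrix.mul_one, hXZ, hV]
    module
  have h2V' : (2 : ℝ) • V = (1 - Z) * X := by
    rw [Matrix.sub_mul, Matrix.one_mul, hZX, hV]
    module
  have hVV : (V * V).PosSemidef := by
    have := Matrix.posSemidef_conjTranspose_mul_self V
    rwa [hVH] at this
  -- as `2 V = X (1 - Z)`, the bounds `X Z X ≤ 1` and `X² ≤ 4` give two bounds by `(1 - Z)²`
  have b1 : (4 : ℝ) • (V * Z * V) ≤ (1 - Z) * (1 - Z) := by
    have e : (4 : ℝ) • (V * Z * V) = (1 - Z) * (X * Z * X) * (1 - Z) := by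
      calc (4 : ℝ) • (V * Z * V) = ((2 : ℝ) • V) * Z * ((2 : ℝ) • V) := by
            simp only [Matrix.smul_mul, Matrix.mul_smul, smul_smul]; norm_num
        _ = (1 - Z) * (X * Z * X) * (1 - Z) := by
            nth_rw 1 [h2V']
            rw [h2V]
            simp only [Matrix.mul_assoc]
    have h := hermitian_conj_le (X := X * Z * X) (Y := 1)
      (by rw [hXZX]; exact sub_le_self _ hVV.nonneg) h1ZH
    rwa [← e, Matrix.mul_one] at h
  have b2 : V * V ≤ (1 - Z) * (1 - Z) := by
    have e : (4 : ℝ) • (V * V) = (1 - Z) * (X * X) * (1 - Z) := by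
      calc (4 : ℝ) • (V * V) = ((2 : ℝ) • V) * ((2 : ℝ) • V) := by
            simp only [Matrix.smul_mul, Matrix.mul_smul, smul_smul]; norm_num
        _ = (1 - Z) * (X * X) * (1 - Z) := by
            nth_rw 1 [h2V']
            rw [h2V]
            simp only [Matrix.mul_assoc]
    have hXX : X * X ≤ (4 : ℝ) • (1 : Matrix R R ℂ) := by
      have hp : ((2 : ℝ) • Z + Z * Z).PosSemidef := by
        refine (hZp.smul (by norm_num)).add ?_
        have := Matrix.posSemidef_conjTranspose_mul_self Z
        rwa [hZp.isHermitian.eq] at this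
      refine le_of_sub_eq (posSemidef_hermitian_conj hp hXH) ?_
      have : X * ((1 + Z) * (1 + Z)) * X = (4 : ℝ) • (1 : Matrix R R ℂ) := by
        rw [← Matrix.mul_assoc, hXT, Matrix.smul_mul, Matrix.one_mul, Matrix.smul_mul, hTX,
          smul_smul]
        norm_num
      rw [← this]
      have e2 : (1 + Z) * (1 + Z) = 1 + ((2 : ℝ) • Z + Z * Z) := by
        rw [Matrix.mul_add, Matrix.mul_one, Matrix.add_mul, Matrix.one_mul]
        module
      rw [e2, Matrix.mul_add, Matrix.add_mul, Matrix.mul_one, add_sub_cancel_left]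
    have h := hermitian_conj_le hXX h1ZH
    rw [← e, Matrix.mul_smul, Matrix.smul_mul, Matrix.mul_one] at h
    have h4 := smul_le_smul_of_nonneg_left h (show (0 : ℝ) ≤ 1 / 4 by norm_num)
    rw [smul_smul, smul_smul] at h4
    norm_num at h4
    exact h4
  have hσ : (Θ * Θ).PosSemidef := by
    have := Matrix.posSemidef_conjTranspose_mul_self Θ
    rwa [hΘ.eq] at this
  have hQ : (Θ * Θ * ((1 - Z) * (1 - Z))).trace.re = (Θ * Θ * (Z * Z)).trace.re - 1 := by
    have : (1 - Z) * (1 - Z) = 1 - (2 : ℝ) • Z + Z * Z := by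
      rw [Matrix.mul_sub, Matrix.mul_one, Matrix.sub_mul, Matrix.one_mul]
      module
    rw [this, Matrix.mul_add, Matrix.mul_sub, Matrix.mul_one, Matrix.mul_smul, Matrix.trace_add,
      Matrix.trace_sub, Complex.add_re, Complex.sub_re, re_trace_real_smul, hZ1, hΘ1]
    norm_num
    ring
  have hΘV : (Θ * V)ᴴ = V * Θ := by rw [Matrix.conjTranspose_mul, hVH, hΘ.eq]
  have hJp : (Matrix.single f₀ f₀ (1 : ℂ) ⊗ₖ (Θ * (V * V) * Θ)).PosSemidef :=
    (single_posSemidef f₀).kronecker (posSemidef_hermitian_conj hVV hΘ)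
  refine ⟨((1 : Matrix F F ℂ) ⊗ₖ X) * Y * ((1 : Matrix F F ℂ) ⊗ₖ X) +
      Matrix.single f₀ f₀ (1 : ℂ) ⊗ₖ (V * V),
    (5 : ℝ) • (((1 : Matrix F F ℂ) ⊗ₖ (Θ * V)) * Y * ((1 : Matrix F F ℂ) ⊗ₖ (Θ * V))ᴴ) +
      Matrix.single f₀ f₀ (1 : ℂ) ⊗ₖ (Θ * (V * V) * Θ), ?_, ?_, ?_, ?_, ?_⟩
  · exact (posSemidef_hermitian_conj hY (isHermitian_one_kronecker hXH)).add
      ((single_posSemidef f₀).kronecker hVV)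
  · rw [map_add, ptraceLeft_conj, hZ, hXZX, ptraceLeft_kronecker]
    simp
  · exact ((hY.mul_mul_conjTranspose_same _).smul (by norm_num)).add hJp
  -- the constants `5/4` and `9/4 = 5 * (1/4) + 1` come from splitting `Θ X = Θ + Θ V` at `t = 1/4`
  · have h := conj_add_le hY ((1 : Matrix F F ℂ) ⊗ₖ Θ) ((1 : Matrix F F ℂ) ⊗ₖ (Θ * V))
      (t := 1 / 4) (by norm_num)
    have e1 : Θ + Θ * V = Θ * X := by
      rw [hV, Matrix.mul_sub, Matrix.mul_one, add_sub_cancel]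
    have e2 : (Θ * X)ᴴ = X * Θ := by rw [Matrix.conjTranspose_mul, hXH, hΘ.eq]
    rw [← Matrix.kronecker_add, e1, conjTranspose_one_kronecker (S := Θ * X), e2,
      conjTranspose_one_kronecker (S := Θ), hΘ.eq] at h
    norm_num at h
    have e3 : ((1 : Matrix F F ℂ) ⊗ₖ Θ) * (((1 : Matrix F F ℂ) ⊗ₖ X) * Y *
        ((1 : Matrix F F ℂ) ⊗ₖ X) + Matrix.single f₀ f₀ (1 : ℂ) ⊗ₖ (V * V)) *
        ((1 : Matrix F F ℂ) ⊗ₖ Θ) = ((1 : Matrix F F ℂ) ⊗ₖ (Θ * X)) * Y *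
        ((1 : Matrix F F ℂ) ⊗ₖ (X * Θ)) +
        Matrix.single f₀ f₀ (1 : ℂ) ⊗ₖ (Θ * (V * V) * Θ) := by
      rw [Matrix.mul_add, Matrix.add_mul, ← one_kronecker_mul, ← one_kronecker_mul,
        ← Matrix.mul_kronecker_mul, ← Matrix.mul_kronecker_mul, Matrix.one_mul, Matrix.mul_one]
      simp only [Matrix.mul_assoc]
    rw [e3, ← add_assoc]
    gcongr
  · rw [Matrix.trace_add, Complex.add_re, re_trace_real_smul, conjTranspose_one_kronecker, hΘV,
      trace_one_kronecker_conj, hZ, Matrix.trace_kronecker, Matrix.trace_single_eq_same, one_mul]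
    have c1 : (Θ * V * Z * (V * Θ)).trace = (Θ * Θ * (V * Z * V)).trace := by
      have : Θ * V * Z * (V * Θ) = Θ * (V * Z * V) * Θ := by simp only [Matrix.mul_assoc]
      rw [this, Matrix.trace_mul_comm, ← Matrix.mul_assoc]
    have c2 : (Θ * (V * V) * Θ).trace = (Θ * Θ * (V * V)).trace := by
      rw [Matrix.trace_mul_comm, ← Matrix.mul_assoc]
    have d1 := re_trace_mul_mono hσ b1
    have d2 := re_trace_mul_mono hσ b2
    rw [Matrix.mul_smul, re_trace_real_smul] at d1
    rw [c1, c2]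
    linarith

end Normalize

section Encoder

variable {F J L A₁ A₂ : Type*} [Fintype F] [DecidableEq F] [Fintype J] [DecidableEq J] [Fintype L]
  [DecidableEq L] [Fintype A₁] [DecidableEq A₁] [Fintype A₂] [DecidableEq A₂]

theorem isCP_smul_sum {ι A B : Type*} (s : Finset ι) {c : ℝ} (hc : 0 ≤ c)
    {Φ : ι → Matrix A A ℂ →ₗ[ℂ] Matrix B B ℂ} (h : ∀ i, IsCP (Φ i)) :
    IsCP ((c : ℂ) • ∑ i ∈ s, Φ i) := by
  intro k X hX
  have : onRight (Fin k) ((c : ℂ) • ∑ i ∈ s, Φ i) X = c • ∑ i ∈ s, onRight (Fin k) (Φ i) X := by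
    ext x y
    simp [onRight, Matrix.sum_apply]
  rw [this]
  exact (Matrix.posSemidef_sum _ fun i _ => h i k X hX).smul hc

theorem avgIns_isCP (s : Finset J) (t : Finset L) {ρ₁ : Matrix A₁ A₁ ℂ} {ρ₂ : Matrix A₂ A₂ ℂ}
    (h₁ : ρ₁.PosSemidef) (h₂ : ρ₂.PosSemidef) : IsCP (avgIns s t ρ₁ ρ₂) := by
  have := isCP_smul_sum (s ×ˢ t) (c := (s.card * t.card : ℝ)⁻¹) (by positivity)
    fun p : J × L => (ins_isCP p.1 h₁).tensorMap (ins_isCP p.2 h₂)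
  rwa [Complex.ofReal_inv] at this

theorem avgIns_conj (s : Finset J) (t : Finset L) {ρ₁ : Matrix A₁ A₁ ℂ} {ρ₂ : Matrix A₂ A₂ ℂ}
    (h₁ : ρ₁.PosSemidef) (h₂ : ρ₂.PosSemidef) (X : Matrix (F × A₁ × A₂) (F × A₁ × A₂) ℂ) :
    ((1 : Matrix F F ℂ) ⊗ₖ powerPair J L (CFC.sqrt ρ₁) (CFC.sqrt ρ₂)) *
        onRight F (avgIns s t 1 1) X *
        ((1 : Matrix F F ℂ) ⊗ₖ powerPair J L (CFC.sqrt ρ₁) (CFC.sqrt ρ₂)) =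
      onRight F (avgIns s t ρ₁ ρ₂) (((1 : Matrix F F ℂ) ⊗ₖ (CFC.sqrt ρ₁ ⊗ₖ CFC.sqrt ρ₂)) * X *
        ((1 : Matrix F F ℂ) ⊗ₖ (CFC.sqrt ρ₁ ⊗ₖ CFC.sqrt ρ₂))) := by
  have h0 : ∀ h : Matrix (A₁ × A₂) (A₁ × A₂) ℂ,
      powerPair J L (CFC.sqrt ρ₁) (CFC.sqrt ρ₂) * avgIns s t 1 1 h *
        powerPair J L (CFC.sqrt ρ₁) (CFC.sqrt ρ₂) =
      avgIns s t ρ₁ ρ₂ ((CFC.sqrt ρ₁ ⊗ₖ CFC.sqrt ρ₂) * h * (CFC.sqrt ρ₁ ⊗ₖ CFC.sqrt ρ₂)) := by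
    intro h
    have : LinearMap.mulRight ℂ (powerPair J L (CFC.sqrt ρ₁) (CFC.sqrt ρ₂)) ∘ₗ
        LinearMap.mulLeft ℂ (powerPair J L (CFC.sqrt ρ₁) (CFC.sqrt ρ₂)) ∘ₗ avgIns s t 1 1 =
        avgIns s t ρ₁ ρ₂ ∘ₗ LinearMap.mulRight ℂ (CFC.sqrt ρ₁ ⊗ₖ CFC.sqrt ρ₂) ∘ₗ
          LinearMap.mulLeft ℂ (CFC.sqrt ρ₁ ⊗ₖ CFC.sqrt ρ₂) := by
      refine linearMap_ext_kronecker fun X Y => ?_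
      simp only [avgIns, powerPair, LinearMap.comp_apply, LinearMap.mulRight_apply,
        LinearMap.mulLeft_apply, LinearMap.smul_apply, LinearMap.sum_apply, tensorMap_kronecker,
        Matrix.mul_smul, Matrix.smul_mul, Finset.mul_sum, Finset.sum_mul,
        ← Matrix.mul_kronecker_mul, ins_conj, Matrix.mul_one, sqrt_mul_sqrt h₁, sqrt_mul_sqrt h₂]
    exact LinearMap.congr_fun this h
  have : LinearMap.mulRight ℂ
        ((1 : Matrix F F ℂ) ⊗ₖ powerPair J L (CFC.sqrt ρ₁) (CFC.sqrt ρ₂)) ∘ₗ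
      LinearMap.mulLeft ℂ
        ((1 : Matrix F F ℂ) ⊗ₖ powerPair J L (CFC.sqrt ρ₁) (CFC.sqrt ρ₂)) ∘ₗ
      onRight F (avgIns s t 1 1) =
      onRight F (avgIns s t ρ₁ ρ₂) ∘ₗ
        LinearMap.mulRight ℂ ((1 : Matrix F F ℂ) ⊗ₖ (CFC.sqrt ρ₁ ⊗ₖ CFC.sqrt ρ₂)) ∘ₗ
        LinearMap.mulLeft ℂ ((1 : Matrix F F ℂ) ⊗ₖ (CFC.sqrt ρ₁ ⊗ₖ CFC.sqrt ρ₂)) := by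
    refine linearMap_ext_kronecker fun X Y => ?_
    simp only [LinearMap.comp_apply, LinearMap.mulRight_apply, LinearMap.mulLeft_apply,
      onRight_kronecker, ← Matrix.mul_kronecker_mul, Matrix.one_mul, Matrix.mul_one, h0]
  exact LinearMap.congr_fun this X

theorem trace_onRight_avgIns {s : Finset J} {t : Finset L} (hs : s.Nonempty) (ht : t.Nonempty)
    {ρ₁ : Matrix A₁ A₁ ℂ} {ρ₂ : Matrix A₂ A₂ ℂ} (h₁ : ρ₁.trace = 1) (h₂ : ρ₂.trace = 1)
    (X : Matrix (F × A₁ × A₂) (F × A₁ × A₂) ℂ) :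
    (onRight F (avgIns s t ρ₁ ρ₂) X).trace = X.trace := by
  have hs0 : (s.card : ℂ) ≠ 0 := by exact_mod_cast hs.card_pos.ne'
  have ht0 : (t.card : ℂ) ≠ 0 := by exact_mod_cast ht.card_pos.ne'
  have : Matrix.traceLinearMap _ ℂ ℂ ∘ₗ avgIns s t ρ₁ ρ₂ = Matrix.traceLinearMap _ ℂ ℂ := by
    refine linearMap_ext_kronecker fun X Y => ?_
    simp only [avgIns, LinearMap.comp_apply, LinearMap.smul_apply, LinearMap.sum_apply,
      tensorMap_kronecker, Matrix.traceLinearMap_apply, Matrix.trace_smul, Matrix.trace_sum,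
      Matrix.trace_kronecker, trace_ins _ h₁, trace_ins _ h₂, Finset.sum_const, Finset.card_product,
      nsmul_eq_mul, smul_eq_mul]
    push_cast
    field_simp
  rw [← trace_ptraceLeft, ptraceLeft_onRight, ← trace_ptraceLeft X]
  exact LinearMap.congr_fun this _

theorem powerPair_mul (a c : Matrix A₁ A₁ ℂ) (b d : Matrix A₂ A₂ ℂ) :
    powerPair J L a b * powerPair J L c d = powerPair J L (a * c) (b * d) := by
  simp only [powerPair, ← Matrix.mul_kronecker_mul, tensorPower_mul]

theorem isHermitian_powerPair {a : Matrix A₁ A₁ ℂ} {b : Matrix A₂ A₂ ℂ} (ha : a.IsHermitian)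
    (hb : b.IsHermitian) : (powerPair J L a b).IsHermitian := by
  rw [Matrix.IsHermitian, powerPair, Matrix.conjTranspose_kronecker, conjTranspose_tensorPower,
    conjTranspose_tensorPower, ha.eq, hb.eq]

theorem trace_powerPair {a : Matrix A₁ A₁ ℂ} {b : Matrix A₂ A₂ ℂ} (ha : a.trace = 1)
    (hb : b.trace = 1) : (powerPair J L a b).trace = 1 := by
  rw [powerPair, Matrix.trace_kronecker, trace_tensorPower, trace_tensorPower, ha, hb]
  simp

/-- Existence of the encoder. From the purifications of `ρ₁^{⊗ J} ⊗ ρ₂^{⊗ L}` the sender can steer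
to a state dominated by `15/8` times the state that carries `ψ` at a random pair of copies
`(j, k) ∈ s × t`, up to a remainder of small trace. The state `ω` is the smoothing of the marginal
of `ψ` on `A₁ A₂`. -/
theorem exists_encoder {ψ : Matrix (F × A₁ × A₂) (F × A₁ × A₂) ℂ} (hψ : IsState ψ)
    {ρ₁ : Matrix A₁ A₁ ℂ} {ρ₂ : Matrix A₂ A₂ ℂ} (h₁ : ρ₁ = ptraceRight (ptraceLeft ψ))
    (h₂ : ρ₂ = ptraceLeft (ptraceLeft ψ)) {ω : Matrix (A₁ × A₂) (A₁ × A₂) ℂ} (hω : IsState ω)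
    {c δ : ℝ} (hc : 0 ≤ c) (hδ : 0 ≤ δ) (hωc : ω ≤ c • (ρ₁ ⊗ₖ ρ₂))
    (hr : ptraceRight ω ≤ (1 + δ) • ρ₁) (hl : ptraceLeft ω ≤ (1 + δ) • ρ₂)
    {s : Finset J} {t : Finset L} (hs : s.Nonempty) (ht : t.Nonempty) (f₀ : F) :
    ∃ Γ Δ : Matrix (F × ((J → A₁) × (L → A₂))) (F × ((J → A₁) × (L → A₂))) ℂ,
      Γ.PosSemidef ∧ ptraceLeft Γ = 1 ∧ Δ.PosSemidef ∧
      ((1 : Matrix F F ℂ) ⊗ₖ powerPair J L (CFC.sqrt ρ₁) (CFC.sqrt ρ₂)) * Γ *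
          ((1 : Matrix F F ℂ) ⊗ₖ powerPair J L (CFC.sqrt ρ₁) (CFC.sqrt ρ₂)) ≤
        (15 / 8 : ℝ) • onRight F (avgIns s t ρ₁ ρ₂) ψ + Δ ∧
      Δ.trace.re ≤ 15 / 2 * (1 - fidelity (ptraceLeft ψ) ω) +
        9 / 4 * (c / (s.card * t.card) + δ / s.card + δ / t.card) := by
  have hψ₂p : (ptraceLeft ψ).PosSemidef := ptraceLeft_posSemidef hψ.posSemidef
  have h₁p : ρ₁.PosSemidef := h₁ ▸ ptraceRight_posSemidef hψ₂p
  have h₂p : ρ₂.PosSemidef := h₂ ▸ ptraceLeft_posSemidef hψ₂p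
  have h₁1 : ρ₁.trace = 1 := by rw [h₁, trace_ptraceRight, trace_ptraceLeft, hψ.trace_eq_one]
  have h₂1 : ρ₂.trace = 1 := by rw [h₂, trace_ptraceLeft, trace_ptraceLeft, hψ.trace_eq_one]
  obtain ⟨ψ', Δ₂, hψ'p, hΔ₂p, hψ'tr, hψ'le, hΔ₂tr⟩ := exists_extension hψ hω f₀
  set S := sqrtPinv ρ₁ ⊗ₖ sqrtPinv ρ₂ with hS
  have hSH : S.IsHermitian := isHermitian_kronecker_sqrtPinv ρ₁ ρ₂
  set φ := ((1 : Matrix F F ℂ) ⊗ₖ S) * ψ' * ((1 : Matrix F F ℂ) ⊗ₖ S) with hφ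
  have hφp : φ.PosSemidef := posSemidef_hermitian_conj hψ'p (isHermitian_one_kronecker hSH)
  have hφtr : ptraceLeft φ = S * ω * S := by rw [hφ, ptraceLeft_conj, hψ'tr]
  obtain ⟨m1, m2, m3, m4⟩ := moments_sqrtPinv_conj h₁p h₂p hω hc hδ hωc hr hl rfl
  set Θ := powerPair J L (CFC.sqrt ρ₁) (CFC.sqrt ρ₂) with hΘ
  have hΘΘ : Θ * Θ = powerPair J L ρ₁ ρ₂ := by
    rw [hΘ, powerPair_mul, sqrt_mul_sqrt h₁p, sqrt_mul_sqrt h₂p]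
  have hYp : (onRight F (avgIns s t 1 1) φ).PosSemidef :=
    (avgIns_isCP s t Matrix.PosSemidef.one Matrix.PosSemidef.one).onRight hφp
  obtain ⟨Γ, Δ₁, hΓ, hΓ1, hΔ₁p, hle, hΔ₁tr⟩ := exists_choi_of_second_moment hYp
    (isHermitian_powerPair (isHermitian_sqrt ρ₁) (isHermitian_sqrt ρ₂))
    (by rw [← hΘ, hΘΘ, trace_powerPair h₁1 h₂1])
    ((ptraceLeft_onRight _ _).trans (congrArg _ hφtr))
    (by rw [← hΘ, hΘΘ, trace_mul_avgIns h₁1 h₂1 hs ht, m1]) f₀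
  have hsq := trace_avgIns_sq_le h₁1 h₂1 m1 m2 hδ m3 m4 hs ht
  rw [← hΘ] at hle hΔ₁tr
  rw [hΘΘ] at hΔ₁tr
  set E := supp ρ₁ ⊗ₖ supp ρ₂ with hE
  have hEH : E.IsHermitian := by
    rw [Matrix.IsHermitian, hE, Matrix.conjTranspose_kronecker, (isHermitian_supp h₁p).eq,
      (isHermitian_supp h₂p).eq]
  have hE1 : E ≤ 1 := kronecker_le_one (supp_posSemidef h₁p) (supp_le_one h₁p) (supp_le_one h₂p)
  have hEE : E * E = E := by
    rw [hE, ← Matrix.mul_kronecker_mul, supp_mul_supp h₁p, supp_mul_supp h₂p]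
  have hφE : ((1 : Matrix F F ℂ) ⊗ₖ (CFC.sqrt ρ₁ ⊗ₖ CFC.sqrt ρ₂)) * φ *
      ((1 : Matrix F F ℂ) ⊗ₖ (CFC.sqrt ρ₁ ⊗ₖ CFC.sqrt ρ₂)) =
      ((1 : Matrix F F ℂ) ⊗ₖ E) * ψ' * ((1 : Matrix F F ℂ) ⊗ₖ E) := by
    calc _ = (((1 : Matrix F F ℂ) ⊗ₖ (CFC.sqrt ρ₁ ⊗ₖ CFC.sqrt ρ₂)) * ((1 : Matrix F F ℂ) ⊗ₖ S)) *
          ψ' * (((1 : Matrix F F ℂ) ⊗ₖ S) *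
            ((1 : Matrix F F ℂ) ⊗ₖ (CFC.sqrt ρ₁ ⊗ₖ CFC.sqrt ρ₂))) := by
          rw [hφ]; simp only [Matrix.mul_assoc]
      _ = _ := by
          rw [one_kronecker_mul, one_kronecker_mul, hS, ← Matrix.mul_kronecker_mul,
            ← Matrix.mul_kronecker_mul, sqrt_mul_sqrtPinv h₁p, sqrt_mul_sqrtPinv h₂p]
          rfl
  -- `ψ` itself is supported on the supports of its marginals
  have hψE : ((1 : Matrix F F ℂ) ⊗ₖ E) * ψ * ((1 : Matrix F F ℂ) ⊗ₖ E) = ψ := by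
    refine one_kronecker_conj_eq_self hEH hψ.posSemidef ?_
    have e1 := one_kronecker_conj_eq_self (F := A₁) (isHermitian_supp h₂p) hψ₂p
      (by rw [← h₂, mul_supp h₂p])
    have f1 : ptraceLeft ψ * ((1 : Matrix A₁ A₁ ℂ) ⊗ₖ supp ρ₂) = ptraceLeft ψ := by
      conv_lhs => rw [← e1]
      rw [Matrix.mul_assoc, one_kronecker_mul, supp_mul_supp h₂p, e1]
    have f2 : ptraceLeft ψ * (supp ρ₁ ⊗ₖ (1 : Matrix A₂ A₂ ℂ)) = ptraceLeft ψ := by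
      have h0 : ptraceLeft ψ * ((1 - supp ρ₁) ⊗ₖ (1 : Matrix A₂ A₂ ℂ)) = 0 := by
        refine mul_eq_zero_of_trace_conj hψ₂p ?_
        rw [Matrix.conjTranspose_kronecker, Matrix.conjTranspose_one, ← trace_ptraceRight,
          ptraceRight_conj, ← h₁, Matrix.mul_assoc, Matrix.mul_sub, Matrix.mul_one, mul_supp h₁p,
          sub_self, Matrix.mul_zero]
        simp
      have e : ((1 - supp ρ₁) ⊗ₖ (1 : Matrix A₂ A₂ ℂ)) = 1 - supp ρ₁ ⊗ₖ (1 : Matrix A₂ A₂ ℂ) := by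
        rw [eq_sub_iff_add_eq, ← Matrix.add_kronecker, sub_add_cancel, Matrix.one_kronecker_one]
      rw [e, Matrix.mul_sub, Matrix.mul_one, sub_eq_zero] at h0
      exact h0.symm
    have : E = (supp ρ₁ ⊗ₖ (1 : Matrix A₂ A₂ ℂ)) * ((1 : Matrix A₁ A₁ ℂ) ⊗ₖ supp ρ₂) := by
      rw [← Matrix.mul_kronecker_mul, Matrix.one_mul, Matrix.mul_one]
    rw [this, ← Matrix.mul_assoc, f2, f1]
  set Δ₃ := ((1 : Matrix F F ℂ) ⊗ₖ E) * Δ₂ * ((1 : Matrix F F ℂ) ⊗ₖ E) with hΔ₃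
  have hΔ₃p : Δ₃.PosSemidef := posSemidef_hermitian_conj hΔ₂p (isHermitian_one_kronecker hEH)
  have hΔ₃tr : Δ₃.trace.re ≤ 6 * (1 - fidelity (ptraceLeft ψ) ω) := by
    refine le_trans ?_ hΔ₂tr
    rw [hΔ₃, trace_one_kronecker_conj, Matrix.trace_mul_comm, ← Matrix.mul_assoc, hEE,
      ← trace_ptraceLeft Δ₂]
    refine (re_trace_mul_mono_left (ptraceLeft_posSemidef hΔ₂p) hE1).trans ?_
    rw [Matrix.one_mul]
  have hmid : ((1 : Matrix F F ℂ) ⊗ₖ E) * ψ' * ((1 : Matrix F F ℂ) ⊗ₖ E) ≤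
      (3 / 2 : ℝ) • ψ + Δ₃ := by
    have := hermitian_conj_le hψ'le (isHermitian_one_kronecker (F := F) hEH)
    rwa [Matrix.mul_add, Matrix.add_mul, Matrix.mul_smul, Matrix.smul_mul, hψE] at this
  have hcp := avgIns_isCP s t h₁p h₂p
  have hmap : onRight F (avgIns s t ρ₁ ρ₂)
      (((1 : Matrix F F ℂ) ⊗ₖ E) * ψ' * ((1 : Matrix F F ℂ) ⊗ₖ E)) ≤
      (3 / 2 : ℝ) • onRight F (avgIns s t ρ₁ ρ₂) ψ + onRight F (avgIns s t ρ₁ ρ₂) Δ₃ := by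
    refine le_of_sub_eq (hcp.onRight (Matrix.le_iff.mp hmid)) ?_
    rw [map_sub, map_add]
    congr 2
    exact ((onRight F (avgIns s t ρ₁ ρ₂)).map_smul_of_tower (3 / 2 : ℝ) ψ).symm
  refine ⟨Γ, (5 / 4 : ℝ) • onRight F (avgIns s t ρ₁ ρ₂) Δ₃ + Δ₁, hΓ, hΓ1,
    ((hcp.onRight hΔ₃p).smul (by norm_num)).add hΔ₁p, hle.trans ?_, ?_⟩
  · rw [avgIns_conj s t h₁p h₂p, hφE]
    have := smul_le_smul_of_nonneg_left hmap (show (0 : ℝ) ≤ 5 / 4 by norm_num)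
    refine (add_le_add_left this Δ₁).trans_eq ?_
    module
  · rw [Matrix.trace_add, Complex.add_re, re_trace_real_smul, trace_onRight_avgIns hs ht h₁1 h₂1]
    linarith

end Encoder

/-! ### Position-based decoding -/

section Decoder

variable {B A J : Type*} [Fintype B] [DecidableEq B] [Fintype A] [DecidableEq A] [Fintype J]
  [DecidableEq J]

theorem trace_onRight_ins_same (j : J) {ρ : Matrix A A ℂ} (hρ : ρ.trace = 1)
    (T ω : Matrix (B × A) (B × A) ℂ) :
    (onRight B (ins j 1) T * onRight B (ins j ρ) ω).trace = (T * ω).trace := by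
  have : ((LinearMap.mul ℂ _).compl₁₂ (onRight B (ins j 1)) (onRight B (ins j ρ))).compr₂
      (Matrix.traceLinearMap _ ℂ ℂ) = (LinearMap.mul ℂ _).compr₂ (Matrix.traceLinearMap _ ℂ ℂ) := by
    refine bilinearMap_ext_kronecker fun X X' Y Y' => ?_
    simp [onRight_kronecker, ← Matrix.mul_kronecker_mul, Matrix.trace_kronecker,
      trace_ins_mul_ins_same j hρ]
  exact LinearMap.congr_fun₂ this T ω

theorem trace_onRight_ins_of_ne {j j' : J} (hj : j' ≠ j) {ρ : Matrix A A ℂ} (hρ : ρ.trace = 1)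
    (T ω : Matrix (B × A) (B × A) ℂ) :
    (onRight B (ins j' 1) T * onRight B (ins j ρ) ω).trace =
      (T * (ptraceRight ω ⊗ₖ ρ)).trace := by
  let K : Matrix B B ℂ →ₗ[ℂ] Matrix (B × A) (B × A) ℂ :=
    { toFun := fun X => X ⊗ₖ ρ
      map_add' := fun X Y => Matrix.add_kronecker X Y ρ
      map_smul' := fun c X => Matrix.smul_kronecker c X ρ }
  have : ((LinearMap.mul ℂ _).compl₁₂ (onRight B (ins j' 1)) (onRight B (ins j ρ))).compr₂
      (Matrix.traceLinearMap _ ℂ ℂ) =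
      ((LinearMap.mul ℂ _).compl₁₂ LinearMap.id (K ∘ₗ ptraceRight)).compr₂
          (Matrix.traceLinearMap _ ℂ ℂ) := by
    refine bilinearMap_ext_kronecker fun X X' Y Y' => ?_
    simp [onRight_kronecker, ← Matrix.mul_kronecker_mul, Matrix.trace_kronecker,
      trace_ins_mul_ins_of_ne hj hρ, ptraceRight_kronecker, K]
    ring
  exact LinearMap.congr_fun₂ this T ω

theorem onRight_ins_le_one (j : J) {T : Matrix (B × A) (B × A) ℂ} (hT : T ≤ 1) :
    onRight B (ins j 1) T ≤ 1 := by
  have h := (ins_isCP j (Matrix.PosSemidef.one (n := A) (R := ℂ))).onRight (Matrix.le_iff.mp hT)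
  refine le_of_sub_eq h ?_
  have e : onRight B (ins j (1 : Matrix A A ℂ)) 1 = 1 :=
    calc onRight B (ins j (1 : Matrix A A ℂ)) 1 = onRight B (ins j 1) (1 ⊗ₖ 1) := by
          rw [Matrix.one_kronecker_one]
      _ = 1 := by rw [onRight_kronecker, ins_one_one, Matrix.one_kronecker_one]
  rw [map_sub]
  exact congrArg (· - _) e.symm

/-- Position-based decoding: from a test `T` that distinguishes `ω` from `ω_B ⊗ ρ` one builds a
measurement that locates the block `m` of the copy carrying `ω`. The regularisation `κ` makes the
normalisation of the pretty good measurement invertible, and the outcome `m₀` collects the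
resulting inconclusive effect. -/
theorem exists_positionDecoder {M K : ℕ} (m₀ : Fin M) {T ω : Matrix (B × A) (B × A) ℂ}
    {ρ : Matrix A A ℂ} (hT : T.PosSemidef) (hT1 : T ≤ 1) (hω : IsState ω) (hρ : IsState ρ) {κ : ℝ}
    (hκ : 0 < κ) :
    ∃ Λ : Fin M → Matrix (B × (Fin M × Fin K → A)) (B × (Fin M × Fin K → A)) ℂ,
      (∀ m, (Λ m).PosSemidef) ∧ ∑ m, Λ m = 1 ∧
      ∀ m k, ((1 - Λ m) * onRight B (ins (m, k) ρ) ω).trace.re ≤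
        2 * (1 - (T * ω).trace.re) +
          4 * (M * K * (T * (ptraceRight ω ⊗ₖ ρ)).trace.re + κ) := by
  set S : Fin M × Fin K → Matrix (B × (Fin M × Fin K → A)) (B × (Fin M × Fin K → A)) ℂ :=
    fun j => onRight B (ins j 1) T with hS
  have hSp : ∀ j, (S j).PosSemidef := fun j => (ins_isCP j Matrix.PosSemidef.one).onRight hT
  have hS1 : ∀ j, S j ≤ 1 := fun j => onRight_ins_le_one j hT1
  have hκp : (κ • (1 : Matrix (B × (Fin M × Fin K → A)) (B × (Fin M × Fin K → A)) ℂ)).PosDef :=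
    Matrix.PosDef.one.smul hκ
  obtain ⟨W, hW⟩ : ∃ W, W = ∑ j, S j + κ • 1 := ⟨_, rfl⟩
  have hWd : W.PosDef := by
    rw [hW, add_comm]
    exact hκp.add_posSemidef (Matrix.posSemidef_sum _ fun j _ => hSp j)
  set p := CFC.sqrt W with hp
  have hpp : p * p = W := sqrt_mul_sqrt hWd.posSemidef
  have hdet : IsUnit p.det := by
    have h := (Matrix.isUnit_iff_isUnit_det _).mp hWd.isUnit
    rw [← hpp, Matrix.det_mul] at h
    exact isUnit_of_mul_isUnit_left h
  have hqH : (p⁻¹).IsHermitian := (isHermitian_sqrt W).inv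
  have hqWq : p⁻¹ * W * p⁻¹ = 1 := by
    rw [← hpp, ← Matrix.mul_assoc, Matrix.nonsing_inv_mul _ hdet, Matrix.one_mul,
      Matrix.mul_nonsing_inv _ hdet]
  set E : Fin M × Fin K → Matrix (B × (Fin M × Fin K → A)) (B × (Fin M × Fin K → A)) ℂ :=
    fun j => p⁻¹ * S j * p⁻¹ with hE
  have hEp : ∀ j, (E j).PosSemidef := fun j => posSemidef_hermitian_conj (hSp j) hqH
  have hrest : (1 - ∑ j, E j).PosSemidef := by
    have : 1 - ∑ j, E j = p⁻¹ * (κ • 1) * p⁻¹ := by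
      refine sub_eq_of_eq_add' ?_
      rw [hE, ← Finset.sum_mul, ← Finset.mul_sum, ← Matrix.add_mul, ← Matrix.mul_add, ← hW, hqWq]
    rw [this]
    exact posSemidef_hermitian_conj hκp.posSemidef hqH
  refine ⟨fun m => ∑ k, E (m, k) + if m = m₀ then 1 - ∑ j, E j else 0, fun m => ?_, ?_,
    fun m k => ?_⟩
  · refine (Matrix.posSemidef_sum _ fun k _ => hEp _).add ?_
    split_ifs
    · exact hrest
    · exact Matrix.PosSemidef.zero
  · rw [Finset.sum_add_distrib, ← Fintype.sum_prod_type', Finset.sum_ite_eq' Finset.univ m₀,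
      if_pos (Finset.mem_univ _)]
    exact add_sub_cancel _ _
  · have hωj : (onRight B (ins (m, k) ρ) ω).PosSemidef :=
      (ins_isCP _ hρ.posSemidef).onRight hω.posSemidef
    set Tj := ∑ i ∈ Finset.univ.erase (m, k), S i + κ • 1 with hTj
    have hTjp : Tj.PosSemidef :=
      (Matrix.posSemidef_sum _ fun j _ => hSp j).add hκp.posSemidef
    have hsum : S (m, k) + Tj = W := by
      rw [hTj, ← add_assoc, Finset.add_sum_erase _ _ (Finset.mem_univ _), hW]
    have hn := hayashi_nagaoka (hSp (m, k)) (hS1 (m, k)) hTjp (by rw [hsum]; exact hWd.isUnit)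
    rw [hsum] at hn
    have h1 : 1 - (∑ k, E (m, k) + if m = m₀ then 1 - ∑ j, E j else 0) ≤ 1 - E (m, k) := by
      refine sub_le_sub_left ?_ 1
      rw [← Finset.add_sum_erase _ _ (Finset.mem_univ k), add_assoc]
      refine le_add_of_nonneg_right (add_nonneg ?_ ?_)
      · exact (Matrix.posSemidef_sum _ fun k _ => hEp _).nonneg
      · split_ifs
        · exact hrest.nonneg
        · exact le_rfl
    have h2 := re_trace_mul_mono_left hωj (h1.trans hn)
    have htr1 : (onRight B (ins (m, k) ρ) ω).trace = 1 := by
      rw [← trace_ptraceLeft, ptraceLeft_onRight, trace_ins _ hρ.trace_eq_one, trace_ptraceLeft,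
        hω.trace_eq_one]
    have htrS : (S (m, k) * onRight B (ins (m, k) ρ) ω).trace = (T * ω).trace :=
      trace_onRight_ins_same _ hρ.trace_eq_one T ω
    set β := (T * (ptraceRight ω ⊗ₖ ρ)).trace.re with hβ
    have hβ0 : 0 ≤ β :=
      re_trace_mul_nonneg hT ((ptraceRight_posSemidef hω.posSemidef).kronecker hρ.posSemidef)
    have htrT : (Tj * onRight B (ins (m, k) ρ) ω).trace.re ≤ M * K * β + κ := by
      rw [hTj, Matrix.add_mul, Finset.sum_mul, Matrix.smul_mul, Matrix.one_mul, Matrix.trace_add,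
        Matrix.trace_sum, Complex.add_re, re_trace_real_smul, htr1, Complex.re_sum,
        Complex.one_re, mul_one]
      gcongr
      have : ∀ i ∈ Finset.univ.erase (m, k),
          (S i * onRight B (ins (m, k) ρ) ω).trace.re = β := fun i hi => by
        rw [hS, hβ, ← trace_onRight_ins_of_ne (Finset.ne_of_mem_erase hi) hρ.trace_eq_one]
      rw [Finset.sum_congr rfl this, Finset.sum_const, nsmul_eq_mul]
      gcongr
      have : ((Finset.univ.erase (m, k)).card : ℝ) ≤
          (Finset.univ : Finset (Fin M × Fin K)).card := by
        exact_mod_cast Finset.card_le_card (Finset.erase_subset _ _)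
      simpa using this
    refine h2.trans ?_
    rw [Matrix.add_mul, Matrix.smul_mul, Matrix.smul_mul, Matrix.trace_add, Complex.add_re,
      re_trace_real_smul, re_trace_real_smul, Matrix.sub_mul, Matrix.one_mul, Matrix.trace_sub,
      htr1, htrS, Complex.sub_re, Complex.one_re]
    linarith

end Decoder

/-! ### Codes from Choi operators and measurements -/

section Channels

variable {ι F R W : Type*} [Fintype ι] [DecidableEq ι] [Fintype F] [Fintype R] [DecidableEq R]

/-- The block diagonal operator with blocks `X i`. -/
def blockDiag (X : ι → Matrix R R ℂ) : Matrix (ι × R) (ι × R) ℂ :=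
  Matrix.of fun x y => if x.1 = y.1 then X x.1 x.2 y.2 else 0

theorem blockDiag_posSemidef {X : ι → Matrix R R ℂ} (h : ∀ i, (X i).PosSemidef) :
    (blockDiag X).PosSemidef := by
  have : blockDiag X = ∑ i, Matrix.single i i (1 : ℂ) ⊗ₖ X i := by
    ext ⟨i, r⟩ ⟨i', r'⟩
    simp only [blockDiag, Matrix.of_apply, Matrix.sum_apply, Matrix.kroneckerMap_apply,
      Matrix.single_apply, ite_mul, one_mul, zero_mul, ite_and, Finset.sum_ite_eq',
      Finset.mem_univ, if_true]
  rw [this]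
  exact Matrix.posSemidef_sum _ fun i _ => (single_posSemidef i).kronecker (h i)

/-- The Choi operator of the controlled channel that applies the channel with Choi operator `Γ i`
when the classical control register is in state `i`. -/
def controlledChoi (Γ : ι → Matrix (F × R) (F × R) ℂ) :
    Matrix (F × (ι × R)) (F × (ι × R)) ℂ :=
  (blockDiag Γ).submatrix (fun x => (x.2.1, (x.1, x.2.2))) (fun x => (x.2.1, (x.1, x.2.2)))

theorem controlledChoi_isCPTP {Γ : ι → Matrix (F × R) (F × R) ℂ} (h : ∀ i, (Γ i).PosSemidef)
    (h1 : ∀ i, ptraceLeft (Γ i) = 1) : IsCPTP (choiMap (controlledChoi Γ)) := by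
  classical
  refine choiMap_isCPTP ((blockDiag_posSemidef h).submatrix _) ?_
  ext ⟨i, r⟩ ⟨i', r'⟩
  have h2 : ∀ r r', ∑ f, Γ i (f, r) (f, r') = (1 : Matrix R R ℂ) r r' := fun r r' => by
    rw [← h1 i]; rfl
  by_cases hi : i = i'
  · subst hi
    simp [ptraceLeft, controlledChoi, blockDiag, h2, Matrix.one_apply]
  · simp [ptraceLeft, controlledChoi, blockDiag, hi]

/-- The measurement with effects `Λ i`, the outcome being written in the computational basis. -/
def measMap (Λ : ι → Matrix R R ℂ) : Matrix R R ℂ →ₗ[ℂ] Matrix ι ι ℂ :=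
  choiMap (blockDiag fun i => (Λ i)ᵀ)

theorem measMap_isCPTP {Λ : ι → Matrix R R ℂ} (h : ∀ i, (Λ i).PosSemidef) (h1 : ∑ i, Λ i = 1) :
    IsCPTP (measMap Λ) := by
  refine choiMap_isCPTP (blockDiag_posSemidef fun i => (h i).transpose) ?_
  ext r r'
  have h2 : ∑ i, Λ i r' r = (1 : Matrix R R ℂ) r' r := by rw [← h1, Matrix.sum_apply]
  simp [ptraceLeft, blockDiag, h2, Matrix.one_apply, eq_comm]

theorem measMap_apply_self (Λ : ι → Matrix R R ℂ) (X : Matrix R R ℂ) (i : ι) :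
    measMap Λ X i i = (Λ i * X).trace := by
  simp only [measMap, choiMap, blockDiag, LinearMap.coe_mk, AddHom.coe_mk, Matrix.of_apply,
    if_true, Matrix.transpose_apply, Matrix.trace, Matrix.diag, Matrix.mul_apply]
  exact Finset.sum_comm

theorem tensorMap_measMap_apply_self {ι' R' : Type*} [Fintype ι'] [DecidableEq ι'] [Fintype R']
    [DecidableEq R'] (Λ : ι → Matrix R R ℂ) (Λ' : ι' → Matrix R' R' ℂ)
    (X : Matrix (R × R') (R × R') ℂ) (i : ι) (i' : ι') :
    tensorMap (measMap Λ) (measMap Λ') X (i, i') (i, i') = ((Λ i ⊗ₖ Λ' i') * X).trace := by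
  have : Matrix.entryLinearMap ℂ ℂ (i, i') (i, i') ∘ₗ tensorMap (measMap Λ) (measMap Λ') =
      Matrix.traceLinearMap _ ℂ ℂ ∘ₗ LinearMap.mulLeft ℂ (Λ i ⊗ₖ Λ' i') := by
    refine linearMap_ext_kronecker fun X Y => ?_
    simp [tensorMap_kronecker, measMap_apply_self, ← Matrix.mul_kronecker_mul,
      Matrix.trace_kronecker]
  exact LinearMap.congr_fun this X

/-- Applying a channel with Choi operator `Γ` to one half of a pure state whose amplitudes are the
entries of `Θ`. -/
theorem onLeft_choiMap [DecidableEq F] (Γ : Matrix (F × R) (F × R) ℂ) (Θ : Matrix R R ℂ) :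
    onLeft R (choiMap Γ) (Matrix.of fun x y => Θ x.2 x.1 * star (Θ y.2 y.1)) =
      ((1 : Matrix F F ℂ) ⊗ₖ Θ) * Γ * ((1 : Matrix F F ℂ) ⊗ₖ Θ)ᴴ := by
  ext ⟨f, r⟩ ⟨f', r'⟩
  simp only [onLeft, choiMap, LinearMap.coe_mk, AddHom.coe_mk, Matrix.of_apply, Matrix.mul_apply,
    Fintype.sum_prod_type, Matrix.conjTranspose_apply, Matrix.kroneckerMap_apply, Matrix.one_apply,
    ite_mul, one_mul, zero_mul, Finset.sum_ite_irrel, Finset.sum_const_zero, Finset.sum_ite_eq,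
    Finset.mem_univ, if_true, apply_ite star, star_zero, mul_ite, mul_zero]
  rw [Finset.sum_comm]
  refine Finset.sum_congr rfl fun s' _ => ?_
  rw [Finset.sum_mul]
  refine Finset.sum_congr rfl fun s _ => ?_
  ring

end Channels

section BroadcastMap

variable {F B C : Type*}

/-- The broadcast channel followed by the grouping of the registers of each receiver. -/
def broadcastMap (N : Matrix F F ℂ →ₗ[ℂ] Matrix (B × C) (B × C) ℂ) (E E' : Type*) :
    Matrix (F × (E × E')) (F × (E × E')) ℂ →ₗ[ℂ]
      Matrix ((B × E) × (C × E')) ((B × E) × (C × E')) ℂ where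
  toFun X := (onLeft (E × E') N X).submatrix (Equiv.prodProdProdComm B E C E')
    (Equiv.prodProdProdComm B E C E')
  map_add' X Y := by rw [map_add]; rfl
  map_smul' c X := by rw [map_smul]; rfl

end BroadcastMap

section Code

variable {F B C A₁ A₂ : Type u} [Fintype F] [Fintype B] [DecidableEq B] [Fintype C] [DecidableEq C]
  [Fintype A₁] [DecidableEq A₁] [Fintype A₂] [DecidableEq A₂] {J L : Type} [Fintype J]
  [DecidableEq J] [Fintype L] [DecidableEq L] {M₁ M₂ : ℕ}

/-- The data of a code in which the shared states purify tensor powers of `ρ₁` and `ρ₂`, with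
`R = (J → A₁) × (L → A₂)`. -/
structure CodeData (F B C : Type u) [Fintype F] [Fintype B] [DecidableEq B] [Fintype C]
    [DecidableEq C] (J L : Type) [Fintype J] [DecidableEq J] [Fintype L] [DecidableEq L]
    {A₁ A₂ : Type u} [Fintype A₁] [DecidableEq A₁] [Fintype A₂] [DecidableEq A₂]
    (ρ₁ : Matrix A₁ A₁ ℂ) (ρ₂ : Matrix A₂ A₂ ℂ) (M₁ M₂ : ℕ) where
  /-- The Choi operators of the encoder. -/
  Γ : Fin M₁ × Fin M₂ → Matrix (F × ((J → A₁) × (L → A₂))) (F × ((J → A₁) × (L → A₂))) ℂ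
  /-- The measurement of the first receiver. -/
  Λ₁ : Fin M₁ → Matrix (B × (J → A₁)) (B × (J → A₁)) ℂ
  /-- The measurement of the second receiver. -/
  Λ₂ : Fin M₂ → Matrix (C × (L → A₂)) (C × (L → A₂)) ℂ
  isState₁ : IsState ρ₁
  isState₂ : IsState ρ₂
  Γ_posSemidef : ∀ m, (Γ m).PosSemidef
  ptraceLeft_Γ : ∀ m, ptraceLeft (Γ m) = 1
  Λ₁_posSemidef : ∀ m, (Λ₁ m).PosSemidef
  Λ₂_posSemidef : ∀ m, (Λ₂ m).PosSemidef
  sum_Λ₁ : ∑ m, Λ₁ m = 1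
  sum_Λ₂ : ∑ m, Λ₂ m = 1

theorem sum_norm_sq_tensorPower_sqrt {A J : Type*} [Fintype A] [DecidableEq A] [Fintype J]
    [DecidableEq J] {ρ : Matrix A A ℂ} (hρ : IsState ρ) :
    ∑ x : (J → A) × (J → A), ‖tensorPower (fun _ : J => CFC.sqrt ρ) x.2 x.1‖ ^ 2 = 1 := by
  have h : (tensorPower (fun _ : J => CFC.sqrt ρ) *
      (tensorPower (fun _ : J => CFC.sqrt ρ))ᴴ).trace = 1 := by
    rw [conjTranspose_tensorPower, (isHermitian_sqrt ρ).eq, tensorPower_mul, trace_tensorPower]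
    simp [sqrt_mul_sqrt hρ.posSemidef, hρ.trace_eq_one]
  have h2 := congrArg Complex.re h
  simp only [Matrix.trace, Matrix.diag, Matrix.mul_apply, Matrix.conjTranspose_apply,
    Complex.re_sum, RCLike.star_def, Complex.mul_conj, Complex.ofReal_re, Complex.one_re,
    Complex.normSq_eq_norm_sq] at h2
  rw [Fintype.sum_prod_type, Finset.sum_comm]
  exact h2

variable {ρ₁ : Matrix A₁ A₁ ℂ} {ρ₂ : Matrix A₂ A₂ ℂ}

/-- The entanglement-assisted code determined by `d`. -/
def CodeData.code (d : CodeData F B C J L ρ₁ ρ₂ M₁ M₂) : BroadcastCode F B C M₁ M₂ where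
  EA₁ := J → A₁
  EB := J → A₁
  EA₂ := L → A₂
  EC := L → A₂
  θ₁ x := tensorPower (fun _ => CFC.sqrt ρ₁) x.2 x.1
  θ₂ x := tensorPower (fun _ => CFC.sqrt ρ₂) x.2 x.1
  norm_θ₁ := sum_norm_sq_tensorPower_sqrt d.isState₁
  norm_θ₂ := sum_norm_sq_tensorPower_sqrt d.isState₂
  enc := choiMap (controlledChoi d.Γ)
  decB := measMap d.Λ₁
  decC := measMap d.Λ₂
  enc_isCPTP := controlledChoi_isCPTP d.Γ_posSemidef d.ptraceLeft_Γ
  decB_isCPTP := measMap_isCPTP d.Λ₁_posSemidef d.sum_Λ₁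
  decC_isCPTP := measMap_isCPTP d.Λ₂_posSemidef d.sum_Λ₂

/-- The initial state of `d.code`, with the registers spelled out. -/
def CodeData.initial (d : CodeData F B C J L ρ₁ ρ₂ M₁ M₂) (m₁ : Fin M₁) (m₂ : Fin M₂) :
    Matrix (((Fin M₁ × Fin M₂) × ((J → A₁) × (L → A₂))) × ((J → A₁) × (L → A₂)))
      (((Fin M₁ × Fin M₂) × ((J → A₁) × (L → A₂))) × ((J → A₁) × (L → A₂))) ℂ :=
  d.code.initialState m₁ m₂

theorem CodeData.initial_apply (d : CodeData F B C J L ρ₁ ρ₂ M₁ M₂) (m₁ : Fin M₁) (m₂ : Fin M₂)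
    (m m' : Fin M₁ × Fin M₂) (s r s' r' : (J → A₁) × (L → A₂)) :
    d.initial m₁ m₂ ((m, s), r) ((m', s'), r') =
      Matrix.single (m₁, m₂) (m₁, m₂) (1 : ℂ) m m' *
        (powerPair J L (CFC.sqrt ρ₁) (CFC.sqrt ρ₂) r s *
          star (powerPair J L (CFC.sqrt ρ₁) (CFC.sqrt ρ₂) r' s')) := by
  change Matrix.single (m₁, m₂) (m₁, m₂) (1 : ℂ) m m' *
    ((tensorPower (fun _ => CFC.sqrt ρ₁) r.1 s.1 *
        star (tensorPower (fun _ => CFC.sqrt ρ₁) r'.1 s'.1)) *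
      (tensorPower (fun _ => CFC.sqrt ρ₂) r.2 s.2 *
        star (tensorPower (fun _ => CFC.sqrt ρ₂) r'.2 s'.2))) = _
  simp only [powerPair, Matrix.kroneckerMap_apply, star_mul']
  ring

/-- The state of the channel input and of the receivers' halves of the entanglement, after
encoding. -/
theorem CodeData.encoded_eq [DecidableEq F] (d : CodeData F B C J L ρ₁ ρ₂ M₁ M₂) (m₁ : Fin M₁)
    (m₂ : Fin M₂) :
    onLeft ((J → A₁) × (L → A₂)) (choiMap (controlledChoi d.Γ)) (d.initial m₁ m₂) =
      ((1 : Matrix F F ℂ) ⊗ₖ powerPair J L (CFC.sqrt ρ₁) (CFC.sqrt ρ₂)) * d.Γ (m₁, m₂) *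
        ((1 : Matrix F F ℂ) ⊗ₖ powerPair J L (CFC.sqrt ρ₁) (CFC.sqrt ρ₂)) := by
  have hH : ((1 : Matrix F F ℂ) ⊗ₖ powerPair J L (CFC.sqrt ρ₁) (CFC.sqrt ρ₂))ᴴ =
      (1 : Matrix F F ℂ) ⊗ₖ powerPair J L (CFC.sqrt ρ₁) (CFC.sqrt ρ₂) :=
    isHermitian_one_kronecker (isHermitian_powerPair (isHermitian_sqrt ρ₁) (isHermitian_sqrt ρ₂))
  have h := onLeft_choiMap (d.Γ (m₁, m₂)) (powerPair J L (CFC.sqrt ρ₁) (CFC.sqrt ρ₂))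
  rw [hH] at h
  rw [← h]
  ext ⟨f, r⟩ ⟨f', r'⟩
  simp only [onLeft, choiMap, LinearMap.coe_mk, AddHom.coe_mk, Matrix.of_apply]
  rw [Fintype.sum_prod_type, Finset.sum_eq_single_of_mem (m₁, m₂) (Finset.mem_univ _)]
  · refine Finset.sum_congr rfl fun s _ => ?_
    rw [Fintype.sum_prod_type, Finset.sum_eq_single_of_mem (m₁, m₂) (Finset.mem_univ _)]
    · refine Finset.sum_congr rfl fun s' _ => ?_
      simp [controlledChoi, blockDiag, d.initial_apply]
    · intro m _ hm
      refine Finset.sum_eq_zero fun s' _ => ?_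
      simp [controlledChoi, blockDiag, hm.symm]
  · intro m _ hm
    refine Finset.sum_eq_zero fun s _ => Finset.sum_eq_zero fun x _ => ?_
    simp [d.initial_apply, hm.symm]

theorem CodeData.errorProb_eq [DecidableEq F] (d : CodeData F B C J L ρ₁ ρ₂ M₁ M₂)
    (N : Matrix F F ℂ →ₗ[ℂ] Matrix (B × C) (B × C) ℂ) (m₁ : Fin M₁) (m₂ : Fin M₂) :
    d.code.errorProb N m₁ m₂ = ((1 - d.Λ₁ m₁ ⊗ₖ d.Λ₂ m₂) * broadcastMap N (J → A₁) (L → A₂)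
      (((1 : Matrix F F ℂ) ⊗ₖ powerPair J L (CFC.sqrt ρ₁) (CFC.sqrt ρ₂)) * d.Γ (m₁, m₂) *
        ((1 : Matrix F F ℂ) ⊗ₖ powerPair J L (CFC.sqrt ρ₁) (CFC.sqrt ρ₂)))).trace.re := by
  rw [← d.encoded_eq m₁ m₂]
  set X := broadcastMap N (J → A₁) (L → A₂) (onLeft ((J → A₁) × (L → A₂))
    (choiMap (controlledChoi d.Γ)) (d.initial m₁ m₂)) with hX
  have h : ∀ m : Fin M₁ × Fin M₂, d.code.outputState N m₁ m₂ m m =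
      ((d.Λ₁ m.1 ⊗ₖ d.Λ₂ m.2) * X).trace := fun m =>
    tensorMap_measMap_apply_self d.Λ₁ d.Λ₂ X m.1 m.2
  have hsum : ∑ m : Fin M₁ × Fin M₂, (d.Λ₁ m.1 ⊗ₖ d.Λ₂ m.2) = 1 := by
    rw [← Matrix.one_kronecker_one, ← d.sum_Λ₁, ← d.sum_Λ₂, Fintype.sum_prod_type]
    ext
    simp [Matrix.sum_apply, Finset.sum_mul_sum]
  simp only [BroadcastCode.errorProb, h]
  rw [← Complex.re_sum, ← Matrix.trace_sum, ← Finset.sum_mul, ← hsum,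
    ← Finset.add_sum_erase _ _ (Finset.mem_univ (m₁, m₂)), add_sub_cancel_left]

end Code

/-! ### Error analysis -/

section Marginals

variable {F B C A₁ A₂ E E' : Type*} [Fintype F] [Fintype B] [Fintype C] [Fintype A₁] [Fintype A₂]
  [Fintype E] [Fintype E']

/-- Linear maps on tripartite operators are determined by their values on tensor products. -/
theorem linearMap_ext_kronecker₃ {V : Type*} [AddCommMonoid V] [Module ℂ V]
    {f g : Matrix (F × A₁ × A₂) (F × A₁ × A₂) ℂ →ₗ[ℂ] V}
    (h : ∀ (X : Matrix F F ℂ) (Y : Matrix A₁ A₁ ℂ) (Z : Matrix A₂ A₂ ℂ),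
      f (X ⊗ₖ (Y ⊗ₖ Z)) = g (X ⊗ₖ (Y ⊗ₖ Z))) : f = g := by
  refine linearMap_ext_kronecker fun X W => ?_
  let K : Matrix (A₁ × A₂) (A₁ × A₂) ℂ →ₗ[ℂ] Matrix (F × A₁ × A₂) (F × A₁ × A₂) ℂ :=
    { toFun := fun W => X ⊗ₖ W
      map_add' := fun W W' => Matrix.kronecker_add X W W'
      map_smul' := fun c W => Matrix.kronecker_smul c X W }
  have : f ∘ₗ K = g ∘ₗ K := linearMap_ext_kronecker fun Y Z => h X Y Z
  exact LinearMap.congr_fun this W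

theorem ptraceRight_broadcastMap_kronecker (N : Matrix F F ℂ →ₗ[ℂ] Matrix (B × C) (B × C) ℂ)
    (X : Matrix F F ℂ) (Y : Matrix E E ℂ) (Z : Matrix E' E' ℂ) :
    ptraceRight (broadcastMap N E E' (X ⊗ₖ (Y ⊗ₖ Z))) = Z.trace • (ptraceRight (N X) ⊗ₖ Y) := by
  ext ⟨b, e⟩ ⟨b', e'⟩
  simp only [broadcastMap, ptraceRight, LinearMap.coe_mk, AddHom.coe_mk, onLeft_kronecker,
    Matrix.of_apply, Matrix.submatrix_apply, Equiv.prodProdProdComm_apply,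
    Matrix.kroneckerMap_apply, Matrix.smul_apply, smul_eq_mul, Fintype.sum_prod_type, Matrix.trace,
    Matrix.diag]
  rw [Finset.sum_mul, Finset.sum_comm]
  refine Finset.sum_congr rfl fun z _ => ?_
  rw [Finset.sum_mul, Finset.mul_sum]
  refine Finset.sum_congr rfl fun c _ => ?_
  ring

theorem ptraceLeft_broadcastMap_kronecker (N : Matrix F F ℂ →ₗ[ℂ] Matrix (B × C) (B × C) ℂ)
    (X : Matrix F F ℂ) (Y : Matrix E E ℂ) (Z : Matrix E' E' ℂ) :
    ptraceLeft (broadcastMap N E E' (X ⊗ₖ (Y ⊗ₖ Z))) = Y.trace • (ptraceLeft (N X) ⊗ₖ Z) := by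
  ext ⟨b, e⟩ ⟨b', e'⟩
  simp only [broadcastMap, ptraceLeft, LinearMap.coe_mk, AddHom.coe_mk, onLeft_kronecker,
    Matrix.of_apply, Matrix.submatrix_apply, Equiv.prodProdProdComm_apply,
    Matrix.kroneckerMap_apply, Matrix.smul_apply, smul_eq_mul, Fintype.sum_prod_type, Matrix.trace,
    Matrix.diag]
  rw [Finset.sum_mul, Finset.sum_comm]
  refine Finset.sum_congr rfl fun z _ => ?_
  rw [Finset.sum_mul, Finset.mul_sum]
  refine Finset.sum_congr rfl fun c _ => ?_
  ring

theorem ptraceRight_broadcastMap (N : Matrix F F ℂ →ₗ[ℂ] Matrix (B × C) (B × C) ℂ)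
    (μ : Matrix A₁ A₁ ℂ →ₗ[ℂ] Matrix E E ℂ) {ν : Matrix A₂ A₂ ℂ →ₗ[ℂ] Matrix E' E' ℂ}
    (hν : ∀ X, (ν X).trace = X.trace) (ψ : Matrix (F × A₁ × A₂) (F × A₁ × A₂) ℂ) :
    ptraceRight (broadcastMap N E E' (onRight F (tensorMap μ ν) ψ)) =
      onRight B μ (onLeft A₁ (ptraceRight ∘ₗ N) (margFA₁ ψ)) := by
  have : ptraceRight ∘ₗ broadcastMap N E E' ∘ₗ onRight F (tensorMap μ ν) =
      onRight B μ ∘ₗ onLeft A₁ (ptraceRight ∘ₗ N) ∘ₗ onRight F ptraceRight := by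
    refine linearMap_ext_kronecker₃ fun X Y Z => ?_
    simp only [LinearMap.comp_apply, onRight_kronecker, onLeft_kronecker, tensorMap_kronecker,
      ptraceRight_kronecker, ptraceRight_broadcastMap_kronecker, hν, Matrix.kronecker_smul,
      map_smul]
  exact LinearMap.congr_fun this ψ

theorem ptraceLeft_broadcastMap (N : Matrix F F ℂ →ₗ[ℂ] Matrix (B × C) (B × C) ℂ)
    {μ : Matrix A₁ A₁ ℂ →ₗ[ℂ] Matrix E E ℂ} (ν : Matrix A₂ A₂ ℂ →ₗ[ℂ] Matrix E' E' ℂ)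
    (hμ : ∀ X, (μ X).trace = X.trace) (ψ : Matrix (F × A₁ × A₂) (F × A₁ × A₂) ℂ) :
    ptraceLeft (broadcastMap N E E' (onRight F (tensorMap μ ν) ψ)) =
      onRight C ν (onLeft A₂ (ptraceLeft ∘ₗ N) (margFA₂ ψ)) := by
  have : ptraceLeft ∘ₗ broadcastMap N E E' ∘ₗ onRight F (tensorMap μ ν) =
      onRight C ν ∘ₗ onLeft A₂ (ptraceLeft ∘ₗ N) ∘ₗ onRight F ptraceLeft := by
    refine linearMap_ext_kronecker₃ fun X Y Z => ?_
    simp only [LinearMap.comp_apply, onRight_kronecker, onLeft_kronecker, tensorMap_kronecker,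
      ptraceLeft_kronecker, ptraceLeft_broadcastMap_kronecker, hμ, Matrix.kronecker_smul,
      map_smul]
  exact LinearMap.congr_fun this ψ

theorem broadcastMap_posSemidef {N : Matrix F F ℂ →ₗ[ℂ] Matrix (B × C) (B × C) ℂ} (hN : IsCPTP N)
    {X : Matrix (F × (E × E')) (F × (E × E')) ℂ} (hX : X.PosSemidef) :
    (broadcastMap N E E' X).PosSemidef :=
  (hN.isCP.onLeft hX).submatrix _

theorem trace_onLeft {G : Type*} [Fintype G] {Φ : Matrix F F ℂ →ₗ[ℂ] Matrix G G ℂ}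
    (hΦ : ∀ X, (Φ X).trace = X.trace) (X : Matrix (F × E) (F × E) ℂ) :
    (onLeft E Φ X).trace = X.trace := by
  rw [← trace_ptraceRight, ptraceRight_onLeft, hΦ, trace_ptraceRight]

theorem trace_broadcastMap {N : Matrix F F ℂ →ₗ[ℂ] Matrix (B × C) (B × C) ℂ} (hN : IsCPTP N)
    (X : Matrix (F × (E × E')) (F × (E × E')) ℂ) : (broadcastMap N E E' X).trace = X.trace := by
  rw [← trace_onLeft hN.tracePreserving X]
  exact (Equiv.prodProdProdComm B E C E').sum_comp
    fun x => onLeft (E × E') N X x x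

theorem ptraceRight_isCP : IsCP (ptraceRight (A := B) (R := C)) := by
  intro k X hX
  have := ptraceRight_posSemidef (hX.submatrix (fun x : (Fin k × B) × C => (x.1.1, x.1.2, x.2)))
  exact this

theorem ptraceLeft_isCP : IsCP (ptraceLeft (A := C) (R := B)) := by
  intro k X hX
  have := ptraceRight_posSemidef (hX.submatrix (fun x : (Fin k × C) × B => (x.1.1, x.2, x.1.2)))
  exact this

/-- The output state `Tr_C N(ψ_{F A₁})` seen by the first receiver. -/
theorem isState_onLeft_margFA₁ {N : Matrix F F ℂ →ₗ[ℂ] Matrix (B × C) (B × C) ℂ} (hN : IsCPTP N)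
    {ψ : Matrix (F × A₁ × A₂) (F × A₁ × A₂) ℂ} (hψ : IsState ψ) :
    IsState (onLeft A₁ (ptraceRight ∘ₗ N) (margFA₁ ψ)) where
  posSemidef := (ptraceRight_isCP.comp hN.isCP).onLeft (ptraceRight_isCP.onRight hψ.posSemidef)
  trace_eq_one := by
    rw [trace_onLeft fun X => by rw [LinearMap.comp_apply, trace_ptraceRight, hN.tracePreserving],
      margFA₁, ← trace_ptraceLeft, ptraceLeft_onRight, trace_ptraceRight, trace_ptraceLeft,
      hψ.trace_eq_one]

/-- The output state `Tr_B N(ψ_{F A₂})` seen by the second receiver. -/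
theorem isState_onLeft_margFA₂ {N : Matrix F F ℂ →ₗ[ℂ] Matrix (B × C) (B × C) ℂ} (hN : IsCPTP N)
    {ψ : Matrix (F × A₁ × A₂) (F × A₁ × A₂) ℂ} (hψ : IsState ψ) :
    IsState (onLeft A₂ (ptraceLeft ∘ₗ N) (margFA₂ ψ)) where
  posSemidef := (ptraceLeft_isCP.comp hN.isCP).onLeft (ptraceLeft_isCP.onRight hψ.posSemidef)
  trace_eq_one := by
    rw [trace_onLeft fun X => by rw [LinearMap.comp_apply, trace_ptraceLeft, hN.tracePreserving],
      margFA₂, ← trace_ptraceLeft, ptraceLeft_onRight, trace_ptraceLeft, trace_ptraceLeft,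
      hψ.trace_eq_one]

end Marginals

section ErrorBound

variable {F B C A₁ A₂ : Type u} [Fintype F] [DecidableEq F] [Fintype B] [DecidableEq B] [Fintype C]
  [DecidableEq C] [Fintype A₁] [DecidableEq A₁] [Fintype A₂] [DecidableEq A₂] {J L : Type}
  [Fintype J] [DecidableEq J] [Fintype L] [DecidableEq L] {M₁ M₂ : ℕ}
  {ρ₁ : Matrix A₁ A₁ ℂ} {ρ₂ : Matrix A₂ A₂ ℂ}

theorem effect_le_one {ι R : Type*} [Fintype ι] [DecidableEq ι] [Fintype R] [DecidableEq R]
    {Λ : ι → Matrix R R ℂ} (h : ∀ i, (Λ i).PosSemidef) (h1 : ∑ i, Λ i = 1) (i : ι) : Λ i ≤ 1 := by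
  rw [← h1, ← Finset.add_sum_erase _ _ (Finset.mem_univ i)]
  exact le_add_of_nonneg_right (Matrix.posSemidef_sum _ fun i _ => h i).nonneg

theorem CodeData.effect_le_one (d : CodeData F B C J L ρ₁ ρ₂ M₁ M₂) (m₁ : Fin M₁) (m₂ : Fin M₂) :
    d.Λ₁ m₁ ⊗ₖ d.Λ₂ m₂ ≤ 1 :=
  kronecker_le_one (d.Λ₁_posSemidef m₁) (QBroadcast.effect_le_one d.Λ₁_posSemidef d.sum_Λ₁ m₁)
    (QBroadcast.effect_le_one d.Λ₂_posSemidef d.sum_Λ₂ m₂)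

theorem CodeData.errorProb_le_one (d : CodeData F B C J L ρ₁ ρ₂ M₁ M₂)
    {N : Matrix F F ℂ →ₗ[ℂ] Matrix (B × C) (B × C) ℂ} (hN : IsCPTP N) (m₁ : Fin M₁)
    (m₂ : Fin M₂) : d.code.errorProb N m₁ m₂ ≤ 1 := by
  have hH : (powerPair J L (CFC.sqrt ρ₁) (CFC.sqrt ρ₂)).IsHermitian :=
    isHermitian_powerPair (isHermitian_sqrt ρ₁) (isHermitian_sqrt ρ₂)
  rw [d.errorProb_eq]
  refine (re_trace_mul_mono_left (Y := 1) (broadcastMap_posSemidef hN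
    (posSemidef_hermitian_conj (d.Γ_posSemidef _) (isHermitian_one_kronecker hH))) ?_).trans ?_
  · exact sub_le_self _ ((d.Λ₁_posSemidef m₁).kronecker (d.Λ₂_posSemidef m₂)).nonneg
  · rw [Matrix.one_mul, trace_broadcastMap hN, trace_one_kronecker_conj, d.ptraceLeft_Γ,
      Matrix.mul_one, powerPair_mul, sqrt_mul_sqrt d.isState₁.posSemidef,
      sqrt_mul_sqrt d.isState₂.posSemidef,
      trace_powerPair d.isState₁.trace_eq_one d.isState₂.trace_eq_one, Complex.one_re]

/-- If both receivers locate the position of `ψ` well, then the error probability is small for every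
encoder whose output is dominated by a mixture of such positions. -/
theorem CodeData.errorProb_le (d : CodeData F B C J L ρ₁ ρ₂ M₁ M₂)
    {N : Matrix F F ℂ →ₗ[ℂ] Matrix (B × C) (B × C) ℂ} (hN : IsCPTP N) {m₁ : Fin M₁} {m₂ : Fin M₂}
    {ψ : Matrix (F × A₁ × A₂) (F × A₁ × A₂) ℂ} (hψ : IsState ψ) {s : Finset J} {t : Finset L}
    (hs : s.Nonempty) (ht : t.Nonempty)
    {Δ : Matrix (F × ((J → A₁) × (L → A₂))) (F × ((J → A₁) × (L → A₂))) ℂ} (hΔ : Δ.PosSemidef)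
    {c e₁ e₂ : ℝ} (hc : 0 ≤ c)
    (hle : ((1 : Matrix F F ℂ) ⊗ₖ powerPair J L (CFC.sqrt ρ₁) (CFC.sqrt ρ₂)) * d.Γ (m₁, m₂) *
        ((1 : Matrix F F ℂ) ⊗ₖ powerPair J L (CFC.sqrt ρ₁) (CFC.sqrt ρ₂)) ≤
      c • onRight F (avgIns s t ρ₁ ρ₂) ψ + Δ)
    (h₁ : ∀ j ∈ s, ((1 - d.Λ₁ m₁) * onRight B (ins j ρ₁)
      (onLeft A₁ (ptraceRight ∘ₗ N) (margFA₁ ψ))).trace.re ≤ e₁)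
    (h₂ : ∀ k ∈ t, ((1 - d.Λ₂ m₂) * onRight C (ins k ρ₂)
      (onLeft A₂ (ptraceLeft ∘ₗ N) (margFA₂ ψ))).trace.re ≤ e₂) :
    d.code.errorProb N m₁ m₂ ≤ c * (e₁ + e₂) + Δ.trace.re := by
  rw [d.errorProb_eq]
  set Θ := powerPair J L (CFC.sqrt ρ₁) (CFC.sqrt ρ₂)
  set T := 1 - d.Λ₁ m₁ ⊗ₖ d.Λ₂ m₂ with hT
  set b := broadcastMap N (J → A₁) (L → A₂) with hb
  have hTp : T.PosSemidef := Matrix.le_iff.mp (d.effect_le_one m₁ m₂)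
  have hT1 : T ≤ 1 := sub_le_self _ ((d.Λ₁_posSemidef m₁).kronecker (d.Λ₂_posSemidef m₂)).nonneg
  have hmono : b (((1 : Matrix F F ℂ) ⊗ₖ Θ) * d.Γ (m₁, m₂) * ((1 : Matrix F F ℂ) ⊗ₖ Θ)) ≤
      b (c • onRight F (avgIns s t ρ₁ ρ₂) ψ + Δ) :=
    le_of_sub_eq (broadcastMap_posSemidef hN (Matrix.le_iff.mp hle)) (map_sub b _ _).symm
  have hpos : ∀ j ∈ s, ∀ k ∈ t,
      (T * b (onRight F (tensorMap (ins j ρ₁) (ins k ρ₂)) ψ)).trace.re ≤ e₁ + e₂ := by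
    intro j hj k hk
    have hp : (b (onRight F (tensorMap (ins j ρ₁) (ins k ρ₂)) ψ)).PosSemidef :=
      broadcastMap_posSemidef hN (((ins_isCP j d.isState₁.posSemidef).tensorMap
        (ins_isCP k d.isState₂.posSemidef)).onRight hψ.posSemidef)
    have hTle : T ≤ (1 - d.Λ₁ m₁) ⊗ₖ (1 : Matrix (C × (L → A₂)) (C × (L → A₂)) ℂ) +
        (1 : Matrix (B × (J → A₁)) (B × (J → A₁)) ℂ) ⊗ₖ (1 - d.Λ₂ m₂) := by
      have e : (1 - d.Λ₁ m₁) ⊗ₖ (1 : Matrix (C × (L → A₂)) (C × (L → A₂)) ℂ) +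
        (1 : Matrix (B × (J → A₁)) (B × (J → A₁)) ℂ) ⊗ₖ (1 - d.Λ₂ m₂) - T =
          (1 - d.Λ₁ m₁) ⊗ₖ (1 - d.Λ₂ m₂) := by
        rw [hT, ← Matrix.one_kronecker_one (m := B × (J → A₁)) (n := C × (L → A₂))]
        ext
        simp only [Matrix.sub_apply, Matrix.add_apply, Matrix.kroneckerMap_apply]
        ring
      exact le_of_sub_eq ((Matrix.le_iff.mp
        (QBroadcast.effect_le_one d.Λ₁_posSemidef d.sum_Λ₁ m₁)).kronecker (Matrix.le_iff.mp
        (QBroadcast.effect_le_one d.Λ₂_posSemidef d.sum_Λ₂ m₂))) e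
    refine (re_trace_mul_mono_left hp hTle).trans ?_
    rw [Matrix.add_mul, Matrix.trace_add, Complex.add_re, trace_mul_kronecker_one,
      trace_mul_one_kronecker, hb,
      ptraceRight_broadcastMap N _ (fun X => trace_ins k d.isState₂.trace_eq_one X),
      ptraceLeft_broadcastMap N _ (fun X => trace_ins j d.isState₁.trace_eq_one X)]
    exact add_le_add (h₁ j hj) (h₂ k hk)
  have havg : (T * b (onRight F (avgIns s t ρ₁ ρ₂) ψ)).trace.re ≤ e₁ + e₂ := by
    have hs0 : (0 : ℝ) < s.card := by exact_mod_cast hs.card_pos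
    have ht0 : (0 : ℝ) < t.card := by exact_mod_cast ht.card_pos
    have e : onRight F (avgIns s t ρ₁ ρ₂) ψ = ((s.card * t.card : ℝ)⁻¹ : ℂ) •
        ∑ p ∈ s ×ˢ t, onRight F (tensorMap (ins p.1 ρ₁) (ins p.2 ρ₂)) ψ := by
      ext x y
      simp [avgIns, onRight, Matrix.sum_apply]
    rw [e, map_smul, map_sum, Matrix.mul_smul, Matrix.mul_sum, Matrix.trace_smul,
      Matrix.trace_sum, smul_eq_mul, ← Complex.ofReal_inv, Complex.re_ofReal_mul, Complex.re_sum]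
    have := Finset.sum_le_sum fun p (hp : p ∈ s ×ˢ t) =>
      hpos p.1 (Finset.mem_product.mp hp).1 p.2 (Finset.mem_product.mp hp).2
    rw [Finset.sum_const, Finset.card_product, nsmul_eq_mul] at this
    push_cast at this
    refine (mul_le_mul_of_nonneg_left this (by positivity)).trans_eq ?_
    field_simp
  have hΔb : (T * b Δ).trace.re ≤ Δ.trace.re := by
    refine (re_trace_mul_mono_left (broadcastMap_posSemidef hN hΔ) hT1).trans ?_
    rw [Matrix.one_mul, trace_broadcastMap hN]
  refine (re_trace_mul_mono hTp hmono).trans ?_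
  rw [map_add, Matrix.mul_add, Matrix.trace_add, Complex.add_re]
  have hsm : (broadcastMap N (J → A₁) (L → A₂)) (c • onRight F (avgIns s t ρ₁ ρ₂) ψ) =
      c • b (onRight F (avgIns s t ρ₁ ρ₂) ψ) := b.map_smul_of_tower c _
  rw [hsm, Matrix.mul_smul, re_trace_real_smul]
  exact add_le_add (mul_le_mul_of_nonneg_left havg hc) hΔb

end ErrorBound

/-! ### Choice of the rates and of the block sizes -/

section Numbers

theorem add_le_of_le_sub_coe {D : EReal} {R c : ℝ} (h : (R : EReal) ≤ D - (c : EReal)) :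
    ((R + c : ℝ) : EReal) ≤ D := by
  have := (EReal.le_sub_iff_add_le (Or.inl (EReal.coe_ne_bot c)) (Or.inl (EReal.coe_ne_top c))).mp h
  exact_mod_cast this

/-- Real numbers that witness the three rate constraints up to a loss of one bit in each of the
single rates and of three bits in the sum rate. The strict inequalities make witnesses of the
suprema and of the infimum available, whether or not these are attained. -/
theorem exists_real_rates {D₁ D₂ I : EReal} {R₁ R₂ c c' : ℝ} (h₁ : (R₁ : EReal) ≤ D₁ - (c : EReal))
    (h₂ : (R₂ : EReal) ≤ D₂ - (c : EReal))
    (h₁₂ : ((R₁ + R₂ : ℝ) : EReal) ≤ D₁ + D₂ - I - (c' : EReal)) :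
    ∃ x₁ x₂ y : ℝ, (x₁ : EReal) < D₁ ∧ (x₂ : EReal) < D₂ ∧ I < (y : EReal) ∧
      R₁ + c - 1 ≤ x₁ ∧ R₂ + c - 1 ≤ x₂ ∧ R₁ + R₂ + c' - 3 ≤ x₁ + x₂ - y := by
  have h₁ := add_le_of_le_sub_coe h₁
  have h₂ := add_le_of_le_sub_coe h₂
  have h₁₂ := add_le_of_le_sub_coe h₁₂
  have lt1 : ((R₁ + c - 1 : ℝ) : EReal) < D₁ :=
    lt_of_lt_of_le (by exact_mod_cast sub_one_lt _) h₁
  have lt2 : ((R₂ + c - 1 : ℝ) : EReal) < D₂ :=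
    lt_of_lt_of_le (by exact_mod_cast sub_one_lt _) h₂
  have hI : I ≠ ⊤ := by
    rintro rfl
    rw [EReal.sub_top] at h₁₂
    simp at h₁₂
  -- when one of the quantities is infinite, its witness absorbs the sum rate constraint
  induction I with
  | top => exact absurd rfl hI
  | bot =>
    refine ⟨R₁ + c - 1, R₂ + c - 1, -(R₁ + R₂ + c' - 3) + (R₁ + c - 1) + (R₂ + c - 1), lt1, lt2,
      EReal.bot_lt_coe _, le_rfl, le_rfl, by linarith⟩
  | coe i =>
    induction D₁ with
    | bot => simp at lt1
    | top =>
      refine ⟨max (R₁ + c - 1) (R₁ + R₂ + c' - 3 - (R₂ + c - 1) + (i + 1)), R₂ + c - 1, i + 1,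
        EReal.coe_lt_top _, lt2, by exact_mod_cast lt_add_one i, le_max_left _ _, le_rfl, ?_⟩
      have := le_max_right (R₁ + c - 1) (R₁ + R₂ + c' - 3 - (R₂ + c - 1) + (i + 1))
      linarith
    | coe d₁ =>
      induction D₂ with
      | bot => simp at lt2
      | top =>
        refine ⟨R₁ + c - 1, max (R₂ + c - 1) (R₁ + R₂ + c' - 3 - (R₁ + c - 1) + (i + 1)), i + 1,
          lt1, EReal.coe_lt_top _, by exact_mod_cast lt_add_one i, le_rfl, le_max_left _ _, ?_⟩
        have := le_max_right (R₂ + c - 1) (R₁ + R₂ + c' - 3 - (R₁ + c - 1) + (i + 1))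
        linarith
      | coe d₂ =>
        have a₁ : R₁ + c ≤ d₁ := by exact_mod_cast h₁
        have a₂ : R₂ + c ≤ d₂ := by exact_mod_cast h₂
        have a₁₂ : R₁ + R₂ + c' ≤ d₁ + d₂ - i := by exact_mod_cast h₁₂
        exact ⟨d₁ - 1, d₂ - 1, i + 1, by exact_mod_cast sub_one_lt d₁,
          by exact_mod_cast sub_one_lt d₂, by exact_mod_cast lt_add_one i, by linarith,
          by linarith, by linarith⟩

theorem exists_nat_block {δ a : ℝ} (ha : 0 < a) (h : a ≤ δ) :
    ∃ K : ℕ, 0 < K ∧ K * a ≤ δ ∧ δ ≤ 2 * (K * a) := by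
  have h1 : 1 ≤ δ / a := (one_le_div ha).mpr h
  refine ⟨⌊δ / a⌋₊, Nat.floor_pos.mpr h1, ?_, ?_⟩
  · exact (le_div_iff₀ ha).mp (Nat.floor_le (by positivity))
  · have h2 := Nat.lt_floor_add_one (δ / a)
    have h3 : (1 : ℝ) ≤ ⌊δ / a⌋₊ := by exact_mod_cast Nat.floor_pos.mpr h1
    have h4 : δ / a ≤ 2 * ⌊δ / a⌋₊ := by linarith
    rw [div_le_iff₀ ha] at h4
    linarith

/-- The numbers `K₁`, `K₂` of positions per message: small enough for the receivers to decode, and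
large enough for the sender to hide the correlations between the two positions. A receiver with a
single message need not decode, which leaves its number of positions unconstrained. -/
theorem exists_block_sizes {δ u₁ u₂ v : ℝ} {M₁ M₂ : ℕ} (hδ : 0 < δ) (hu₁ : 0 < u₁) (hu₂ : 0 < u₂)
    (hv : 0 < v) (hM₁ : 0 < M₁) (hM₂ : 0 < M₂) (h₁ : M₁ = 1 ∨ M₁ * u₁ ≤ δ)
    (h₂ : M₂ = 1 ∨ M₂ * u₂ ≤ δ)
    (h₁₂ : M₁ = 1 ∨ M₂ = 1 ∨ 4 * (M₁ * u₁ * (M₂ * u₂) * v) ≤ δ ^ 3) :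
    ∃ K₁ K₂ : ℕ, 0 < K₁ ∧ 0 < K₂ ∧ (M₁ = 1 ∨ M₁ * K₁ * u₁ ≤ δ) ∧ (M₂ = 1 ∨ M₂ * K₂ * u₂ ≤ δ) ∧
      v / (K₁ * K₂) ≤ δ := by
  have big : v / (⌈v / δ⌉₊ + 1 : ℕ) ≤ δ := by
    rw [div_le_iff₀ (by positivity), ← div_le_iff₀' hδ]
    push_cast
    linarith [Nat.le_ceil (v / δ)]
  rcases eq_or_ne M₁ 1 with h | h
  · refine ⟨⌈v / δ⌉₊ + 1, 1, by omega, one_pos, Or.inl h, ?_, by simpa using big⟩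
    exact h₂.imp_right fun h => by simpa using h
  rcases eq_or_ne M₂ 1 with h' | h'
  · refine ⟨1, ⌈v / δ⌉₊ + 1, one_pos, by omega, ?_, Or.inl h', by simpa using big⟩
    exact h₁.imp_right fun h => by simpa using h
  have h₁ := h₁.resolve_left h
  have h₂ := h₂.resolve_left h'
  have h₁₂ := (h₁₂.resolve_left h).resolve_left h'
  have p₁ : 0 < (M₁ : ℝ) * u₁ := by positivity
  have p₂ : 0 < (M₂ : ℝ) * u₂ := by positivity
  obtain ⟨K₁, hK₁, le₁, ge₁⟩ := exists_nat_block p₁ h₁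
  obtain ⟨K₂, hK₂, le₂, ge₂⟩ := exists_nat_block p₂ h₂
  refine ⟨K₁, K₂, hK₁, hK₂, Or.inr (by linarith), Or.inr (by linarith), ?_⟩
  rw [div_le_iff₀ (by positivity)]
  have h5 : δ * δ ≤ 2 * (K₁ * (M₁ * u₁)) * (2 * (K₂ * (M₂ * u₂))) :=
    mul_le_mul ge₁ ge₂ hδ.le (by positivity)
  have h6 : v * (4 * (M₁ * u₁ * (M₂ * u₂))) ≤ δ * (K₁ * K₂) * (4 * (M₁ * u₁ * (M₂ * u₂))) := by
    have := mul_le_mul_of_nonneg_left h5 hδ.le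
    nlinarith
  exact le_of_mul_le_mul_right h6 (by positivity)

theorem ceil_two_rpow_eq_one {R : ℝ} (h : R ≤ 0) : ⌈(2 : ℝ) ^ R⌉₊ = 1 := by
  rw [Nat.ceil_eq_iff one_ne_zero]
  simpa using ⟨by positivity, Real.rpow_le_one_of_one_le_of_nonpos one_le_two h⟩

theorem ceil_two_rpow_le {R : ℝ} (h : 0 ≤ R) : (⌈(2 : ℝ) ^ R⌉₊ : ℝ) ≤ 2 ^ (R + 1) := by
  have h1 : (1 : ℝ) ≤ 2 ^ R := Real.one_le_rpow one_le_two h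
  rw [Real.rpow_add_one two_ne_zero]
  linarith [Nat.ceil_lt_add_one (zero_le_one.trans h1)]

theorem two_rpow_mul_logb {δ : ℝ} (hδ : 0 < δ) (n : ℕ) :
    (2 : ℝ) ^ (-(n * Real.logb 2 (1 / δ))) = δ ^ n := by
  rw [one_div, Real.logb_inv, mul_neg, neg_neg, mul_comm, Real.rpow_mul zero_le_two,
    Real.rpow_logb two_pos (by norm_num) hδ, Real.rpow_natCast]

theorem ceil_mul_le {δ R x : ℝ} (hδ : 0 < δ) (hδ1 : δ ≤ 1)
    (h : R + (5 * Real.logb 2 (1 / δ) + 2) - 1 ≤ x) :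
    ⌈(2 : ℝ) ^ R⌉₊ = 1 ∨ (⌈(2 : ℝ) ^ R⌉₊ : ℝ) * 2 ^ (-x) ≤ δ := by
  rcases le_total R 0 with hR | hR
  · exact Or.inl (ceil_two_rpow_eq_one hR)
  refine Or.inr ((mul_le_mul_of_nonneg_right (ceil_two_rpow_le hR) (by positivity)).trans ?_)
  rw [← Real.rpow_add two_pos]
  refine (Real.rpow_le_rpow_of_exponent_le one_le_two
    (z := -((5 : ℕ) * Real.logb 2 (1 / δ))) (by push_cast; linarith)).trans ?_
  rw [two_rpow_mul_logb hδ]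
  exact pow_le_of_le_one hδ.le hδ1 (by norm_num)

theorem ceil_mul_ceil_mul_le {δ R₁ R₂ x₁ x₂ y : ℝ} (hδ : 0 < δ) (hδ1 : δ ≤ 1 / 2)
    (h : R₁ + R₂ + (11 * Real.logb 2 (1 / δ) + 5) - 3 ≤ x₁ + x₂ - y) :
    ⌈(2 : ℝ) ^ R₁⌉₊ = 1 ∨ ⌈(2 : ℝ) ^ R₂⌉₊ = 1 ∨
      4 * ((⌈(2 : ℝ) ^ R₁⌉₊ : ℝ) * 2 ^ (-x₁) * (⌈(2 : ℝ) ^ R₂⌉₊ * 2 ^ (-x₂)) * 2 ^ y) ≤ δ ^ 3 := by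
  rcases le_total R₁ 0 with hR₁ | hR₁
  · exact Or.inl (ceil_two_rpow_eq_one hR₁)
  rcases le_total R₂ 0 with hR₂ | hR₂
  · exact Or.inr (Or.inl (ceil_two_rpow_eq_one hR₂))
  refine Or.inr (Or.inr ?_)
  have h1 : (⌈(2 : ℝ) ^ R₁⌉₊ : ℝ) * 2 ^ (-x₁) * (⌈(2 : ℝ) ^ R₂⌉₊ * 2 ^ (-x₂)) * 2 ^ y ≤
      2 ^ (R₁ + 1) * 2 ^ (-x₁) * (2 ^ (R₂ + 1) * 2 ^ (-x₂)) * 2 ^ y := by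
    have := ceil_two_rpow_le hR₁
    have := ceil_two_rpow_le hR₂
    gcongr
  have h2 : (2 : ℝ) ^ (R₁ + 1) * 2 ^ (-x₁) * (2 ^ (R₂ + 1) * 2 ^ (-x₂)) * 2 ^ y ≤ δ ^ 11 := by
    simp only [← Real.rpow_add two_pos]
    refine (Real.rpow_le_rpow_of_exponent_le one_le_two
      (z := -((11 : ℕ) * Real.logb 2 (1 / δ))) (by push_cast; linarith)).trans ?_
    rw [two_rpow_mul_logb hδ]
  have h3 : δ ^ 11 ≤ δ ^ 5 := pow_le_pow_of_le_one hδ.le (by linarith) (by norm_num)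
  have h4 : δ ^ 5 = δ ^ 3 * δ ^ 2 := by ring
  have h5 : δ ^ 2 ≤ (1 / 2) ^ 2 := pow_le_pow_left₀ hδ.le hδ1 2
  have h6 : δ ^ 3 * δ ^ 2 ≤ δ ^ 3 * (1 / 2) ^ 2 := mul_le_mul_of_nonneg_left h5 (by positivity)
  linarith

end Numbers

/-! ### Witnesses for the information quantities -/

section Witnesses

variable {A B : Type*} [Fintype A] [DecidableEq A] [Fintype B] [DecidableEq B]

theorem le_two_rpow_neg_of_lt_logInv {x t : ℝ} (h : (x : EReal) < logInv t) : t ≤ 2 ^ (-x) := by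
  unfold logInv at h
  split_ifs at h with ht
  · exact ht.trans (by positivity)
  · have ht := not_le.mp ht
    have h : x < Real.logb 2 (1 / t) := by exact_mod_cast h
    rw [one_div, Real.logb_inv] at h
    rw [← Real.logb_le_iff_le_rpow one_lt_two ht]
    linarith

theorem exists_test_of_lt_dH {ε x : ℝ} {ρ σ : Matrix A A ℂ} (h : (x : EReal) < dH ε ρ σ) :
    ∃ T : Matrix A A ℂ, T.PosSemidef ∧ T ≤ 1 ∧ 1 - ε ^ 2 ≤ (T * ρ).trace.re ∧
      (T * σ).trace.re ≤ 2 ^ (-x) := by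
  obtain ⟨T, h⟩ := lt_iSup_iff.mp h
  obtain ⟨⟨h0, h1, h2⟩, h⟩ := lt_iSup_iff.mp h
  exact ⟨T, by simpa [Loewner] using h0, Matrix.le_iff.mpr h1, h2, le_two_rpow_neg_of_lt_logInv h⟩

theorem exists_state_of_restrictedIMax_lt {ε δ y : ℝ} {ρ : Matrix (A × B) (A × B) ℂ}
    (h : restrictedIMax ε δ ρ < (y : EReal)) :
    ∃ ω : Matrix (A × B) (A × B) ℂ, IsState ω ∧ purifiedDist ρ ω ≤ ε ∧
      ptraceRight ω ≤ (1 + δ) • ptraceRight ρ ∧ ptraceLeft ω ≤ (1 + δ) • ptraceLeft ρ ∧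
      ∃ l : ℝ, l < y ∧ ω ≤ (2 : ℝ) ^ l • (ptraceRight ρ ⊗ₖ ptraceLeft ρ) := by
  obtain ⟨ω, h⟩ := iInf_lt_iff.mp h
  obtain ⟨⟨hω, hP, hr, hl⟩, h⟩ := iInf_lt_iff.mp h
  obtain ⟨l, h⟩ := iInf_lt_iff.mp h
  obtain ⟨hle, h⟩ := iInf_lt_iff.mp h
  exact ⟨ω, hω, hP, Matrix.le_iff.mpr hr, Matrix.le_iff.mpr hl, l, by exact_mod_cast h,
    Matrix.le_iff.mpr hle⟩

theorem traceNorm_nonneg (X : Matrix A A ℂ) : 0 ≤ traceNorm X :=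
  re_trace_nonneg (Matrix.nonneg_iff_posSemidef.mp (CFC.sqrt_nonneg _))

theorem one_sub_fidelity_le {ε : ℝ} {ρ σ : Matrix A A ℂ} (h : purifiedDist ρ σ ≤ ε) :
    1 - fidelity ρ σ ≤ ε ^ 2 := by
  have h0 : 0 ≤ fidelity ρ σ := traceNorm_nonneg _
  have h1 := (Real.sqrt_le_iff.mp h).2
  rcases le_total (fidelity ρ σ) 1 with hf | hf
  · nlinarith
  · nlinarith [sq_nonneg ε]

end Witnesses

/-- A receiver's measurement whose error is controlled by a test; a receiver with a single message
needs no test. -/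
theorem exists_decoder {A B : Type*} [Fintype A] [DecidableEq A] [Fintype B] [DecidableEq B]
    {M K : ℕ} (hM : 0 < M) {ε δ u : ℝ} (hδ : 0 < δ) {T ω : Matrix (B × A) (B × A) ℂ}
    {ρ : Matrix A A ℂ} (hT : T.PosSemidef) (hT1 : T ≤ 1) (hω : IsState ω) (hρ : IsState ρ)
    (hTω : 1 - ε ^ 2 ≤ (T * ω).trace.re) (hTρ : (T * (ptraceRight ω ⊗ₖ ρ)).trace.re ≤ u)
    (h : M = 1 ∨ M * K * u ≤ δ) :
    ∃ Λ : Fin M → Matrix (B × (Fin M × Fin K → A)) (B × (Fin M × Fin K → A)) ℂ,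
      (∀ m, (Λ m).PosSemidef) ∧ ∑ m, Λ m = 1 ∧
      ∀ m k, ((1 - Λ m) * onRight B (ins (m, k) ρ) ω).trace.re ≤ 2 * ε ^ 2 + 8 * δ := by
  rcases h with rfl | h
  · refine ⟨fun _ => 1, fun _ => Matrix.PosSemidef.one, by simp, fun m k => ?_⟩
    rw [sub_self, Matrix.zero_mul, Matrix.trace_zero, Complex.zero_re]
    positivity
  · obtain ⟨Λ, hp, h1, hΛ⟩ := exists_positionDecoder (K := K) ⟨0, hM⟩ hT hT1 hω hρ hδ
    refine ⟨Λ, hp, h1, fun m k => (hΛ m k).trans ?_⟩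
    have := mul_le_mul_of_nonneg_left hTρ (show (0 : ℝ) ≤ M * K by positivity)
    linarith

section Coding

variable {F B C A₁ A₂ : Type u} [Fintype F] [Fintype B] [DecidableEq B] [Fintype C] [DecidableEq C]
  [Fintype A₁] [DecidableEq A₁] [Fintype A₂] [DecidableEq A₂]

/-- Every code has error probability at most one. -/
theorem isAchievable_of_one_le {N : Matrix F F ℂ →ₗ[ℂ] Matrix (B × C) (B × C) ℂ} (hN : IsCPTP N)
    {ρ₁ : Matrix A₁ A₁ ℂ} {ρ₂ : Matrix A₂ A₂ ℂ} (hρ₁ : IsState ρ₁) (hρ₂ : IsState ρ₂) (f₀ : F)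
    {R₁ R₂ η : ℝ} (hη : 1 ≤ η ^ 2) : IsAchievable N R₁ R₂ η := by
  classical
  have hM : ∀ R : ℝ, 0 < ⌈(2 : ℝ) ^ R⌉₊ := fun R => Nat.ceil_pos.mpr (by positivity)
  have hite : ∀ {n : Type u} [Fintype n] [DecidableEq n] {M : ℕ} (m₀ m : Fin M),
      (if m = m₀ then (1 : Matrix n n ℂ) else 0).PosSemidef := by
    intro n _ _ M m₀ m
    split_ifs
    exacts [Matrix.PosSemidef.one, Matrix.PosSemidef.zero]
  let d : CodeData F B C (Fin 1) (Fin 1) ρ₁ ρ₂ ⌈(2 : ℝ) ^ R₁⌉₊ ⌈(2 : ℝ) ^ R₂⌉₊ :=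
    { Γ := fun _ => Matrix.single f₀ f₀ 1 ⊗ₖ 1
      Λ₁ := fun m => if m = ⟨0, hM R₁⟩ then 1 else 0
      Λ₂ := fun m => if m = ⟨0, hM R₂⟩ then 1 else 0
      isState₁ := hρ₁
      isState₂ := hρ₂
      Γ_posSemidef := fun _ => (single_posSemidef f₀).kronecker Matrix.PosSemidef.one
      ptraceLeft_Γ := fun _ => by rw [ptraceLeft_kronecker, Matrix.trace_single_eq_same, one_smul]
      Λ₁_posSemidef := hite _
      Λ₂_posSemidef := hite _
      sum_Λ₁ := by simp
      sum_Λ₂ := by simp }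
  exact ⟨d.code, fun m₁ m₂ => (d.errorProb_le_one hN m₁ m₂).trans hη⟩

/-- The coding theorem in terms of explicit tests `T₁`, `T₂`, an explicit state `ω` close to
`ψ_{A₁A₂}`, and block sizes `K₁`, `K₂`. -/
theorem exists_code {ε δ c u₁ u₂ : ℝ} (hδ : 0 < δ) (hc : 0 ≤ c)
    {N : Matrix F F ℂ →ₗ[ℂ] Matrix (B × C) (B × C) ℂ} (hN : IsCPTP N)
    {ψ : Matrix (F × A₁ × A₂) (F × A₁ × A₂) ℂ} (hψ : IsState ψ) (f₀ : F) {M₁ M₂ K₁ K₂ : ℕ}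
    (hM₁ : 0 < M₁) (hM₂ : 0 < M₂) (hK₁ : 0 < K₁) (hK₂ : 0 < K₂)
    {ω : Matrix (A₁ × A₂) (A₁ × A₂) ℂ} (hω : IsState ω) (hP : purifiedDist (margA₁A₂ ψ) ω ≤ ε)
    (hωr : ptraceRight ω ≤ (1 + δ) • ptraceRight (margA₁A₂ ψ))
    (hωl : ptraceLeft ω ≤ (1 + δ) • ptraceLeft (margA₁A₂ ψ))
    (hωc : ω ≤ c • (ptraceRight (margA₁A₂ ψ) ⊗ₖ ptraceLeft (margA₁A₂ ψ)))
    (hcK : c / (K₁ * K₂) ≤ δ)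
    {T₁ : Matrix (B × A₁) (B × A₁) ℂ} (hT₁ : T₁.PosSemidef) (hT₁1 : T₁ ≤ 1)
    (hα₁ : 1 - ε ^ 2 ≤ (T₁ * onLeft A₁ (ptraceRight ∘ₗ N) (margFA₁ ψ)).trace.re)
    (hβ₁ : (T₁ * ((ptraceRight ∘ₗ N) (ptraceRight (margFA₁ ψ)) ⊗ₖ
      ptraceLeft (margFA₁ ψ))).trace.re ≤ u₁)
    (hu₁ : M₁ = 1 ∨ M₁ * K₁ * u₁ ≤ δ)
    {T₂ : Matrix (C × A₂) (C × A₂) ℂ} (hT₂ : T₂.PosSemidef) (hT₂1 : T₂ ≤ 1)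
    (hα₂ : 1 - ε ^ 2 ≤ (T₂ * onLeft A₂ (ptraceLeft ∘ₗ N) (margFA₂ ψ)).trace.re)
    (hβ₂ : (T₂ * ((ptraceLeft ∘ₗ N) (ptraceRight (margFA₂ ψ)) ⊗ₖ
      ptraceLeft (margFA₂ ψ))).trace.re ≤ u₂)
    (hu₂ : M₂ = 1 ∨ M₂ * K₂ * u₂ ≤ δ) :
    ∃ code : BroadcastCode F B C M₁ M₂, ∀ m₁ m₂,
      code.errorProb N m₁ m₂ ≤ 15 * ε ^ 2 + 37 * δ := by
  classical
  have hr₁ : ptraceLeft (margFA₁ ψ) = ptraceRight (margA₁A₂ ψ) := ptraceLeft_onRight _ _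
  have hr₂ : ptraceLeft (margFA₂ ψ) = ptraceLeft (margA₁A₂ ψ) := ptraceLeft_onRight _ _
  have hψ₂ : IsState (margA₁A₂ ψ) :=
    ⟨ptraceLeft_posSemidef hψ.posSemidef, by rw [margA₁A₂, trace_ptraceLeft, hψ.trace_eq_one]⟩
  set ρ₁ := ptraceRight (margA₁A₂ ψ) with hρ₁
  set ρ₂ := ptraceLeft (margA₁A₂ ψ) with hρ₂
  have sρ₁ : IsState ρ₁ :=
    ⟨ptraceRight_posSemidef hψ₂.posSemidef, by rw [hρ₁, trace_ptraceRight, hψ₂.trace_eq_one]⟩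
  have sρ₂ : IsState ρ₂ :=
    ⟨ptraceLeft_posSemidef hψ₂.posSemidef, by rw [hρ₂, trace_ptraceLeft, hψ₂.trace_eq_one]⟩
  rw [hr₁, ← ptraceRight_onLeft] at hβ₁
  rw [hr₂, ← ptraceRight_onLeft] at hβ₂
  obtain ⟨Λ₁, p₁, s₁, e₁⟩ := exists_decoder (K := K₁) hM₁ hδ hT₁ hT₁1
    (isState_onLeft_margFA₁ hN hψ) sρ₁ hα₁ hβ₁ hu₁
  obtain ⟨Λ₂, p₂, s₂, e₂⟩ := exists_decoder (K := K₂) hM₂ hδ hT₂ hT₂1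
    (isState_onLeft_margFA₂ hN hψ) sρ₂ hα₂ hβ₂ hu₂
  -- the message `m` is sent by placing `ψ` at a uniformly random position of the block `{m} × Fin K`
  have ne₁ : ∀ m : Fin M₁, (({m} : Finset (Fin M₁)) ×ˢ (Finset.univ : Finset (Fin K₁))).Nonempty :=
    fun m => ⟨(m, ⟨0, hK₁⟩), by simp⟩
  have ne₂ : ∀ m : Fin M₂, (({m} : Finset (Fin M₂)) ×ˢ (Finset.univ : Finset (Fin K₂))).Nonempty :=
    fun m => ⟨(m, ⟨0, hK₂⟩), by simp⟩
  choose Γ Δ hΓ hΓ1 hΔ hle hΔtr using fun m : Fin M₁ × Fin M₂ =>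
    exists_encoder hψ hρ₁ hρ₂ hω hc hδ.le hωc hωr hωl (ne₁ m.1) (ne₂ m.2) f₀
  let d : CodeData F B C (Fin M₁ × Fin K₁) (Fin M₂ × Fin K₂) ρ₁ ρ₂ M₁ M₂ :=
    ⟨Γ, Λ₁, Λ₂, sρ₁, sρ₂, hΓ, hΓ1, p₁, p₂, s₁, s₂⟩
  refine ⟨d.code, fun m₁ m₂ => (d.errorProb_le hN hψ (ne₁ m₁) (ne₂ m₂) (hΔ (m₁, m₂))
    (by norm_num) (hle (m₁, m₂)) (e₁ := 2 * ε ^ 2 + 8 * δ) (e₂ := 2 * ε ^ 2 + 8 * δ)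
    ?_ ?_).trans ?_⟩
  · rintro ⟨m, k⟩ hm
    obtain rfl : m₁ = m := by simpa using hm
    exact e₁ m₁ k
  · rintro ⟨m, k⟩ hm
    obtain rfl : m₂ = m := by simpa using hm
    exact e₂ m₂ k
  · have h1 := hΔtr (m₁, m₂)
    simp only [Finset.card_product, Finset.card_singleton, Finset.card_univ, Fintype.card_fin,
      one_mul] at h1
    have h2 : δ / K₁ ≤ δ := div_le_self hδ.le (by exact_mod_cast hK₁)
    have h3 : δ / K₂ ≤ δ := div_le_self hδ.le (by exact_mod_cast hK₂)
    have h4 : 1 - fidelity (ptraceLeft ψ) ω ≤ ε ^ 2 := one_sub_fidelity_le hP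
    linarith

theorem nonempty_of_isState {A : Type*} [Fintype A] {ρ : Matrix A A ℂ} (h : IsState ρ) :
    Nonempty A := by
  by_contra hA
  have := not_nonempty_iff.mp hA
  simpa [Matrix.trace] using h.trace_eq_one

end Coding

end

end QBroadcast

theorem theorem6 {F B C A₁ A₂ : Type u}
    [Fintype F] [Fintype B] [DecidableEq B] [Fintype C] [DecidableEq C]
    [Fintype A₁] [DecidableEq A₁] [Fintype A₂] [DecidableEq A₂]
    (ε δ : ℝ) (hε : 0 < ε) (hδ : 0 < δ)
    (N : Matrix F F ℂ →ₗ[ℂ] Matrix (B × C) (B × C) ℂ) (hN : QBroadcast.IsCPTP N)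
    (ψ : Matrix (F × A₁ × A₂) (F × A₁ × A₂) ℂ) (hψ : QBroadcast.IsState ψ)
    (R₁ R₂ : ℝ)
    (hR₁ : (R₁ : EReal) ≤
      QBroadcast.channelDH ε (QBroadcast.ptraceRight ∘ₗ N) (QBroadcast.margFA₁ ψ)
        - ((5 * Real.logb 2 (1 / δ) + 2 : ℝ) : EReal))
    (hR₂ : (R₂ : EReal) ≤
      QBroadcast.channelDH ε (QBroadcast.ptraceLeft ∘ₗ N) (QBroadcast.margFA₂ ψ)
        - ((5 * Real.logb 2 (1 / δ) + 2 : ℝ) : EReal))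
    (hR₁₂ : ((R₁ + R₂ : ℝ) : EReal) ≤
      QBroadcast.channelDH ε (QBroadcast.ptraceRight ∘ₗ N) (QBroadcast.margFA₁ ψ)
        + QBroadcast.channelDH ε (QBroadcast.ptraceLeft ∘ₗ N) (QBroadcast.margFA₂ ψ)
        - QBroadcast.restrictedIMax ε δ (QBroadcast.margA₁A₂ ψ)
        - ((11 * Real.logb 2 (1 / δ) + 5 : ℝ) : EReal)) :
    QBroadcast.IsAchievable N R₁ R₂ (4 * ε + 9 * Real.sqrt δ) := by
  obtain ⟨f₀, a₁, a₂⟩ := QBroadcast.nonempty_of_isState hψ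
  have hη : 16 * ε ^ 2 + 81 * δ ≤ (4 * ε + 9 * Real.sqrt δ) ^ 2 := by
    have := Real.sq_sqrt hδ.le
    have := mul_nonneg hε.le (Real.sqrt_nonneg δ)
    nlinarith
  rcases le_or_gt δ (1 / 2) with hδ2 | hδ2
  · obtain ⟨x₁, x₂, y, hx₁, hx₂, hy, h₁, h₂, h₁₂⟩ := QBroadcast.exists_real_rates hR₁ hR₂ hR₁₂
    obtain ⟨T₁, hT₁, hT₁1, hα₁, hβ₁⟩ := QBroadcast.exists_test_of_lt_dH hx₁
    obtain ⟨T₂, hT₂, hT₂1, hα₂, hβ₂⟩ := QBroadcast.exists_test_of_lt_dH hx₂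
    obtain ⟨ω, hω, hP, hr, hl, l, hly, hle⟩ := QBroadcast.exists_state_of_restrictedIMax_lt hy
    have hM : ∀ R : ℝ, 0 < ⌈(2 : ℝ) ^ R⌉₊ := fun R => Nat.ceil_pos.mpr (by positivity)
    obtain ⟨K₁, K₂, hK₁, hK₂, hu₁, hu₂, hv⟩ := QBroadcast.exists_block_sizes (v := 2 ^ l) hδ
      (by positivity) (by positivity) (by positivity) (hM R₁) (hM R₂)
      (QBroadcast.ceil_mul_le hδ (by linarith) h₁) (QBroadcast.ceil_mul_le hδ (by linarith) h₂)
      (QBroadcast.ceil_mul_ceil_mul_le hδ hδ2 (h₁₂.trans (sub_le_sub_left hly.le _)))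
    obtain ⟨code, hcode⟩ := QBroadcast.exists_code hδ (by positivity) hN hψ f₀ (hM R₁) (hM R₂) hK₁
      hK₂ hω hP hr hl hle hv hT₁ hT₁1 hα₁ hβ₁ hu₁ hT₂ hT₂1 hα₂ hβ₂ hu₂
    exact ⟨code, fun m₁ m₂ => (hcode m₁ m₂).trans
      (le_trans (by nlinarith [sq_nonneg ε]) hη)⟩
  · -- here the error bound exceeds one; `single` is a state on each of the registers `A₁`, `A₂`
    have hs : ∀ {A : Type u} [Fintype A] [DecidableEq A] (a : A),
        QBroadcast.IsState (Matrix.single a a (1 : ℂ)) := fun a =>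
      ⟨QBroadcast.single_posSemidef a, Matrix.trace_single_eq_same a 1⟩
    exact QBroadcast.isAchievable_of_one_le hN (hs a₁) (hs a₂) f₀
      (le_trans (by nlinarith [sq_nonneg ε]) hη)
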